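/- **Model.** Algorithms are while-programs with oracles on a random-access machine: finitely many program-addressed registers and an indirectly addressed memory, all holding rational numbers, with the exact operations $+,-,\times,\div$, the test $\le$, load/store through natural-number addresses, and oracle queries. The *number of operations* of a run counts every executed instruction, test and oracle query as $1$. The *bit cost* of a run charges every operation $1$ plus the binary lengths of all operands, results (including oracle answers) and addresses involved (logarithmic cost, polynomially equivalent to Turing machine time). Here $\langle z\rangle=1+\lceil\log_2(|z|+1)\rceil$ for $z\in\mathbb{Z}$, $\langle p/q\rangle=\langle p\rangle+\langle q\rangle$ in lowest terms, and the length of a vector or of a list of vectors is the sum of the lengths of its entries. **Definitions.** For a finite set $S\subset\mathbb{Z}^n$ let $\rho(S)=\max\{|x_i|: x\in S,\ 1\le i\le n\}$ (and $0$ if there is no such $x_i$). A *linear discrete optimization oracle* for $S$, queried on $w\in\mathbb{Z}^n$, returns some $x^*\in S$ with $wx^*=\max\{wx:x\in S\}$, or asserts that no such $x^*$ exists. A *comparison oracle* for $c:\mathbb{R}^d\to\mathbb{R}$, queried on rational vectors $x,y\in\mathbb{Q}^d$, asserts whether or not $c(x)\le c(y)$. A set $E$ *covers all edge-directions* of a polytope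 $P$ if for every edge ($1$-dimensional face) $[u,v]$ of $P$ it contains a nonzero scalar multiple of $u-v$. **Theorem.** For every fixed $d$ there is a strongly polynomial time algorithm that, given a finite set $S\subset\mathbb{Z}^n$ presented by a linear discrete optimization oracle, integer vectors $w_1,\dots,w_d\in\mathbb{Z}^n$, a finite set $E\subset\mathbb{Z}^n$ (given as a list of vectors) covering all edge-directions of $\mathrm{conv}(S)$, and a convex functional $c:\mathbb{R}^d\to\mathbb{R}$ presented by a comparison oracle, encoded as $[n,|E|;\langle\rho(S),w_1,\dots,w_d,E\rangle]$, solves the convex discrete optimization problem $$\max\{c(w_1x,\dots,w_dx):\ x\in S\}.$$ That is, for every $d$ there are one program and two polynomials $p,q$ such that on every such input, for all $n$, $S$, $w_1,\dots,w_d$, $E$, $c$ and all such oracles, where the program receives $n$, $|E|$, $w_1,\dots,w_d$, $E$ and access to the two oracles (but not $\rho(S)$), it halts; it outputs some $x\in S$ maximizing $c(w_1x,\dots,w_dx)$ over $S$, or asserts that no optimal solution exists if there is none; it performs at most $p(n+|E|)$ operations, including oracle queries; and its bit cost is at most $q\big(n+|E|+\langle\rho(S)\rangle+\sum_{i=1}^d\langle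 w_i\rangle+\sum_{e\in E}\langle e\rangle\big)$. -/

import Mathlib

namespace ConvexOpt

/-! ### Binary lengths -/

/-- Binary length of an integer: `1 + ⌈log₂ (|z| + 1)⌉`. -/
def intLen (z : ℤ) : ℕ := 1 + Nat.clog 2 (z.natAbs + 1)

/-- Binary length of a rational number in lowest terms. -/
def ratLen (r : ℚ) : ℕ := intLen r.num + intLen (r.den : ℤ)

/-- Binary length of a family of integer vectors (a matrix, or a listed set of vectors). -/
def famLen {k n : ℕ} (v : Fin k → Fin n → ℤ) : ℕ := ∑ i, ∑ j, intLen (v i j)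

/-! ### Oracle programs on a random-access machine

The machine has registers, which programs address directly by constants, and a memory, which
programs address indirectly through the contents of registers.  All cells hold rational numbers
and all arithmetic is exact; there is no rounding instruction.  Two costs are recorded for a run:
the number of executed operations (every instruction, test and oracle query counts as one), and
the bit cost (logarithmic cost: every operation costs one plus the binary lengths of all operands,
results and addresses which it touches).  The logarithmic cost is polynomially related to time on
a multitape Turing machine. -/

/-- The state of the machine. -/
structure State where
  reg : ℕ → ℚ
  mem : ℕ → ℚ

namespace State

/-- Assign a value to a register. -/
def setReg (s : State) (a : ℕ) (v : ℚ) : State := ⟨Function.update s.reg a v, s.mem⟩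

/-- Assign a value to a memory cell. -/
def setMem (s : State) (a : ℕ) (v : ℚ) : State := ⟨s.reg, Function.update s.mem a v⟩

/-- Write a vector into consecutive memory cells, the first of which is cell `a`. -/
def writeVec {k : ℕ} (s : State) (a : ℕ) (x : Fin k → ℚ) : State :=
  ⟨s.reg, fun i => if h : a ≤ i ∧ i < a + k then x ⟨i - a, by omega⟩ else s.mem i⟩

/-- The vector of the given length in consecutive memory cells, the first of which is cell `a`. -/
def readVec (s : State) (k a : ℕ) : Fin k → ℚ := fun j => s.mem (a + j)

end State

/-- The oracles of an instance: a linear optimization oracle on `ℤⁿ`, which answers with a point or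
with the assertion that there is no optimal solution, and a comparison oracle on rational points
of `ℝᵈ`. -/
structure Oracles (n d : ℕ) where
  lin : (Fin n → ℤ) → Option (Fin n → ℤ)
  cmp : (Fin d → ℚ) → (Fin d → ℚ) → Bool

/-- The arithmetic operations. -/
inductive ArithOp
  | add
  | sub
  | mul
  | div

/-- Exact rational arithmetic; division by zero has no result. -/
def ArithOp.eval : ArithOp → ℚ → ℚ → Option ℚ
  | .add, x, y => some (x + y)
  | .sub, x, y => some (x - y)
  | .mul, x, y => some (x * y)
  | .div, x, y => if y = 0 then none else some (x / y)

/-- Programs. -/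
inductive Prog
  /-- Do nothing. -/
  | skip
  /-- `reg a := z`. -/
  | const (a : ℕ) (z : ℤ)
  /-- `reg a := reg b ∘ reg c`. -/
  | arith (o : ArithOp) (a b c : ℕ)
  /-- `reg a := mem (reg b)`. -/
  | load (a b : ℕ)
  /-- `mem (reg a) := reg b`. -/
  | store (a b : ℕ)
  /-- Query the linear optimization oracle on the integer vector which starts at memory cell
  `reg b`.  Set `reg a` to `1` and write the answer from memory cell `reg c` on, or set `reg a`
  to `0` if the oracle asserts that there is no optimal solution. -/
  | linQuery (a b c : ℕ)
  /-- Query the comparison oracle on the pair of vectors which start at the memory cells `reg b`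
  and `reg c`; set `reg a` to `1` if the answer is yes, and to `0` otherwise. -/
  | cmpQuery (a b c : ℕ)
  /-- Sequential composition. -/
  | seq (P Q : Prog)
  /-- If `reg a ≤ reg b` then `P` else `Q`. -/
  | ite (a b : ℕ) (P Q : Prog)
  /-- While `reg a ≤ reg b` do `P`. -/
  | loop (a b : ℕ) (P : Prog)

/-- `Run O P s s' t b`: with the oracles `O`, the program `P` started in state `s` halts in
state `s'` after `t` operations with total bit cost `b`.  A program has no run if it does not
halt, divides by zero, uses a value that is not a natural number as an address, or queries the
linear optimization oracle on a vector that is not integer. -/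
inductive Run {n d : ℕ} (O : Oracles n d) : Prog → State → State → ℕ → ℕ → Prop
  | skip (s : State) : Run O .skip s s 0 0
  | const (s : State) (a : ℕ) (z : ℤ) :
      Run O (.const a z) s (s.setReg a z) 1 (1 + intLen a + ratLen z)
  | arith (s : State) (o : ArithOp) (a b c : ℕ) (v : ℚ)
      (hv : o.eval (s.reg b) (s.reg c) = some v) :
      Run O (.arith o a b c) s (s.setReg a v) 1
        (1 + intLen a + intLen b + intLen c + ratLen (s.reg b) + ratLen (s.reg c) + ratLen v)
  | load (s : State) (a b i : ℕ) (hi : s.reg b = (i : ℚ)) :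
      Run O (.load a b) s (s.setReg a (s.mem i)) 1
        (1 + intLen a + intLen b + intLen i + ratLen (s.mem i))
  | store (s : State) (a b i : ℕ) (hi : s.reg a = (i : ℚ)) :
      Run O (.store a b) s (s.setMem i (s.reg b)) 1
        (1 + intLen a + intLen b + intLen i + ratLen (s.reg b))
  | linQuery_some (s : State) (a b c i k : ℕ) (w x : Fin n → ℤ)
      (hi : s.reg b = (i : ℚ)) (hk : s.reg c = (k : ℚ))
      (hw : s.readVec n i = fun j => (w j : ℚ)) (hx : O.lin w = some x) :
      Run O (.linQuery a b c) s ((s.writeVec k fun j => (x j : ℚ)).setReg a 1) 1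
        (1 + intLen a + intLen b + intLen c + intLen i + intLen k
          + ∑ j : Fin n, (intLen (i + j : ℕ) + intLen (w j))
          + ∑ j : Fin n, (intLen (k + j : ℕ) + intLen (x j)))
  | linQuery_none (s : State) (a b c i k : ℕ) (w : Fin n → ℤ)
      (hi : s.reg b = (i : ℚ)) (hk : s.reg c = (k : ℚ))
      (hw : s.readVec n i = fun j => (w j : ℚ)) (hx : O.lin w = none) :
      Run O (.linQuery a b c) s (s.setReg a 0) 1
        (1 + intLen a + intLen b + intLen c + intLen i + intLen k
          + ∑ j : Fin n, (intLen (i + j : ℕ) + intLen (w j)))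
  | cmpQuery (s : State) (a b c i k : ℕ)
      (hi : s.reg b = (i : ℚ)) (hk : s.reg c = (k : ℚ)) :
      Run O (.cmpQuery a b c) s
        (s.setReg a (if O.cmp (s.readVec d i) (s.readVec d k) then 1 else 0)) 1
        (1 + intLen a + intLen b + intLen c + intLen i + intLen k
          + ∑ j : Fin d, (intLen (i + j : ℕ) + ratLen (s.readVec d i j))
          + ∑ j : Fin d, (intLen (k + j : ℕ) + ratLen (s.readVec d k j)))
  | seq (P Q : Prog) (s s₁ s₂ : State) (t₁ t₂ b₁ b₂ : ℕ)
      (h₁ : Run O P s s₁ t₁ b₁) (h₂ : Run O Q s₁ s₂ t₂ b₂) :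
      Run O (.seq P Q) s s₂ (t₁ + t₂) (b₁ + b₂)
  | ite_true (a b : ℕ) (P Q : Prog) (s s₁ : State) (t l : ℕ)
      (h : s.reg a ≤ s.reg b) (h₁ : Run O P s s₁ t l) :
      Run O (.ite a b P Q) s s₁ (1 + t)
        (1 + intLen a + intLen b + ratLen (s.reg a) + ratLen (s.reg b) + l)
  | ite_false (a b : ℕ) (P Q : Prog) (s s₁ : State) (t l : ℕ)
      (h : ¬ s.reg a ≤ s.reg b) (h₁ : Run O Q s s₁ t l) :
      Run O (.ite a b P Q) s s₁ (1 + t)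
        (1 + intLen a + intLen b + ratLen (s.reg a) + ratLen (s.reg b) + l)
  | loop_done (a b : ℕ) (P : Prog) (s : State) (h : ¬ s.reg a ≤ s.reg b) :
      Run O (.loop a b P) s s 1
        (1 + intLen a + intLen b + ratLen (s.reg a) + ratLen (s.reg b))
  | loop_step (a b : ℕ) (P : Prog) (s s₁ s₂ : State) (t₁ t₂ l₁ l₂ : ℕ)
      (h : s.reg a ≤ s.reg b) (h₁ : Run O P s s₁ t₁ l₁)
      (h₂ : Run O (.loop a b P) s₁ s₂ t₂ l₂) :
      Run O (.loop a b P) s s₂ (1 + t₁ + t₂)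
        (1 + intLen a + intLen b + ratLen (s.reg a) + ratLen (s.reg b) + l₁ + l₂)

/-! ### The convex discrete optimization problem -/

/-- The value `w x` of a linear functional at a point. -/
def dot {n : ℕ} (w x : Fin n → ℤ) : ℤ := ∑ j, w j * x j

/-- The objective function `x ↦ c (w₁ x, …, w_d x)`. -/
def objective {n d : ℕ} (c : (Fin d → ℝ) → ℝ) (w : Fin d → Fin n → ℤ) (x : Fin n → ℤ) : ℝ :=
  c fun i => (dot (w i) x : ℝ)

/-- The radius of a finite set: the largest absolute value of a coordinate of one of its points
(zero if there is none). -/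
def radius {n : ℕ} (S : Finset (Fin n → ℤ)) : ℕ :=
  S.sup fun x => Finset.univ.sup fun j => (x j).natAbs

/-- An integer vector as a point of `ℝⁿ`. -/
def toReal {n : ℕ} (x : Fin n → ℤ) : Fin n → ℝ := fun j => (x j : ℝ)

/-- The polytope `conv S` in `ℝⁿ`. -/
def polytope {n : ℕ} (S : Finset (Fin n → ℤ)) : Set (Fin n → ℝ) :=
  convexHull ℝ (toReal '' (S : Set (Fin n → ℤ)))

/-- `[u, v]` is an edge of the polytope `P`: a one-dimensional face of `P`, the faces being
the sets of maximizers over `P` of linear functionals. -/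
def IsEdge {n : ℕ} (P : Set (Fin n → ℝ)) (u v : Fin n → ℝ) : Prop :=
  u ≠ v ∧ IsExposed ℝ P (segment ℝ u v)

/-- `E` contains a direction, that is, a nonzero scalar multiple of `u - v`, of each edge
`[u, v]` of `P`. -/
def CoversEdgeDirections {n : ℕ} (E : Set (Fin n → ℤ)) (P : Set (Fin n → ℝ)) : Prop :=
  ∀ u v : Fin n → ℝ, IsEdge P u v → ∃ e ∈ E, ∃ t : ℝ, t ≠ 0 ∧ toReal e = t • (u - v)

/-- A linear discrete optimization oracle for `S`: queried on `w`, it returns a maximizer of `w`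
over `S` or asserts (`none`) that there is no maximizer. -/
def IsLinearOracle {n : ℕ} (S : Finset (Fin n → ℤ))
    (L : (Fin n → ℤ) → Option (Fin n → ℤ)) : Prop :=
  ∀ w, (∀ x, L w = some x → x ∈ S ∧ ∀ y ∈ S, dot w y ≤ dot w x) ∧
    (L w = none → ¬ ∃ x ∈ S, ∀ y ∈ S, dot w y ≤ dot w x)

/-- A comparison oracle for `c`: queried on `x` and `y`, it asserts whether or not
`c x ≤ c y`. -/
def IsComparisonOracle {d : ℕ} (c : (Fin d → ℝ) → ℝ)
    (C : (Fin d → ℚ) → (Fin d → ℚ) → Bool) : Prop :=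
  ∀ x y, C x y = true ↔ c (fun i => (x i : ℝ)) ≤ c (fun i => (y i : ℝ))

/-- The initial state: registers `0` and `1` hold `n` and the number `m` of listed vectors of `E`;
the memory holds, from cell `0` on, the entries of `w₁, …, w_d` followed by those of
`e₁, …, e_m`.  All other cells hold zero. -/
def inputState {n d m : ℕ} (w : Fin d → Fin n → ℤ) (e : Fin m → Fin n → ℤ) : State where
  reg := fun a => if a = 0 then (n : ℚ) else if a = 1 then (m : ℚ) else 0
  mem := fun a =>
    if h : a < (d + m) * n then
      (Fin.append w e (Fin.divNat ⟨a, h⟩) (Fin.modNat ⟨a, h⟩) : ℚ)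
    else 0

/-- The output of a halted program: register `0` holds `1` and the memory holds, from
cell `0` on, an optimal solution in `S`; or register `0` holds `0`, which asserts that no optimal
solution exists, and indeed none exists. -/
def OutputCorrect {n d : ℕ} (S : Finset (Fin n → ℤ)) (c : (Fin d → ℝ) → ℝ)
    (w : Fin d → Fin n → ℤ) (s : State) : Prop :=
  (s.reg 0 = 1 ∧ ∃ x ∈ S, s.readVec n 0 = (fun j => (x j : ℚ)) ∧
      ∀ y ∈ S, objective c w y ≤ objective c w x) ∨
    (s.reg 0 = 0 ∧ ¬ ∃ x ∈ S, ∀ y ∈ S, objective c w y ≤ objective c w x)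

/-- The program `A` solves the convex discrete optimization problem with `d` linear functionals,
over all finite sets presented by a linear discrete optimization oracle and endowed with a
list of vectors covering all edge-directions of the convex hull, in strongly polynomial time with
data encoded as `[n, |E|; ⟨ρ(S), w₁, …, w_d, E⟩]`: the number of operations, including oracle
queries, is polynomial in the special part `n, |E|` of the input, and the bit cost is polynomial
in the entire input.  The summands `n + m` in the latter account for the header of the input; they
are dominated by the other summands unless `d = 0` or `n = 0`.  The radius is not available to the
program.  The vectors `e` list the set `E` in any order. -/
def SolvesInStronglyPolynomialTime (d : ℕ) (A : Prog) : Prop :=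
  ∃ p q : Polynomial ℕ,
    ∀ (n m : ℕ) (S : Finset (Fin n → ℤ)) (w : Fin d → Fin n → ℤ) (e : Fin m → Fin n → ℤ)
      (c : (Fin d → ℝ) → ℝ) (O : Oracles n d),
      IsLinearOracle S O.lin →
      CoversEdgeDirections (Set.range e) (polytope S) →
      ConvexOn ℝ Set.univ c →
      IsComparisonOracle c O.cmp →
      ∃ (s : State) (t b : ℕ), Run O A (inputState w e) s t b ∧
        OutputCorrect S c w s ∧
        t ≤ p.eval (n + m) ∧
        b ≤ q.eval (n + m + intLen (radius S) + famLen w + famLen e)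

end ConvexOpt

namespace ConvexOpt

open Matrix

/-! ### Polyhedral geometry -/

/-! Let `M : ℝⁿ → ℝᵈ` be the linear map with rows `w_i`. A convex function on the finite set `M S`
is dominated by its values at vertices of `conv (M S)`, and each vertex `v` is the unique maximizer
of some functional `h` (`exists_exposed_ge`). It is therefore enough to find polynomially many `h`,
independent of `c`, that expose all vertices: the linear oracle queried on `∑ i, h i * w i` then
returns a point of `S` above the vertex.

The hyperplanes orthogonal to the vectors `M e`, `e ∈ E`, cut `ℝᵈ` into cells. Two functionals that
increase along the same edges of `conv S` have a common maximizer: move from one to the other and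
look at the first edge where the maximizer would change (`exists_common_maximizer`). As `E` covers
the edge-directions, the vertex selected by `h` depends only on the cell of `h`
(`mulVec_eq_of_isMax`).

To reach a cell by integer data, describe it by inequalities `1 ≤ ± g ⬝ᵥ h`, where `g` runs through
the nonzero `M e` and the unit vectors. The unit vectors make this polyhedron pointed, so it has a
basic solution (`exists_basic_feasible`). This solves a system `A h = b` with `d` generators as rows
and `b ∈ {1, -1}ᵈ`, and by Cramer's rule `det A • cramer A b` is an integral positive multiple of it
(`exists_candidate_eq_smul`). Hence the at most `(2 (m + d)) ^ d` candidates suffice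
(`exists_candidate_ge`), a polynomial number for fixed `d`.

The program runs through all pairs `(A, b)` by nested loops, keeps the direction with the best
values by means of the comparison oracle, and repeats the query for that direction at the end.
`Env.Ex` is a Hoare triple that counts operations and bounds the bit cost by a common price `K` per
operation. All stored numbers stay below one bound `2 ^ lam`, because candidates are values of fixed
expressions in the generators (`Setting.abs_cand_le`). The operation count involves only `n`, `m`
and constants depending on `d`, while `lam`, and with it the lengths of the numbers, enters only
`K`. Correctness and operation count are combined in `Setting.ex_main`, and the two polynomials come
from the `PolyBounded` lemmas. -/

/-- A linear functional can be perturbed so that it vanishes at no point of a given finite set and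
keeps its sign at the points of another one where it is positive. -/
theorem exists_generic {n : ℕ} {Z Y : Set (Fin n → ℝ)} (hZ : Z.Finite) (hY : Y.Finite)
    (hZ0 : ∀ z ∈ Z, z ≠ 0) (f : Fin n → ℝ) :
    ∃ a : Fin n → ℝ, (∀ z ∈ Z, a ⬝ᵥ z ≠ 0) ∧ ∀ y ∈ Y, 0 < f ⬝ᵥ y → 0 < a ⬝ᵥ y := by
  have hcont : ∀ z : Fin n → ℝ, Continuous fun a : Fin n → ℝ => a ⬝ᵥ z := fun z => by
    unfold dotProduct; fun_prop
  -- Hyperplanes orthogonal to nonzero vectors have open dense complements, so a generic `a` exists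
  -- in every open set. The conditions from `Y` define an open set that contains `f`.
  have hd : Dense (⋂ z ∈ Z, {a : Fin n → ℝ | a ⬝ᵥ z ≠ 0}) := by
    refine dense_biInter_of_isOpen (fun z _ => isOpen_ne_fun (hcont z) continuous_const)
      hZ.countable fun z hz => ?_
    let K : Submodule ℝ (Fin n → ℝ) :=
      { carrier := {a | a ⬝ᵥ z = 0}
        add_mem' := fun {a b} ha hb => by
          simp only [Set.mem_ofPred_eq] at *; rw [add_dotProduct, ha, hb, add_zero]
        zero_mem' := by simp
        smul_mem' := fun c a ha => by
          simp only [Set.mem_ofPred_eq] at *; rw [smul_dotProduct, ha, smul_zero] }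
    have : Dense ((K : Set (Fin n → ℝ))ᶜ) := by
      rw [← interior_eq_empty_iff_dense_compl, ← Set.not_nonempty_iff_eq_empty]
      intro h
      have htop := Submodule.eq_top_of_nonempty_interior' K h
      have hz' : z ∈ K := by rw [htop]; trivial
      exact hZ0 z hz (dotProduct_self_eq_zero.1 hz')
    exact this
  have ho : IsOpen (⋂ y ∈ Y, {a : Fin n → ℝ | 0 < f ⬝ᵥ y → 0 < a ⬝ᵥ y}) := by
    refine hY.isOpen_biInter fun y _ => ?_
    by_cases h : 0 < f ⬝ᵥ y
    · simpa [h] using isOpen_lt continuous_const (hcont y)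
    · simp [h]
  obtain ⟨a, ha, ha'⟩ := hd.exists_mem_open ho ⟨f, by simp⟩
  exact ⟨a, by simpa using ha, by simpa using ha'⟩

/-- The face of maximizers of a linear functional is an edge if these are collinear. -/
theorem exists_isEdge_of_collinear {n : ℕ} (T : Finset (Fin n → ℝ)) (g φ p q : Fin n → ℝ)
    (hp : p ∈ T) (hq : q ∈ T) (hpm : ∀ r ∈ T, g ⬝ᵥ r ≤ g ⬝ᵥ p) (hpq : g ⬝ᵥ p = g ⬝ᵥ q)
    (hφ : φ ⬝ᵥ p < φ ⬝ᵥ q)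
    (hcol : ∀ r ∈ T, g ⬝ᵥ r = g ⬝ᵥ p → ∃ τ : ℝ, r = p + τ • (q - p)) :
    ∃ u ∈ T, ∃ v ∈ T, IsEdge (convexHull ℝ (T : Set (Fin n → ℝ))) u v ∧ φ ⬝ᵥ v < φ ⬝ᵥ u ∧
      g ⬝ᵥ u = g ⬝ᵥ v := by
  classical
  set F := T.filter fun r => g ⬝ᵥ r = g ⬝ᵥ p with hF
  have hpF : p ∈ F := by simp [hF, hp]
  have hqF : q ∈ F := by simp [hF, hq, hpq]
  obtain ⟨v, hv, hvm⟩ := F.exists_min_image (fun r => φ ⬝ᵥ r) ⟨p, hpF⟩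
  obtain ⟨u, hu, hum⟩ := F.exists_max_image (fun r => φ ⬝ᵥ r) ⟨p, hpF⟩
  have hvu : φ ⬝ᵥ v < φ ⬝ᵥ u := (hvm p hpF).trans_lt (hφ.trans_le (hum q hqF))
  have hvF := (Finset.mem_filter.1 hv)
  have huF := (Finset.mem_filter.1 hu)
  -- On the line through `p` and `q` the functional `φ` is strictly increasing in the parameter `τ`,
  -- so its extreme points `v` and `u` in `F` enclose all of `F`.
  have hseg : ∀ r ∈ F, r ∈ segment ℝ u v := by
    intro r hr
    obtain ⟨τr, er⟩ := hcol r (Finset.mem_filter.1 hr).1 (Finset.mem_filter.1 hr).2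
    obtain ⟨τu, eu⟩ := hcol u huF.1 huF.2
    obtain ⟨τv, ev⟩ := hcol v hvF.1 hvF.2
    have h1 := hvm r hr
    have h2 := hum r hr
    have hδ : 0 < φ ⬝ᵥ (q - p) := by rw [dotProduct_sub]; linarith
    have fr : φ ⬝ᵥ r = φ ⬝ᵥ p + τr * φ ⬝ᵥ (q - p) := by
      rw [er, dotProduct_add, dotProduct_smul, smul_eq_mul]
    have fu : φ ⬝ᵥ u = φ ⬝ᵥ p + τu * φ ⬝ᵥ (q - p) := by
      rw [eu, dotProduct_add, dotProduct_smul, smul_eq_mul]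
    have fv : φ ⬝ᵥ v = φ ⬝ᵥ p + τv * φ ⬝ᵥ (q - p) := by
      rw [ev, dotProduct_add, dotProduct_smul, smul_eq_mul]
    have hvu' : τv < τu := by
      by_contra h; push Not at h
      have := mul_le_mul_of_nonneg_right h hδ.le
      linarith
    have hvr : τv ≤ τr := by
      by_contra h; push Not at h
      have := mul_lt_mul_of_pos_right h hδ
      linarith
    have hru : τr ≤ τu := by
      by_contra h; push Not at h
      have := mul_lt_mul_of_pos_right h hδ
      linarith
    have hne : τu - τv ≠ 0 := by linarith
    refine ⟨(τr - τv) / (τu - τv), (τu - τr) / (τu - τv), div_nonneg (by linarith) (by linarith),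
      div_nonneg (by linarith) (by linarith), by field_simp; ring, ?_⟩
    rw [er, eu, ev]
    ext i
    simp only [Pi.add_apply, Pi.smul_apply, Pi.sub_apply, smul_eq_mul]
    field_simp
    ring
  refine ⟨u, huF.1, v, hvF.1, ⟨?_, ?_⟩, hvu, huF.2.trans hvF.2.symm⟩
  · rintro rfl; exact lt_irrefl _ hvu
  · intro _
    refine ⟨LinearMap.toContinuousLinearMap
      (LinearMap.mk ⟨fun x => g ⬝ᵥ x, fun x y => dotProduct_add g x y⟩
        fun c x => by simp [dotProduct_smul]), ?_⟩
    have hle : ∀ x ∈ convexHull ℝ (T : Set (Fin n → ℝ)), g ⬝ᵥ x ≤ g ⬝ᵥ p := by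
      intro x hx
      have hc : Convex ℝ {x : Fin n → ℝ | g ⬝ᵥ x ≤ g ⬝ᵥ p} := by
        intro x hx y hy a b ha hb hab
        simp only [Set.mem_ofPred_eq] at *
        rw [dotProduct_add, dotProduct_smul, dotProduct_smul, smul_eq_mul, smul_eq_mul]
        calc _ ≤ a * g ⬝ᵥ p + b * g ⬝ᵥ p := by gcongr
          _ = _ := by rw [← add_mul, hab, one_mul]
      exact convexHull_min (fun r hr => hpm r hr) hc hx
    ext x
    simp only [LinearMap.coe_toContinuousLinearMap', LinearMap.coe_mk, AddHom.coe_mk,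
      Set.mem_ofPred_eq]
    constructor
    · intro hx
      have hxT : x ∈ convexHull ℝ (T : Set (Fin n → ℝ)) :=
        segment_subset_convexHull (Finset.mem_coe.2 huF.1) (Finset.mem_coe.2 hvF.1) hx
      refine ⟨hxT, fun y hy => ?_⟩
      obtain ⟨a, b, _, _, hab, rfl⟩ := hx
      rw [dotProduct_add, dotProduct_smul, dotProduct_smul, huF.2, hvF.2, smul_eq_mul, smul_eq_mul,
        ← add_mul, hab, one_mul]
      exact hle y hy
    · rintro ⟨hx, hxm⟩
      obtain ⟨w, hw0, hw1, rfl⟩ := Finset.mem_convexHull'.1 hx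
      have hgp := hxm p (subset_convexHull ℝ _ hp)
      -- The deficits `w y * (g ⬝ᵥ p - g ⬝ᵥ y)` are nonnegative with sum at most zero, so all
      -- vanish: a maximizer in the hull has no weight outside `F`.
      have hsum : ∑ y ∈ T, w y * (g ⬝ᵥ p - g ⬝ᵥ y) ≤ 0 := by
        have e1 : g ⬝ᵥ ∑ y ∈ T, w y • y = ∑ y ∈ T, w y * g ⬝ᵥ y := by
          rw [dotProduct_sum]; simp
        simp only [mul_sub, Finset.sum_sub_distrib, ← Finset.sum_mul, hw1, one_mul]
        linarith
      have hz : ∀ y ∈ T, w y * (g ⬝ᵥ p - g ⬝ᵥ y) = 0 := by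
        have h0 : ∀ y ∈ T, 0 ≤ w y * (g ⬝ᵥ p - g ⬝ᵥ y) := fun y hy =>
          mul_nonneg (hw0 y hy) (sub_nonneg.2 (hpm y hy))
        exact (Finset.sum_eq_zero_iff_of_nonneg h0).1 (le_antisymm hsum (Finset.sum_nonneg h0))
      have hoff : ∀ y ∈ T, y ∉ F → w y = 0 := by
        intro y hy hyF
        rcases mul_eq_zero.1 (hz y hy) with h | h
        · exact h
        · exact absurd (Finset.mem_filter.2 ⟨hy, (sub_eq_zero.1 h).symm⟩) hyF
      have s1 : ∑ y ∈ F, w y = 1 := by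
        rw [← hw1]
        exact Finset.sum_subset (Finset.filter_subset _ _) fun y hy hn => hoff y hy hn
      have s2 : ∑ y ∈ F, w y • y = ∑ y ∈ T, w y • y :=
        Finset.sum_subset (Finset.filter_subset _ _) fun y hy hn => by rw [hoff y hy hn, zero_smul]
      rw [← s2]
      exact (convex_segment u v).sum_mem (fun y hy => hw0 y (Finset.mem_filter.1 hy).1) s1 hseg

/-- If `f₀` increases along every edge along which `f₁` increases, then the two functionals have
a common maximizer. -/
theorem exists_common_maximizer {n : ℕ} (T : Finset (Fin n → ℝ)) (hT : T.Nonempty)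
    (f₀ f₁ : Fin n → ℝ)
    (h : ∀ u v, IsEdge (convexHull ℝ (T : Set (Fin n → ℝ))) u v →
      0 < f₁ ⬝ᵥ (u - v) → 0 < f₀ ⬝ᵥ (u - v)) :
    ∃ p ∈ T, (∀ r ∈ T, f₀ ⬝ᵥ r ≤ f₀ ⬝ᵥ p) ∧ ∀ r ∈ T, f₁ ⬝ᵥ r ≤ f₁ ⬝ᵥ p := by
  classical
  -- For points `p, q, r` these are combinations of `q - p` and `r - p` killed by `f₁`. If `a` kills
  -- none of the nonzero ones, the faces met below are collinear.
  set Z : Set (Fin n → ℝ) := (((T ×ˢ T ×ˢ T).image fun x =>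
    (f₁ ⬝ᵥ (x.2.2 - x.1)) • (x.2.1 - x.1) - (f₁ ⬝ᵥ (x.2.1 - x.1)) • (x.2.2 - x.1) :
      Finset (Fin n → ℝ)) : Set (Fin n → ℝ)) \ {0} with hZ
  set Y : Set (Fin n → ℝ) := (((T ×ˢ T).image fun x => x.1 - x.2 : Finset (Fin n → ℝ)) :
    Set (Fin n → ℝ)) with hY
  obtain ⟨a, haZ, haY⟩ := exists_generic (Z := Z) (Y := Y)
    ((Finset.finite_toSet _).subset Set.sdiff_subset) (Finset.finite_toSet _)
    (fun z hz => hz.2) f₀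
  have haY' : ∀ u ∈ T, ∀ v ∈ T, 0 < f₀ ⬝ᵥ (u - v) → 0 < a ⬝ᵥ (u - v) := by
    intro u hu v hv
    exact haY _ (Finset.mem_coe.2 (Finset.mem_image.2 ⟨(u, v), by simp [hu, hv], rfl⟩))
  obtain ⟨p, hp, hpm⟩ := T.exists_max_image (fun r => a ⬝ᵥ r) hT
  refine ⟨p, hp, fun r hr => ?_, ?_⟩
  · by_contra hc
    push Not at hc
    have := haY' r hr p hp (by rw [dotProduct_sub]; linarith)
    rw [dotProduct_sub] at this
    linarith [hpm r hr]
  by_contra hc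
  push Not at hc
  obtain ⟨r₀, hr₀, hr₀p⟩ := hc
  -- Ratio test: `t` is the first parameter at which `p` shares the maximum of `a + t • f₁` with a
  -- point where `f₁` is larger.
  obtain ⟨q, hq, hqm⟩ := (T.filter fun r => f₁ ⬝ᵥ p < f₁ ⬝ᵥ r).exists_min_image
    (fun r => (a ⬝ᵥ p - a ⬝ᵥ r) / (f₁ ⬝ᵥ r - f₁ ⬝ᵥ p)) ⟨r₀, by simp [hr₀, hr₀p]⟩
  obtain ⟨hqT, hqp⟩ := Finset.mem_filter.1 hq
  set t := (a ⬝ᵥ p - a ⬝ᵥ q) / (f₁ ⬝ᵥ q - f₁ ⬝ᵥ p) with ht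
  have ht0 : 0 ≤ t := div_nonneg (sub_nonneg.2 (hpm q hqT)) (by linarith)
  have htq : t * (f₁ ⬝ᵥ q - f₁ ⬝ᵥ p) = a ⬝ᵥ p - a ⬝ᵥ q := div_mul_cancel₀ _ (by linarith)
  have hg : ∀ r, (a + t • f₁) ⬝ᵥ r = a ⬝ᵥ r + t * f₁ ⬝ᵥ r := fun r => by
    rw [add_dotProduct, smul_dotProduct, smul_eq_mul]
  have hmax : ∀ r ∈ T, (a + t • f₁) ⬝ᵥ r ≤ (a + t • f₁) ⬝ᵥ p := by
    intro r hr
    rw [hg, hg]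
    rcases lt_or_ge (f₁ ⬝ᵥ p) (f₁ ⬝ᵥ r) with hlt | hge
    · have := hqm r (Finset.mem_filter.2 ⟨hr, hlt⟩)
      rw [le_div_iff₀ (by linarith)] at this
      linarith
    · have := mul_le_mul_of_nonneg_left hge ht0
      linarith [hpm r hr]
  have hpq : (a + t • f₁) ⬝ᵥ p = (a + t • f₁) ⬝ᵥ q := by rw [hg, hg]; linarith
  obtain ⟨u, hu, v, hv, hE, hvu, huv⟩ := exists_isEdge_of_collinear T (a + t • f₁) f₁ p q hp hqT
    hmax hpq hqp (by
      intro r hr hrp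
      refine ⟨f₁ ⬝ᵥ (r - p) / f₁ ⬝ᵥ (q - p), ?_⟩
      have hδ : f₁ ⬝ᵥ (q - p) ≠ 0 := by rw [dotProduct_sub]; linarith
      -- On the maximizing face `a = - t • f₁` holds for differences, so this combination is killed
      -- by `a` as well as by `f₁`; by the choice of `a` it is zero.
      have hz : (f₁ ⬝ᵥ (r - p)) • (q - p) - (f₁ ⬝ᵥ (q - p)) • (r - p) = 0 := by
        by_contra hne
        refine haZ _ ⟨Finset.mem_coe.2 (Finset.mem_image.2 ⟨(p, q, r), by simp [hp, hqT, hr], rfl⟩),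
          hne⟩ ?_
        rw [hg, hg] at hrp
        rw [hg, hg] at hpq
        simp only [dotProduct_sub, dotProduct_smul, smul_eq_mul]
        have e1 : a ⬝ᵥ q - a ⬝ᵥ p = - t * (f₁ ⬝ᵥ q - f₁ ⬝ᵥ p) := by linarith
        have e2 : a ⬝ᵥ r - a ⬝ᵥ p = - t * (f₁ ⬝ᵥ r - f₁ ⬝ᵥ p) := by linarith
        rw [e1, e2]; ring
      have hz' := congrArg (fun x => (f₁ ⬝ᵥ (q - p))⁻¹ • x) (sub_eq_zero.1 hz)
      simp only [smul_smul, inv_mul_cancel₀ hδ, one_smul] at hz'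
      rw [div_eq_inv_mul, hz']; abel)
  -- Along the edge found, `f₁`, hence `f₀`, hence `a` increases from `v` to `u`, although `a + t •
  -- f₁` with `0 ≤ t` is constant there.
  have h1 : 0 < f₁ ⬝ᵥ (u - v) := by rw [dotProduct_sub]; linarith
  have h2 := haY' u hu v hv (h u v hE h1)
  rw [dotProduct_sub] at h1 h2
  rw [hg, hg] at huv
  have := mul_nonneg ht0 h1.le
  linarith

/-! ### Exposed maximizers of convex functions and basic solutions of inequality systems -/

/-- A convex function is maximized over a finite set at a point which is the unique maximizer of
some linear functional. -/
theorem exists_exposed_ge {d : ℕ} (T : Finset (Fin d → ℝ)) (c : (Fin d → ℝ) → ℝ)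
    (hc : ConvexOn ℝ Set.univ c) (y : Fin d → ℝ) (hy : y ∈ T) :
    ∃ v ∈ T, c y ≤ c v ∧ ∃ h : Fin d → ℝ, ∀ u ∈ T, u ≠ v → h ⬝ᵥ u < h ⬝ᵥ v := by
  set Q := convexHull ℝ (T : Set (Fin d → ℝ)) with hQ
  have hfin : (T : Set (Fin d → ℝ)).Finite := T.finite_toSet
  have hsub : Q.extremePoints ℝ ⊆ T := extremePoints_convexHull_subset
  -- By Krein–Milman `y` lies in the hull of the extreme points, and a convex function is at least
  -- as large at one of these.
  have hyQ : y ∈ convexHull ℝ (Q.extremePoints ℝ) := by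
    have h1 := closure_convexHull_extremePoints (hfin.isCompact_convexHull ℝ)
      (convex_convexHull ℝ (T : Set (Fin d → ℝ)))
    have h2 : IsClosed (convexHull ℝ (Q.extremePoints ℝ)) :=
      (hfin.subset hsub).isClosed_convexHull ℝ
    rw [h2.closure_eq] at h1
    rw [h1]
    exact subset_convexHull ℝ _ hy
  obtain ⟨v, hv, hyv⟩ := hc.exists_ge_of_mem_convexHull (Set.subset_univ _) hyQ
  refine ⟨v, hsub hv, hyv, ?_⟩
  -- An extreme point lies outside the hull of the remaining points of `T`, which is compact, so it
  -- can be strictly separated from them.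
  have hv' := ((convex_convexHull ℝ _).mem_extremePoints_iff_mem_sdiff_convexHull_sdiff.1 hv).2
  have hv'' : v ∉ convexHull ℝ ((T : Set (Fin d → ℝ)) \ {v}) := fun hm =>
    hv' (convexHull_mono (Set.sdiff_subset_sdiff_left (subset_convexHull ℝ _)) hm)
  obtain ⟨f, s, hf, hs⟩ := geometric_hahn_banach_closed_point (convex_convexHull ℝ _)
    ((hfin.subset Set.sdiff_subset).isClosed_convexHull ℝ) hv''
  have hrep : ∀ x, (fun i => f fun j => if i = j then 1 else 0) ⬝ᵥ x = f x := by
    intro x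
    rw [← ContinuousLinearMap.coe_coe, LinearMap.pi_apply_eq_sum_univ (f : (Fin d → ℝ) →ₗ[ℝ] ℝ) x]
    simp [dotProduct, mul_comm]
  refine ⟨fun i => f fun j => if i = j then 1 else 0, fun u hu hne => ?_⟩
  rw [hrep, hrep]
  exact (hf u (subset_convexHull ℝ _ ⟨hu, hne⟩)).trans hs

/-- A polyhedron given by inequalities without a common nonzero kernel has a point at which the
tight inequalities have no common nonzero kernel. -/
theorem exists_basic_feasible {d : ℕ} (G : Finset (Fin d → ℝ))
    (hG : ∀ r : Fin d → ℝ, (∀ g ∈ G, g ⬝ᵥ r = 0) → r = 0)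
    (h : Fin d → ℝ) (hh : ∀ g ∈ G, 1 ≤ g ⬝ᵥ h) :
    ∃ h' : Fin d → ℝ, (∀ g ∈ G, 1 ≤ g ⬝ᵥ h') ∧
      ∀ r : Fin d → ℝ, (∀ g ∈ G, g ⬝ᵥ h' = 1 → g ⬝ᵥ r = 0) → r = 0 := by
  classical
  let K : (Fin d → ℝ) → Submodule ℝ (Fin d → ℝ) := fun h =>
    { carrier := {r | ∀ g ∈ G, g ⬝ᵥ h = 1 → g ⬝ᵥ r = 0}
      add_mem' := fun {a b} ha hb g hg e => by rw [dotProduct_add, ha g hg e, hb g hg e, add_zero]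
      zero_mem' := by simp
      smul_mem' := fun c a ha g hg e => by rw [dotProduct_smul, ha g hg e, smul_zero] }
  induction hk : Module.finrank ℝ (K h) using Nat.strong_induction_on generalizing h with
  | _ k ih =>
  by_cases hr : ∀ r ∈ K h, r = 0
  · exact ⟨h, hh, hr⟩
  push Not at hr
  obtain ⟨r₁, hr₁, hr₁0⟩ := hr
  -- Up to sign, a kernel vector of the tight constraints decreases some other constraint; moving
  -- along it keeps the tight ones tight.
  obtain ⟨r, hrK, g₀, hg₀, hneg⟩ : ∃ r ∈ K h, ∃ g ∈ G, g ⬝ᵥ r < 0 := by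
    have : ∃ g ∈ G, g ⬝ᵥ r₁ ≠ 0 := by
      by_contra hc; push Not at hc; exact hr₁0 (hG r₁ hc)
    obtain ⟨g, hg, hne⟩ := this
    rcases lt_or_gt_of_ne hne with hlt | hgt
    · exact ⟨r₁, hr₁, g, hg, hlt⟩
    · exact ⟨-r₁, (K h).neg_mem hr₁, g, hg, by rw [dotProduct_neg]; linarith⟩
  -- The longest feasible step, at whose end `g` becomes tight. As `g ⬝ᵥ r ≠ 0`, the kernel then
  -- shrinks strictly.
  obtain ⟨g, hg, hgm⟩ := (G.filter fun g => g ⬝ᵥ r < 0).exists_min_image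
    (fun g => (g ⬝ᵥ h - 1) / (-(g ⬝ᵥ r))) ⟨g₀, by simp [hg₀, hneg]⟩
  obtain ⟨hgG, hgr⟩ := Finset.mem_filter.1 hg
  set t := (g ⬝ᵥ h - 1) / (-(g ⬝ᵥ r)) with ht
  have ht0 : 0 ≤ t := div_nonneg (sub_nonneg.2 (hh g hgG)) (by linarith)
  have htg : t * (-(g ⬝ᵥ r)) = g ⬝ᵥ h - 1 := div_mul_cancel₀ _ (by linarith)
  have hval : ∀ g' : Fin d → ℝ, g' ⬝ᵥ (h + t • r) = g' ⬝ᵥ h + t * g' ⬝ᵥ r := fun g' => by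
    rw [dotProduct_add, dotProduct_smul, smul_eq_mul]
  have hfeas : ∀ g' ∈ G, 1 ≤ g' ⬝ᵥ (h + t • r) := by
    intro g' hg'
    rw [hval]
    rcases lt_or_ge (g' ⬝ᵥ r) 0 with hlt | hge
    · have := hgm g' (Finset.mem_filter.2 ⟨hg', hlt⟩)
      rw [le_div_iff₀ (by linarith)] at this
      linarith
    · have := mul_nonneg ht0 hge
      linarith [hh g' hg']
  have htight : g ⬝ᵥ (h + t • r) = 1 := by rw [hval]; linarith
  have hlt : K (h + t • r) < K h := by
    refine lt_of_le_of_ne ?_ ?_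
    · intro x hx g' hg' e
      refine hx g' hg' ?_
      rw [hval, e, hrK g' hg' e, mul_zero, add_zero]
    · intro he
      have : r ∈ K (h + t • r) := by rw [he]; exact hrK
      exact hgr.ne (this g hgG htight)
  exact ih _ (hk ▸ Submodule.finrank_lt_finrank_of_lt hlt) _ hfeas rfl

/-- If `h₀` and `h₁` have the same signs on the images of the edge directions and `v` is the unique
maximizer of `h₀` over the image of `T`, then the maximizers of `h₁` have image `v`. -/
theorem mulVec_eq_of_isMax {n d : ℕ} (T : Finset (Fin n → ℝ)) (M : Matrix (Fin d) (Fin n) ℝ)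
    (G : Finset (Fin d → ℝ))
    (hcov : ∀ u v, IsEdge (convexHull ℝ (T : Set (Fin n → ℝ))) u v → M *ᵥ (u - v) ≠ 0 →
      ∃ g ∈ G, ∃ t : ℝ, t • g = M *ᵥ (u - v))
    (h₀ h₁ v : Fin d → ℝ) (hv : ∃ p ∈ T, M *ᵥ p = v) (hh₀ : ∀ g ∈ G, 0 < g ⬝ᵥ h₀)
    (hh₁ : ∀ g ∈ G, 1 ≤ g ⬝ᵥ h₁)
    (huniq : ∀ u ∈ T, M *ᵥ u ≠ v → h₀ ⬝ᵥ (M *ᵥ u) < h₀ ⬝ᵥ v)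
    (x : Fin n → ℝ) (hx : x ∈ T) (hmax : ∀ r ∈ T, h₁ ⬝ᵥ (M *ᵥ r) ≤ h₁ ⬝ᵥ (M *ᵥ x)) :
    M *ᵥ x = v := by
  obtain ⟨p₀, hp₀, rfl⟩ := hv
  -- Any functional positive on `G` increases along the same edges as `h₀`, so the two share a
  -- maximizer, and uniqueness for `h₀` puts it above `v`.
  have key : ∀ h' : Fin d → ℝ, (∀ g ∈ G, 0 < g ⬝ᵥ h') →
      ∀ r ∈ T, h' ⬝ᵥ (M *ᵥ r) ≤ h' ⬝ᵥ (M *ᵥ p₀) := by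
    intro h' hh'
    obtain ⟨p, hp, hp0, hp1⟩ := exists_common_maximizer T ⟨x, hx⟩ (h₀ ᵥ* M) (h' ᵥ* M) (by
      intro u v hE hpos
      rw [← dotProduct_mulVec] at hpos ⊢
      have hne : M *ᵥ (u - v) ≠ 0 := by
        intro h; rw [h, dotProduct_zero] at hpos; exact lt_irrefl _ hpos
      obtain ⟨g, hg, t, ht⟩ := hcov u v hE hne
      rw [← ht, dotProduct_smul, smul_eq_mul, dotProduct_comm] at hpos ⊢
      exact mul_pos (pos_of_mul_pos_left hpos (hh' g hg).le) (hh₀ g hg))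
    have hpe : M *ᵥ p = M *ᵥ p₀ := by
      by_contra hne
      have h1 := huniq p hp hne
      have h2 := hp0 p₀ hp₀
      rw [← dotProduct_mulVec, ← dotProduct_mulVec] at h2
      linarith
    intro r hr
    have := hp1 r hr
    rwa [← dotProduct_mulVec, ← dotProduct_mulVec, hpe] at this
  by_contra hne
  -- `C` exceeds all `g ⬝ᵥ h₀`, so `C • h₁ - h₀` is still positive on `G` and maximal at `v`. A
  -- maximizer of `h₁` with another image would have a smaller `h₀`-value and hence a larger value
  -- of `C • h₁ - h₀`.
  set C := 1 + ∑ g ∈ G, g ⬝ᵥ h₀ with hC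
  have hCg : ∀ g ∈ G, g ⬝ᵥ h₀ < C := by
    intro g hg
    have := Finset.single_le_sum (f := fun g => g ⬝ᵥ h₀) (fun i hi => (hh₀ i hi).le) hg
    linarith
  have hC0 : 0 < C := by
    have := Finset.sum_nonneg fun i hi => (hh₀ i hi).le
    linarith
  have h1 := key (C • h₁ - h₀) (fun g hg => by
    rw [dotProduct_sub, dotProduct_smul, smul_eq_mul]
    have := mul_le_mul_of_nonneg_left (hh₁ g hg) hC0.le
    linarith [hCg g hg]) x hx
  simp only [sub_dotProduct, smul_dotProduct, smul_eq_mul] at h1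
  have h2 := mul_le_mul_of_nonneg_left (hmax p₀ hp₀) hC0.le
  linarith [huniq x hx hne]

/-! ### Candidate directions -/

/-- The images of the listed vectors under the linear functionals, and the unit vectors. -/
def generators {n d m : ℕ} (w : Fin d → Fin n → ℤ) (e : Fin m → Fin n → ℤ) :
    Set (Fin d → ℤ) :=
  {g | (∃ k, g = fun i => dot (w i) (e k)) ∨ ∃ j, g = Pi.single j 1}

/-- A positive multiple of the solution of the linear system with rows `A` and right hand
side `b`. -/
def candidate {d : ℕ} (A : Fin d → Fin d → ℤ) (b : Fin d → ℤ) : Fin d → ℤ :=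
  (Matrix.of A).det • (Matrix.of A).cramer b

/-- The linear combination of the functionals `w` with coefficients `h`. -/
def pull {n d : ℕ} (w : Fin d → Fin n → ℤ) (h : Fin d → ℤ) : Fin n → ℤ :=
  fun j => ∑ i, h i * w i j

theorem generators_finite {n d m : ℕ} (w : Fin d → Fin n → ℤ) (e : Fin m → Fin n → ℤ) :
    (generators w e).Finite := by
  refine ((Set.finite_range fun k => fun i => dot (w i) (e k)).union
    (Set.finite_range fun j : Fin d => (Pi.single j 1 : Fin d → ℤ))).subset ?_
  rintro g (⟨k, rfl⟩ | ⟨j, rfl⟩)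
  · exact Or.inl ⟨k, rfl⟩
  · exact Or.inr ⟨j, rfl⟩

theorem dot_pull {n d : ℕ} (w : Fin d → Fin n → ℤ) (h : Fin d → ℤ) (x : Fin n → ℤ) :
    dot (pull w h) x = ∑ i, h i * dot (w i) x := by
  simp only [dot, pull, Finset.sum_mul, Finset.mul_sum]
  rw [Finset.sum_comm]
  simp only [mul_assoc]

/-- A basic solution of a system of inequalities `1 ≤ g h` with `g` ranging over signed integer
vectors is a positive rational multiple of a candidate. -/
theorem exists_candidate_eq_smul {d : ℕ} (Γ : Set (Fin d → ℤ)) (G : Finset (Fin d → ℝ))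
    (hG : ∀ g ∈ G, ∃ γ ∈ Γ, ∃ s : ℤ, (s = 1 ∨ s = -1) ∧ g = (s : ℝ) • toReal γ)
    (h : Fin d → ℝ)
    (hh : ∀ r : Fin d → ℝ, (∀ g ∈ G, g ⬝ᵥ h = 1 → g ⬝ᵥ r = 0) → r = 0) :
    ∃ A : Fin d → Fin d → ℤ, (∀ l, A l ∈ Γ) ∧ ∃ b : Fin d → ℤ, (∀ l, b l = 1 ∨ b l = -1) ∧
      ∃ D : ℝ, 0 < D ∧ toReal (candidate A b) = D • h := by
  set tight : Set (Fin d → ℝ) := {g | g ∈ G ∧ g ⬝ᵥ h = 1} with htight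
  -- A functional vanishing on all tight rows is the product with a vector orthogonal to them, which
  -- is zero by assumption.
  have hspan : Submodule.span ℝ tight = ⊤ := by
    by_contra hne
    obtain ⟨f, hf, hle⟩ := Submodule.exists_le_ker_of_lt_top _ (lt_top_iff_ne_top.2 hne)
    have hrep : ∀ x, x ⬝ᵥ (fun i => f fun j => if i = j then 1 else 0) = f x := by
      intro x
      rw [LinearMap.pi_apply_eq_sum_univ f x]
      simp [dotProduct]
    have h0 := hh (fun i => f fun j => if i = j then 1 else 0) fun g hg hgh => by
      rw [hrep]
      exact hle (Submodule.subset_span ⟨hg, hgh⟩)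
    exact hf (LinearMap.ext fun x => by rw [← hrep, h0, dotProduct_zero]; rfl)
  obtain ⟨f, hf, -, hli⟩ := Submodule.exists_fun_fin_finrank_span_eq ℝ tight
  have hfr : Module.finrank ℝ (Submodule.span ℝ tight) = d := by
    rw [hspan, finrank_top]; simp
  have hli' := hli.comp (Fin.cast hfr.symm) (Fin.cast_injective _)
  choose A hA s hs hAs using fun l : Fin d => hG _ (hf (Fin.cast hfr.symm l)).1
  -- The tight equations read `A h = s`, because `s l * s l = 1`. Cramer's vector alone is `det A •
  -- h`; the second factor `det A` makes the multiple positive whatever the sign of the determinant.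
  refine ⟨A, hA, s, hs, ((Matrix.of A).det : ℝ) ^ 2, ?_, ?_⟩
  all_goals
    have hss : ∀ l, (s l : ℝ) * s l = 1 := fun l => by rcases hs l with h | h <;> simp [h]
    have hunit : IsUnit (Matrix.of fun i j => (s i : ℝ) * ((A i j : ℤ) : ℝ)) := by
      have hrow : (Matrix.of fun i j => (s i : ℝ) * ((A i j : ℤ) : ℝ)).row
          = f ∘ Fin.cast hfr.symm := funext fun i => (hAs i).symm
      rw [← Matrix.linearIndependent_rows_iff_isUnit, hrow]
      exact hli'
    rw [Matrix.isUnit_iff_isUnit_det] at hunit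
    have hdet : (Matrix.of fun i j => (s i : ℝ) * ((A i j : ℤ) : ℝ)).det
        = (∏ i, (s i : ℝ)) * ((Matrix.of A).map (Int.cast : ℤ → ℝ)).det :=
      Matrix.det_mul_column (fun i => (s i : ℝ)) ((Matrix.of A).map (Int.cast : ℤ → ℝ))
    have hdc : ((Matrix.of A).map (Int.cast : ℤ → ℝ)).det = ((Matrix.of A).det : ℝ) :=
      ((Int.castRingHom ℝ).map_det (Matrix.of A)).symm
    rw [hdet, hdc] at hunit
    have hne : ((Matrix.of A).det : ℝ) ≠ 0 := right_ne_zero_of_mul hunit.ne_zero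
  · positivity
  · have hinj : Function.Injective ((Matrix.of A).map (Int.cast : ℤ → ℝ)).mulVec := by
      rw [Matrix.mulVec_injective_iff_isUnit, Matrix.isUnit_iff_isUnit_det, hdc]
      exact hne.isUnit
    apply hinj
    have h1 : (Matrix.of A) *ᵥ candidate A s = ((Matrix.of A).det * (Matrix.of A).det) • s := by
      rw [candidate, Matrix.mulVec_smul, Matrix.mulVec_cramer, smul_smul]
    funext l
    have h2 := congrArg (Int.cast : ℤ → ℝ) (congrFun h1 l)
    have h3 := (hf (Fin.cast hfr.symm l)).2
    rw [hAs l, smul_dotProduct, smul_eq_mul] at h3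
    simp only [mulVec, dotProduct, Pi.smul_apply, smul_eq_mul, Int.cast_sum, Int.cast_mul,
      Matrix.of_apply] at h2
    rw [Matrix.mulVec_smul]
    simp only [mulVec, dotProduct, Pi.smul_apply, smul_eq_mul, Matrix.map_apply, Matrix.of_apply,
      toReal]
    rw [h2]
    simp only [dotProduct, toReal] at h3
    have h4 : ∑ j, (A l j : ℝ) * h j = s l := by
      have := congrArg (fun z => (s l : ℝ) * z) h3
      simp only [← mul_assoc, hss, one_mul, mul_one] at this
      exact this
    rw [h4, sq]

/-- Some candidate direction leads to a point which is at least as good as a given one. -/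
theorem exists_candidate_ge {n d m : ℕ} (S : Finset (Fin n → ℤ)) (w : Fin d → Fin n → ℤ)
    (e : Fin m → Fin n → ℤ) (c : (Fin d → ℝ) → ℝ) (hc : ConvexOn ℝ Set.univ c)
    (hE : CoversEdgeDirections (Set.range e) (polytope S))
    (x : (Fin n → ℤ) → Fin n → ℤ)
    (hx : ∀ u, x u ∈ S ∧ ∀ y ∈ S, dot u y ≤ dot u (x u)) (y : Fin n → ℤ) (hy : y ∈ S) :
    ∃ A : Fin d → Fin d → ℤ, (∀ l, A l ∈ generators w e) ∧
      ∃ b : Fin d → ℤ, (∀ l, b l = 1 ∨ b l = -1) ∧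
        objective c w y ≤ objective c w (x (pull w (candidate A b))) := by
  classical
  set M : Matrix (Fin d) (Fin n) ℝ := Matrix.of fun i j => (w i j : ℝ) with hM
  set T : Finset (Fin n → ℝ) := S.image toReal with hT
  have hMt : ∀ z : Fin n → ℤ, M *ᵥ toReal z = fun i => (dot (w i) z : ℝ) := by
    intro z; funext i; simp [hM, mulVec, dotProduct, dot, toReal]
  have hpoly : polytope S = convexHull ℝ (T : Set (Fin n → ℝ)) := by
    rw [polytope, hT, Finset.coe_image]
  obtain ⟨v, hv, hyv, h, hh⟩ := exists_exposed_ge (T.image fun z => M *ᵥ z) c hc (M *ᵥ toReal y)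
    (Finset.mem_image_of_mem _ (Finset.mem_image_of_mem _ hy))
  set Γ : Finset (Fin d → ℝ) :=
    ((generators_finite w e).toFinset.image toReal).filter (· ≠ 0) with hΓ
  -- Perturb `h` off all hyperplanes of the arrangement without losing `v` as its unique maximizer.
  obtain ⟨h₀, hh₀, hh₀'⟩ := exists_generic (Z := (Γ : Set (Fin d → ℝ)))
    (Y := (((T.image fun z => v - M *ᵥ z) : Finset (Fin d → ℝ)) : Set (Fin d → ℝ)))
    (Finset.finite_toSet _) (Finset.finite_toSet _)
    (fun z hz => (Finset.mem_filter.1 (Finset.mem_coe.1 hz)).2) h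
  have huniq : ∀ u ∈ T, M *ᵥ u ≠ v → h₀ ⬝ᵥ (M *ᵥ u) < h₀ ⬝ᵥ v := by
    intro u hu hne
    have h1 := hh _ (Finset.mem_image_of_mem _ hu) hne
    have h2 := hh₀' (v - M *ᵥ u) (Finset.mem_coe.2 (Finset.mem_image_of_mem _ hu))
      (by rw [dotProduct_sub]; linarith)
    rw [dotProduct_sub] at h2
    linarith
  set sg : (Fin d → ℝ) → ℤ := fun g => if 0 < h₀ ⬝ᵥ g then 1 else -1 with hsg
  set G : Finset (Fin d → ℝ) := Γ.image fun g => (sg g : ℝ) • g with hGdef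
  have hpos : ∀ g ∈ G, 0 < g ⬝ᵥ h₀ := by
    intro g hg
    obtain ⟨γ, hγ, rfl⟩ := Finset.mem_image.1 hg
    rw [smul_dotProduct, dotProduct_comm, smul_eq_mul]
    have := hh₀ γ (Finset.mem_coe.2 hγ)
    by_cases hp : 0 < h₀ ⬝ᵥ γ
    · simp [hsg, hp]
    · simp only [hsg, hp, if_false]
      push Not at hp
      have := lt_of_le_of_ne hp this
      push_cast
      linarith
  -- A multiple of `h₀` makes all the signed inequalities at least `1`; the factor only has to
  -- exceed each inverse `(g ⬝ᵥ h₀)⁻¹`.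
  obtain ⟨σ, hσ, hσG⟩ : ∃ σ : ℝ, 0 < σ ∧ ∀ g ∈ G, 1 ≤ g ⬝ᵥ (σ • h₀) := by
    refine ⟨1 + ∑ g ∈ G, (g ⬝ᵥ h₀)⁻¹, ?_, fun g hg => ?_⟩
    · have := Finset.sum_nonneg fun g hg => (inv_pos.2 (hpos g hg)).le
      linarith
    · have h1 := Finset.single_le_sum (f := fun g => (g ⬝ᵥ h₀)⁻¹)
        (fun i hi => (inv_pos.2 (hpos i hi)).le) hg
      rw [dotProduct_smul, smul_eq_mul]
      calc (1 : ℝ) = (g ⬝ᵥ h₀)⁻¹ * g ⬝ᵥ h₀ := (inv_mul_cancel₀ (hpos g hg).ne').symm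
        _ ≤ _ := by
          have := hpos g hg
          gcongr
          linarith
  -- The signed unit vectors belong to `G`, so only `0` is orthogonal to all of `G`, even if the
  -- images of `E` do not span.
  obtain ⟨h₁, hh₁, hker⟩ := exists_basic_feasible G (by
    intro r hr
    funext j
    have hj : toReal (Pi.single j 1 : Fin d → ℤ) = Pi.single j 1 := by
      funext i
      by_cases hij : i = j
      · subst hij; simp [toReal]
      · simp [toReal, hij]
    have hmem : (Pi.single j 1 : Fin d → ℝ) ∈ Γ := by
      rw [hΓ, Finset.mem_filter, ← hj]
      refine ⟨Finset.mem_image_of_mem _ ((Set.Finite.mem_toFinset _).2 (Or.inr ⟨j, rfl⟩)), ?_⟩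
      rw [hj]; simp
    have := hr _ (Finset.mem_image_of_mem _ hmem)
    rw [smul_dotProduct, single_one_dotProduct, smul_eq_mul] at this
    rcases mul_eq_zero.1 this with h | h
    · exfalso
      simp only [hsg] at h
      split_ifs at h <;> norm_num at h
    · exact h) _ hσG
  obtain ⟨A, hA, b, hb, D, hD, hAb⟩ := exists_candidate_eq_smul (generators w e) G (by
    intro g hg
    obtain ⟨γ, hγ, rfl⟩ := Finset.mem_image.1 hg
    obtain ⟨γ', hγ', rfl⟩ := Finset.mem_image.1 (Finset.mem_filter.1 hγ).1
    refine ⟨γ', (Set.Finite.mem_toFinset _).1 hγ', sg (toReal γ'), ?_, rfl⟩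
    simp only [hsg]
    split_ifs <;> simp) h₁ hker
  refine ⟨A, hA, b, hb, ?_⟩
  set q := x (pull w (candidate A b)) with hq
  obtain ⟨hqS, hqm⟩ := hx (pull w (candidate A b))
  rw [← hq] at hqS hqm
  have hval : ∀ z : Fin n → ℤ,
      (dot (pull w (candidate A b)) z : ℝ) = D * h₁ ⬝ᵥ (M *ᵥ toReal z) := by
    intro z
    rw [dot_pull, ← smul_eq_mul, ← smul_dotProduct, ← hAb, hMt]
    simp [dotProduct, toReal]
  have hfin : M *ᵥ toReal q = v := by
    refine mulVec_eq_of_isMax T M G ?_ h₀ h₁ v ?_ hpos hh₁ huniq (toReal q)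
      (Finset.mem_image_of_mem _ hqS) ?_
    -- An edge that `M` does not collapse is parallel to some `e k` with nonzero image, so its image
    -- is a multiple of an element of `G`.
    · intro u u' hedge hne
      obtain ⟨_, ⟨k, rfl⟩, t, ht, hek⟩ := hE u u' (by rwa [hpoly])
      have hg : M *ᵥ toReal (e k) = t • (M *ᵥ (u - u')) := by rw [hek, Matrix.mulVec_smul]
      have hg' : toReal (fun i => dot (w i) (e k)) = t • (M *ᵥ (u - u')) := by
        rw [← hg, hMt]; rfl
      have hmem : toReal (fun i => dot (w i) (e k)) ∈ Γ := by
        refine Finset.mem_filter.2 ⟨Finset.mem_image_of_mem _ ((Set.Finite.mem_toFinset _).2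
          (Or.inl ⟨k, rfl⟩)), ?_⟩
        rw [hg']
        exact smul_ne_zero ht hne
      refine ⟨_, Finset.mem_image_of_mem _ hmem,
        t⁻¹ * (sg (toReal fun i => dot (w i) (e k)) : ℝ), ?_⟩
      have hss : ∀ g, (sg g : ℝ) * sg g = 1 := by
        intro g; simp only [hsg]; split_ifs <;> simp
      rw [smul_smul, mul_assoc, hss, mul_one, hg', smul_smul, inv_mul_cancel₀ ht, one_smul]
    · obtain ⟨p, hp, hpv⟩ := Finset.mem_image.1 hv
      exact ⟨p, hp, hpv⟩
    · intro r hr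
      obtain ⟨z, hz, rfl⟩ := Finset.mem_image.1 hr
      have := hqm z hz
      have h2 : (dot (pull w (candidate A b)) z : ℝ) ≤ dot (pull w (candidate A b)) q := by
        exact_mod_cast this
      rw [hval, hval] at h2
      exact le_of_mul_le_mul_left h2 hD
  have e1 : objective c w y = c (M *ᵥ toReal y) := by rw [hMt]; rfl
  have e2 : objective c w q = c (M *ᵥ toReal q) := by rw [hMt]; rfl
  rw [e1, e2, hfin]
  exact hyv

/-! ### Integer configurations and structured programs -/

theorem intLen_le {z : ℤ} {k : ℕ} (h : |z| ≤ 2 ^ k) : intLen z ≤ k + 2 := by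
  have h1 : z.natAbs ≤ 2 ^ k := by zify; exact_mod_cast h
  have h2 : z.natAbs + 1 ≤ 2 ^ (k + 1) := by
    have := Nat.one_le_two_pow (n := k)
    rw [pow_succ]; omega
  have := Nat.clog_le_of_le_pow h2
  unfold intLen; omega

theorem intLen_natCast_le (a : ℕ) : intLen a ≤ a + 2 :=
  intLen_le (by rw [Nat.abs_cast]; exact_mod_cast Nat.lt_two_pow_self.le)

theorem ratLen_intCast (z : ℤ) : ratLen (z : ℚ) = intLen z + 2 := by
  have : intLen 1 = 2 := by unfold intLen; norm_num [Nat.clog]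
  simp [ratLen, this]

theorem ratLen_le {z : ℤ} {k : ℕ} (h : |z| ≤ 2 ^ k) : ratLen (z : ℚ) ≤ k + 4 := by
  rw [ratLen_intCast]
  have := intLen_le h
  omega

theorem abs_le_two_pow_intLen (z : ℤ) : |z| ≤ 2 ^ intLen z := by
  have h := Nat.le_pow_clog (b := 2) (by norm_num) (z.natAbs + 1)
  have h2 : z.natAbs ≤ 2 ^ intLen z := by
    unfold intLen; rw [pow_add]; omega
  zify at h2
  exact_mod_cast h2

/-! ### Variables and configurations -/

/-- Program variables: sixteen scalars, five vectors of length `d` and a `d × d` matrix. -/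
inductive Var (d : ℕ)
  | s (i : Fin 16)
  | f (k : Fin 5) (i : Fin d)
  | r (l i : Fin d)
  deriving DecidableEq

/-- The number of registers which hold variables. -/
def numVars (d : ℕ) : ℕ := 16 + 5 * d + d * d

/-- The register of a variable. -/
def Var.idx {d : ℕ} : Var d → ℕ
  | .s i => i
  | .f k i => 16 + (finProdFinEquiv (k, i) : ℕ)
  | .r l i => 16 + 5 * d + (finProdFinEquiv (l, i) : ℕ)

theorem Var.idx_lt {d : ℕ} (v : Var d) : v.idx < numVars d := by
  cases v with
  | s i => simp only [idx, numVars]; omega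
  | f k i => have := (finProdFinEquiv (k, i)).2; simp only [idx, numVars]; omega
  | r l i => have := (finProdFinEquiv (l, i)).2; simp only [idx, numVars]; omega

theorem Var.idx_injective {d : ℕ} : Function.Injective (Var.idx (d := d)) := by
  intro u v h
  cases u with
  | s i => cases v with
    | s j => simp only [idx] at h; rw [Fin.ext h]
    | f k j => simp only [idx] at h; omega
    | r l j => simp only [idx] at h; omega
  | f k i =>
    have hki := (finProdFinEquiv (k, i)).2
    cases v with
    | s j => simp only [idx] at h; omega
    | f k' j =>
      have := finProdFinEquiv.injective (Fin.ext (Nat.add_left_cancel h))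
      simp only [Prod.mk.injEq] at this
      rw [this.1, this.2]
    | r l j => simp only [idx] at h; omega
  | r l i => cases v with
    | s j => simp only [idx] at h; omega
    | f k' j =>
      have hki := (finProdFinEquiv (k', j)).2
      simp only [idx] at h; omega
    | r l' j =>
      have := finProdFinEquiv.injective (Fin.ext (Nat.add_left_cancel h))
      simp only [Prod.mk.injEq] at this
      rw [this.1, this.2]

/-- A configuration: integer values of the variables and of the memory cells. -/
structure Cfg (d : ℕ) where
  reg : Var d → ℤ
  mem : ℕ → ℤ

/-- Assign a value to a variable. -/
def Cfg.set {d : ℕ} (σ : Cfg d) (v : Var d) (z : ℤ) : Cfg d := ⟨Function.update σ.reg v z, σ.mem⟩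

/-- Assign a value to a memory cell. -/
def Cfg.setMem {d : ℕ} (σ : Cfg d) (i : ℕ) (z : ℤ) : Cfg d := ⟨σ.reg, Function.update σ.mem i z⟩

@[simp] theorem Cfg.set_mem {d : ℕ} (σ : Cfg d) (v : Var d) (z : ℤ) : (σ.set v z).mem = σ.mem := rfl

@[simp] theorem Cfg.set_reg_self {d : ℕ} (σ : Cfg d) (v : Var d) (z : ℤ) :
    (σ.set v z).reg v = z := Function.update_self _ _ _

@[simp] theorem Cfg.set_reg_of_ne {d : ℕ} (σ : Cfg d) {u v : Var d} (h : u ≠ v) (z : ℤ) :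
    (σ.set v z).reg u = σ.reg u := Function.update_of_ne h _ _

/-- The machine state `s` realizes the configuration `σ`, whose entries are at most `2 ^ k`. -/
structure Rep {d : ℕ} (k : ℕ) (σ : Cfg d) (s : State) : Prop where
  reg : ∀ v, s.reg v.idx = σ.reg v
  mem : ∀ i, s.mem i = σ.mem i
  reg_le : ∀ v, |σ.reg v| ≤ 2 ^ k
  mem_le : ∀ i, |σ.mem i| ≤ 2 ^ k

/-! ### Arithmetic expressions -/

/-- Arithmetic expressions in the variables. -/
inductive Exp (d : ℕ)
  | var (v : Var d)
  | const (z : ℤ)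
  | add (e₁ e₂ : Exp d)
  | sub (e₁ e₂ : Exp d)
  | mul (e₁ e₂ : Exp d)

namespace Exp

variable {d : ℕ}

/-- The value of an expression. -/
def eval (ρ : Var d → ℤ) : Exp d → ℤ
  | var v => ρ v
  | const z => z
  | add e₁ e₂ => e₁.eval ρ + e₂.eval ρ
  | sub e₁ e₂ => e₁.eval ρ - e₂.eval ρ
  | mul e₁ e₂ => e₁.eval ρ * e₂.eval ρ

/-- A measure for the growth of the value and for the size of an expression. -/
def weight : Exp d → ℕ
  | var _ => 1
  | const z => z.natAbs + 1
  | add e₁ e₂ => e₁.weight + e₂.weight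
  | sub e₁ e₂ => e₁.weight + e₂.weight
  | mul e₁ e₂ => e₁.weight + e₂.weight

theorem one_le_weight (e : Exp d) : 1 ≤ e.weight := by
  induction e <;> simp only [weight] <;> omega

/-- Code which evaluates an expression into register `a`, using registers from `a` on. -/
def code (a : ℕ) : Exp d → Prog
  | var v => .seq (.const a 0) (.arith .add a v.idx a)
  | const z => .const a z
  | add e₁ e₂ => .seq (e₁.code a) (.seq (e₂.code (a + 1)) (.arith .add a a (a + 1)))
  | sub e₁ e₂ => .seq (e₁.code a) (.seq (e₂.code (a + 1)) (.arith .sub a a (a + 1)))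
  | mul e₁ e₂ => .seq (e₁.code a) (.seq (e₂.code (a + 1)) (.arith .mul a a (a + 1)))

/-- For products the exponents simply add. For sums and differences the same bound works because
both bounds are at least `2` (this needs `1 ≤ k`), so that their sum is at most their product. -/
theorem abs_eval_le {k : ℕ} (hk : 1 ≤ k) {ρ : Var d → ℤ} (hρ : ∀ v, |ρ v| ≤ 2 ^ k) (e : Exp d) :
    |e.eval ρ| ≤ 2 ^ (k * e.weight) := by
  have two : ∀ a : ℕ, 1 ≤ a → (2 : ℤ) ≤ 2 ^ (k * a) := fun a ha => by
    calc (2 : ℤ) = 2 ^ 1 := by norm_num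
      _ ≤ _ := pow_le_pow_right₀ (by norm_num) (Nat.mul_pos hk ha)
  have hadd : ∀ (x y : ℤ) (a b : ℕ), 1 ≤ a → 1 ≤ b → |x| ≤ 2 ^ (k * a) → |y| ≤ 2 ^ (k * b) →
      |x| + |y| ≤ 2 ^ (k * (a + b)) := by
    intro x y a b ha hb hx hy
    rw [Nat.mul_add, pow_add]
    nlinarith [two a ha, two b hb]
  induction e with
  | var v => simpa [eval, weight] using hρ v
  | const z =>
    simp only [eval, weight]
    calc |z| = (z.natAbs : ℤ) := (Int.natCast_natAbs z).symm
      _ ≤ 2 ^ z.natAbs := by exact_mod_cast Nat.lt_two_pow_self.le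
      _ ≤ _ := pow_le_pow_right₀ (by norm_num)
        ((Nat.le_succ _).trans (Nat.le_mul_of_pos_left _ hk))
  | add e₁ e₂ h₁ h₂ =>
    exact (abs_add_le _ _).trans (hadd _ _ _ _ e₁.one_le_weight e₂.one_le_weight h₁ h₂)
  | sub e₁ e₂ h₁ h₂ =>
    exact (abs_sub _ _).trans (hadd _ _ _ _ e₁.one_le_weight e₂.one_le_weight h₁ h₂)
  | mul e₁ e₂ h₁ h₂ =>
    simp only [eval, weight]
    rw [abs_mul, Nat.mul_add, pow_add]
    gcongr

end Exp

/-! ### Cost parameters and the evaluation of expressions -/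

/-- Oracles together with the parameters of the cost estimates: variables and memory cells hold
integers of absolute value at most `2 ^ lam`, and expressions have weight at most `gam`. -/
structure Env (n d : ℕ) where
  O : Oracles n d
  lam : ℕ
  gam : ℕ
  one_le_lam : 1 ≤ lam
  three_le_gam : 3 ≤ gam
  dim_le : n ≤ 2 ^ lam
  len_le : d ≤ 2 ^ lam

namespace Env

variable {n d : ℕ} (E : Env n d)

/-- A bound for the binary lengths of all values, addresses and register numbers in use. -/
def mu : ℕ := E.lam * E.gam + numVars d + E.gam + 10

/-- A bound for the bit cost of one operation. -/
def K : ℕ := 1 + (6 + 4 * n + 4 * d) * E.mu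

/-- A bound for the number of operations of one simple statement. -/
def U : ℕ := 6 * E.gam + 4

theorem lam_le : E.lam ≤ E.lam * E.gam :=
  Nat.le_mul_of_pos_right _ (by have := E.three_le_gam; omega)

theorem six_mu_le : 1 + 6 * E.mu ≤ E.K := by
  unfold K
  have : 6 * E.mu ≤ (6 + 4 * n + 4 * d) * E.mu := Nat.mul_le_mul_right _ (by omega)
  omega

theorem ratLen_le_mu {z : ℤ} (h : |z| ≤ 2 ^ (E.lam * E.gam)) : ratLen (z : ℚ) ≤ E.mu := by
  have := ratLen_le h
  unfold mu; omega

theorem ratLen_le_mu' {z : ℤ} (h : |z| ≤ 2 ^ E.lam) : ratLen (z : ℚ) ≤ E.mu := by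
  have := ratLen_le h
  have := E.lam_le
  unfold mu; omega

theorem intLen_le_mu {z : ℤ} (h : |z| ≤ 2 ^ (E.lam + 1)) : intLen z ≤ E.mu := by
  have := intLen_le h
  have := E.lam_le
  unfold mu; omega

theorem intLen_reg_le_mu {a : ℕ} (h : a ≤ numVars d + E.gam + 1) : intLen a ≤ E.mu := by
  have := intLen_natCast_le a
  unfold mu; omega

theorem idx_le (v : Var d) : v.idx ≤ numVars d + E.gam + 1 := by
  have := v.idx_lt; omega

theorem run_const (s : State) (a : ℕ) (z : ℤ) (ha : a ≤ numVars d + E.gam + 1)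
    (hz : |z| ≤ 2 ^ (E.lam * E.gam)) :
    ∃ b, Run E.O (.const a z) s (s.setReg a z) 1 b ∧ b ≤ 1 * E.K := by
  refine ⟨_, Run.const s a z, ?_⟩
  have h1 := E.intLen_reg_le_mu ha
  have h2 := E.ratLen_le_mu hz
  have h3 := E.six_mu_le
  omega

theorem run_arith (s : State) (o : ArithOp) (a b c : ℕ) (x y v : ℤ)
    (ha : a ≤ numVars d + E.gam + 1) (hb : b ≤ numVars d + E.gam + 1)
    (hc : c ≤ numVars d + E.gam + 1)
    (hx : s.reg b = x) (hy : s.reg c = y) (hv : o.eval (x : ℚ) y = some (v : ℚ))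
    (hx' : |x| ≤ 2 ^ (E.lam * E.gam)) (hy' : |y| ≤ 2 ^ (E.lam * E.gam))
    (hv' : |v| ≤ 2 ^ (E.lam * E.gam)) :
    ∃ l, Run E.O (.arith o a b c) s (s.setReg a v) 1 l ∧ l ≤ 1 * E.K := by
  refine ⟨_, Run.arith s o a b c v (by rw [hx, hy, hv]), ?_⟩
  rw [hx, hy]
  have h1 := E.intLen_reg_le_mu ha
  have h2 := E.intLen_reg_le_mu hb
  have h3 := E.intLen_reg_le_mu hc
  have h4 := E.ratLen_le_mu hx'
  have h5 := E.ratLen_le_mu hy'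
  have h6 := E.ratLen_le_mu hv'
  have h7 := E.six_mu_le
  omega

theorem run_seq {P Q : Prog} {s s₁ s₂ : State} {t₁ t₂ : ℕ}
    (h₁ : ∃ b, Run E.O P s s₁ t₁ b ∧ b ≤ t₁ * E.K)
    (h₂ : ∃ b, Run E.O Q s₁ s₂ t₂ b ∧ b ≤ t₂ * E.K) :
    ∃ b, Run E.O (.seq P Q) s s₂ (t₁ + t₂) b ∧ b ≤ (t₁ + t₂) * E.K := by
  obtain ⟨b₁, r₁, c₁⟩ := h₁
  obtain ⟨b₂, r₂, c₂⟩ := h₂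
  exact ⟨_, Run.seq _ _ _ _ _ _ _ _ _ r₁ r₂, by rw [Nat.add_mul]; omega⟩

/-- The registers from `a` on form a stack: the second operand is evaluated one register higher, and
since every expression has weight at least one, the weight bounds the depth. Variables lie below
`numVars d` and survive. The summand `1` in the register bound is needed by `storeAt`, whose second
expression starts at `numVars d + 1`. -/
theorem run_code (ρ : Var d → ℤ) (hρ : ∀ v, |ρ v| ≤ 2 ^ E.lam) (e : Exp d) :
    ∀ (a : ℕ) (s : State), numVars d ≤ a → a + e.weight ≤ numVars d + E.gam + 1 →
      e.weight ≤ E.gam → (∀ v : Var d, s.reg v.idx = ρ v) →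
      ∃ s' t, (∃ b, Run E.O (e.code a) s s' t b ∧ b ≤ t * E.K) ∧ t + 1 ≤ 3 * e.weight ∧
        s'.reg a = e.eval ρ ∧ (∀ i < a, s'.reg i = s.reg i) ∧ s'.mem = s.mem := by
  have hval : ∀ e : Exp d, e.weight ≤ E.gam → |e.eval ρ| ≤ 2 ^ (E.lam * E.gam) := fun e he =>
    (e.abs_eval_le E.one_le_lam hρ).trans
      (pow_le_pow_right₀ (by norm_num) (Nat.mul_le_mul_left _ he))
  have hbin : ∀ (e₁ e₂ : Exp d) (o : ArithOp) (v : ℤ),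
      (∀ (a : ℕ) (s : State), numVars d ≤ a → a + e₁.weight ≤ numVars d + E.gam + 1 →
        e₁.weight ≤ E.gam → (∀ v : Var d, s.reg v.idx = ρ v) →
        ∃ s' t, (∃ b, Run E.O (e₁.code a) s s' t b ∧ b ≤ t * E.K) ∧ t + 1 ≤ 3 * e₁.weight ∧
          s'.reg a = e₁.eval ρ ∧ (∀ i < a, s'.reg i = s.reg i) ∧ s'.mem = s.mem) →
      (∀ (a : ℕ) (s : State), numVars d ≤ a → a + e₂.weight ≤ numVars d + E.gam + 1 →
        e₂.weight ≤ E.gam → (∀ v : Var d, s.reg v.idx = ρ v) →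
        ∃ s' t, (∃ b, Run E.O (e₂.code a) s s' t b ∧ b ≤ t * E.K) ∧ t + 1 ≤ 3 * e₂.weight ∧
          s'.reg a = e₂.eval ρ ∧ (∀ i < a, s'.reg i = s.reg i) ∧ s'.mem = s.mem) →
      o.eval (e₁.eval ρ : ℚ) (e₂.eval ρ : ℚ) = some (v : ℚ) → |v| ≤ 2 ^ (E.lam * E.gam) →
      ∀ (a : ℕ) (s : State), numVars d ≤ a →
        a + (e₁.weight + e₂.weight) ≤ numVars d + E.gam + 1 →
        e₁.weight + e₂.weight ≤ E.gam → (∀ v : Var d, s.reg v.idx = ρ v) →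
        ∃ s' t, (∃ b, Run E.O (.seq (e₁.code a) (.seq (e₂.code (a + 1))
            (.arith o a a (a + 1)))) s s' t b ∧ b ≤ t * E.K) ∧
          t + 1 ≤ 3 * (e₁.weight + e₂.weight) ∧
          s'.reg a = v ∧ (∀ i < a, s'.reg i = s.reg i) ∧ s'.mem = s.mem := by
    intro e₁ e₂ o v ih₁ ih₂ ho hv a s ha haw hw hs
    have w₁ := e₁.one_le_weight
    have w₂ := e₂.one_le_weight
    obtain ⟨s₁, t₁, r₁, ht₁, v₁, f₁, m₁⟩ := ih₁ a s ha (by omega) (by omega) hs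
    obtain ⟨s₂, t₂, r₂, ht₂, v₂, f₂, m₂⟩ := ih₂ (a + 1) s₁ (by omega) (by omega) (by omega)
      (fun v => by rw [f₁ _ (by have := v.idx_lt; omega), hs])
    have r₃ := E.run_arith s₂ o a a (a + 1) _ _ v (by omega) (by omega) (by omega)
      (by rw [f₂ a (by omega), v₁]) v₂ ho (hval e₁ (by omega)) (hval e₂ (by omega)) hv
    refine ⟨_, _, E.run_seq r₁ (E.run_seq r₂ r₃), by omega, ?_, ?_, ?_⟩
    · simp [State.setReg]
    · intro i hi
      simp only [State.setReg]
      rw [Function.update_of_ne (by omega), f₂ i (by omega), f₁ i hi]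
    · simp only [State.setReg]; rw [m₂, m₁]
  induction e with
  | var v =>
    intro a s ha haw hw hs
    have hne : v.idx ≠ a := by have := v.idx_lt; omega
    have hv : |ρ v| ≤ 2 ^ (E.lam * E.gam) := hval (.var v) hw
    have h0 : |(0 : ℤ)| ≤ 2 ^ (E.lam * E.gam) := by simp
    simp only [Exp.weight] at haw
    -- There is no move instruction; the variable is added to a cleared register.
    refine ⟨_, _, E.run_seq (E.run_const s a 0 (by omega) h0)
      (E.run_arith _ .add a v.idx a (ρ v) 0 (ρ v) (by omega) (E.idx_le v) (by omega) ?_ ?_ ?_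
        hv h0 hv), ?_, ?_, ?_, ?_⟩
    · simp [State.setReg, hne, hs]
    · simp [State.setReg]
    · simp [ArithOp.eval]
    · simp [Exp.weight]
    · simp [State.setReg, Exp.eval]
    · intro i hi
      simp [State.setReg, Function.update_of_ne hi.ne]
    · rfl
  | const z =>
    intro a s ha haw hw hs
    simp only [Exp.weight] at haw
    refine ⟨_, _, E.run_const s a z (by omega) (hval (.const z) hw), ?_, ?_, ?_, ?_⟩
    · simp only [Exp.weight]; omega
    · simp [State.setReg, Exp.eval]
    · intro i hi
      simp [State.setReg, Function.update_of_ne hi.ne]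
    · rfl
  | add e₁ e₂ h₁ h₂ =>
    intro a s ha haw hw hs
    exact hbin e₁ e₂ .add _ h₁ h₂ (by simp [ArithOp.eval, Exp.eval])
      (hval (.add e₁ e₂) hw) a s ha haw hw hs
  | sub e₁ e₂ h₁ h₂ =>
    intro a s ha haw hw hs
    exact hbin e₁ e₂ .sub _ h₁ h₂ (by simp [ArithOp.eval, Exp.eval])
      (hval (.sub e₁ e₂) hw) a s ha haw hw hs
  | mul e₁ e₂ h₁ h₂ =>
    intro a s ha haw hw hs
    exact hbin e₁ e₂ .mul _ h₁ h₂ (by simp [ArithOp.eval, Exp.eval])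
      (hval (.mul e₁ e₂) hw) a s ha haw hw hs

/-! ### A Hoare logic with operation count and bit cost -/

/-- Started in a state which realizes `σ`, the program halts after at most `t` operations in a
state which realizes a configuration with the property `Q`. -/
def Ex (P : Prog) (σ : Cfg d) (t : ℕ) (Q : Cfg d → Prop) : Prop :=
  ∀ s, Rep E.lam σ s → ∃ s' σ' t' b, Run E.O P s s' t' b ∧ Rep E.lam σ' s' ∧ Q σ' ∧ t' ≤ t ∧
    b ≤ t' * E.K

variable {E}

theorem Ex.mono {P : Prog} {σ : Cfg d} {t t' : ℕ} {Q Q' : Cfg d → Prop} (h : E.Ex P σ t Q)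
    (ht : t ≤ t') (hQ : ∀ σ', Q σ' → Q' σ') : E.Ex P σ t' Q' := by
  intro s hs
  obtain ⟨s', σ', t₁, b, r, hr, q, h1, h2⟩ := h s hs
  exact ⟨s', σ', t₁, b, r, hr, hQ _ q, h1.trans ht, h2⟩

/-- The bounds by `2 ^ lam` are part of `Rep`, so they may be assumed of the initial configuration.
-/
theorem Ex.of_bounded {P : Prog} {σ : Cfg d} {t : ℕ} {Q : Cfg d → Prop}
    (h : (∀ v, |σ.reg v| ≤ 2 ^ E.lam) → (∀ i, |σ.mem i| ≤ 2 ^ E.lam) → E.Ex P σ t Q) :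
    E.Ex P σ t Q := fun s hs => h hs.reg_le hs.mem_le s hs

theorem Ex.skip {σ : Cfg d} {t : ℕ} {Q : Cfg d → Prop} (h : Q σ) : E.Ex .skip σ t Q :=
  fun s hs => ⟨s, σ, 0, 0, Run.skip s, hs, h, Nat.zero_le _, Nat.zero_le _⟩

/-- The bit cost is compared with the actual number of operations, not with its bound `t`; this
makes both estimates additive. -/
theorem Ex.seq {P P' : Prog} {σ : Cfg d} {t₁ t₂ : ℕ} {R Q : Cfg d → Prop} (h₁ : E.Ex P σ t₁ R)
    (h₂ : ∀ σ', R σ' → E.Ex P' σ' t₂ Q) : E.Ex (.seq P P') σ (t₁ + t₂) Q := by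
  intro s hs
  obtain ⟨s₁, σ₁, u₁, b₁, r₁, hr₁, q₁, ht₁, hb₁⟩ := h₁ s hs
  obtain ⟨s₂, σ₂, u₂, b₂, r₂, hr₂, q₂, ht₂, hb₂⟩ := h₂ σ₁ q₁ s₁ hr₁
  exact ⟨s₂, σ₂, u₁ + u₂, b₁ + b₂, Run.seq _ _ _ _ _ _ _ _ _ r₁ r₂, hr₂, q₂, by omega,
    by rw [Nat.add_mul]; omega⟩

end Env

/-- `v := e`. -/
def assign {d : ℕ} (v : Var d) (e : Exp d) : Prog :=
  .seq (e.code (numVars d))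
    (.seq (.const (numVars d + 1) 0) (.arith .add v.idx (numVars d) (numVars d + 1)))

/-- `v := mem e`. -/
def loadAt {d : ℕ} (v : Var d) (e : Exp d) : Prog :=
  .seq (e.code (numVars d)) (.load v.idx (numVars d))

/-- `mem e := e'`. -/
def storeAt {d : ℕ} (e e' : Exp d) : Prog :=
  .seq (e.code (numVars d)) (.seq (e'.code (numVars d + 1)) (.store (numVars d) (numVars d + 1)))

/-- For `v = 0, …, u` do `P`. -/
def forLoop {d : ℕ} (v u : Var d) (P : Prog) : Prog :=
  .seq (assign v (.const 0))
    (.loop v.idx u.idx (.seq P (assign v (.add (.var v) (.const 1)))))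

/-- Sequential composition of a list of programs. -/
def seqs : List Prog → Prog
  | [] => .skip
  | P :: l => .seq P (seqs l)

theorem Rep.setReg {d k : ℕ} {σ : Cfg d} {s : State} (h : Rep k σ s) (v : Var d) (z : ℤ)
    (hz : |z| ≤ 2 ^ k) : Rep k (σ.set v z) (s.setReg v.idx z) where
  reg u := by
    by_cases hu : u = v
    · subst hu; simp [State.setReg]
    · simp [State.setReg, hu, Function.update_of_ne (Var.idx_injective.ne hu), h.reg]
  mem i := h.mem i
  reg_le u := by
    by_cases hu : u = v
    · subst hu; simpa using hz
    · simpa [hu] using h.reg_le u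
  mem_le i := h.mem_le i

theorem Rep.of_eq {d k : ℕ} {σ : Cfg d} {s s' : State} (h : Rep k σ s)
    (hr : ∀ v : Var d, s'.reg v.idx = s.reg v.idx) (hm : s'.mem = s.mem) : Rep k σ s' where
  reg v := by rw [hr, h.reg]
  mem i := by rw [hm, h.mem]
  reg_le := h.reg_le
  mem_le := h.mem_le

namespace Env

variable {n d : ℕ} {E : Env n d}

/-- Intermediate results may reach `2 ^ (lam * gam)`, which `mu` allows for. Only the assigned value
has to respect `2 ^ lam`. -/
theorem Ex.assign {v : Var d} {e : Exp d} {σ : Cfg d} {Q : Cfg d → Prop}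
    (he : e.weight ≤ E.gam) (hb : |e.eval σ.reg| ≤ 2 ^ E.lam)
    (hQ : Q (σ.set v (e.eval σ.reg))) : E.Ex (assign v e) σ E.U Q := by
  intro s hs
  have hb' : |e.eval σ.reg| ≤ 2 ^ (E.lam * E.gam) :=
    hb.trans (pow_le_pow_right₀ (by norm_num) E.lam_le)
  have h0 : |(0 : ℤ)| ≤ 2 ^ (E.lam * E.gam) := by simp
  obtain ⟨s₁, t₁, r₁, ht₁, v₁, f₁, m₁⟩ := E.run_code σ.reg hs.reg_le e (numVars d) s le_rfl
    (by omega) he hs.reg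
  have r₂ := E.run_const s₁ (numVars d + 1) 0 (by omega) h0
  obtain ⟨b, r, hbb⟩ := E.run_seq r₁ (E.run_seq r₂ (E.run_arith _ .add v.idx (numVars d)
    (numVars d + 1) (e.eval σ.reg) 0 (e.eval σ.reg) (E.idx_le v) (by omega) (by omega)
    (by simp [State.setReg, v₁]) (by simp [State.setReg]) (by simp [ArithOp.eval]) hb' h0 hb'))
  refine ⟨_, _, _, b, r, ?_, hQ, by unfold U; omega, hbb⟩
  refine Rep.setReg (s := s₁.setReg (numVars d + 1) ((0 : ℤ) : ℚ))
    (hs.of_eq (fun u => ?_) m₁) v _ hb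
  have := u.idx_lt
  simp only [State.setReg]
  rw [Function.update_of_ne (by omega), f₁ _ this]

theorem Ex.loadAt {v : Var d} {e : Exp d} {σ : Cfg d} {Q : Cfg d → Prop} (i : ℕ)
    (he : e.weight ≤ E.gam) (hi : e.eval σ.reg = i) (hib : |(i : ℤ)| ≤ 2 ^ E.lam)
    (hQ : Q (σ.set v (σ.mem i))) : E.Ex (loadAt v e) σ E.U Q := by
  intro s hs
  obtain ⟨s₁, t₁, r₁, ht₁, v₁, f₁, m₁⟩ := E.run_code σ.reg hs.reg_le e (numVars d) s le_rfl
    (by omega) he hs.reg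
  have hm : s₁.mem i = (σ.mem i : ℚ) := by rw [m₁, hs.mem]
  have r₂ : ∃ b, Run E.O (.load v.idx (numVars d)) s₁ (s₁.setReg v.idx (s₁.mem i)) 1 b ∧
      b ≤ 1 * E.K := by
    refine ⟨_, Run.load s₁ v.idx (numVars d) i (by rw [v₁, hi]; simp), ?_⟩
    have h1 := E.intLen_reg_le_mu (E.idx_le v)
    have h2 := E.intLen_reg_le_mu (a := numVars d) (by omega)
    have h3 := E.intLen_le_mu (hib.trans (pow_le_pow_right₀ (by norm_num) (Nat.le_succ _)))
    have h4 := E.ratLen_le_mu' (hs.mem_le i)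
    have h5 := E.six_mu_le
    rw [hm]
    omega
  rw [hm] at r₂
  obtain ⟨b, r, hbb⟩ := E.run_seq r₁ r₂
  refine ⟨_, _, _, b, r, ?_, hQ, by unfold U; omega, hbb⟩
  exact Rep.setReg (hs.of_eq (fun u => f₁ _ u.idx_lt) m₁) v _ (hs.mem_le i)

theorem Ex.storeAt {e e' : Exp d} {σ : Cfg d} {Q : Cfg d → Prop} (i : ℕ)
    (he : e.weight ≤ E.gam) (he' : e'.weight ≤ E.gam) (hi : e.eval σ.reg = i)
    (hib : |(i : ℤ)| ≤ 2 ^ E.lam) (hb : |e'.eval σ.reg| ≤ 2 ^ E.lam)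
    (hQ : Q (σ.setMem i (e'.eval σ.reg))) : E.Ex (storeAt e e') σ E.U Q := by
  intro s hs
  obtain ⟨s₁, t₁, r₁, ht₁, v₁, f₁, m₁⟩ := E.run_code σ.reg hs.reg_le e (numVars d) s le_rfl
    (by omega) he hs.reg
  obtain ⟨s₂, t₂, r₂, ht₂, v₂, f₂, m₂⟩ := E.run_code σ.reg hs.reg_le e' (numVars d + 1) s₁
    (by omega) (by omega) he' (fun v => by rw [f₁ _ v.idx_lt, hs.reg])
  have hi₂ : s₂.reg (numVars d) = (i : ℚ) := by rw [f₂ _ (by omega), v₁, hi]; simp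
  have r₃ : ∃ b, Run E.O (.store (numVars d) (numVars d + 1)) s₂
      (s₂.setMem i (s₂.reg (numVars d + 1))) 1 b ∧ b ≤ 1 * E.K := by
    refine ⟨_, Run.store s₂ (numVars d) (numVars d + 1) i hi₂, ?_⟩
    have h1 := E.intLen_reg_le_mu (a := numVars d) (by omega)
    have h2 := E.intLen_reg_le_mu (a := numVars d + 1) (by omega)
    have h3 := E.intLen_le_mu (hib.trans (pow_le_pow_right₀ (by norm_num) (Nat.le_succ _)))
    have h4 := E.ratLen_le_mu' hb
    have h5 := E.six_mu_le
    rw [v₂]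
    omega
  rw [v₂] at r₃
  obtain ⟨b, r, hbb⟩ := E.run_seq r₁ (E.run_seq r₂ r₃)
  refine ⟨_, _, _, b, r, ?_, hQ, by unfold U; omega, hbb⟩
  constructor
  · intro v
    have := v.idx_lt
    simp only [State.setMem, Cfg.setMem]
    rw [f₂ _ (by omega), f₁ _ this, hs.reg]
  · intro j
    simp only [State.setMem, Cfg.setMem]
    by_cases hj : j = i
    · subst hj; simp
    · rw [Function.update_of_ne hj, Function.update_of_ne hj, m₂, m₁, hs.mem]
  · exact hs.reg_le
  · intro j
    simp only [Cfg.setMem]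
    by_cases hj : j = i
    · subst hj; simpa using hb
    · rw [Function.update_of_ne hj]; exact hs.mem_le j

theorem sum_len_le {k : ℕ} (i : ℕ) (hk : k ≤ 2 ^ E.lam) (hi : |(i : ℤ)| ≤ 2 ^ E.lam)
    (f : Fin k → ℕ) (hf : ∀ j, f j ≤ E.mu) :
    ∑ j : Fin k, (intLen (i + j : ℕ) + f j) ≤ 2 * k * E.mu := by
  have : ∀ j : Fin k, intLen (i + j : ℕ) + f j ≤ 2 * E.mu := by
    intro j
    have h1 : intLen (i + j : ℕ) ≤ E.mu := by
      apply E.intLen_le_mu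
      rw [Nat.abs_cast] at hi ⊢
      have h2 := j.2
      have h3 : i ≤ 2 ^ E.lam := by exact_mod_cast hi
      -- Start and offset are each at most `2 ^ lam`, so addresses may need one more bit than stored
      -- values.
      have h4 : i + j ≤ 2 ^ (E.lam + 1) := by rw [pow_succ]; omega
      exact_mod_cast h4
    have := hf j
    omega
  calc _ ≤ ∑ _j : Fin k, 2 * E.mu := Finset.sum_le_sum fun j _ => this j
    _ = 2 * k * E.mu := by simp; ring

/-- Write a vector into consecutive memory cells of a configuration. -/
def _root_.ConvexOpt.Cfg.writeVec {k : ℕ} (σ : Cfg d) (a : ℕ) (x : Fin k → ℤ) : Cfg d :=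
  ⟨σ.reg, fun i => if h : a ≤ i ∧ i < a + k then x ⟨i - a, by omega⟩ else σ.mem i⟩

theorem Ex.linQuery_some {a b c : Var d} {σ : Cfg d} {Q : Cfg d → Prop} (i k : ℕ)
    (w x : Fin n → ℤ) (hi : σ.reg b = i) (hk : σ.reg c = k)
    (hw : ∀ j : Fin n, σ.mem (i + j) = w j) (hx : E.O.lin w = some x)
    (hxb : ∀ j, |x j| ≤ 2 ^ E.lam)
    (hQ : Q ((σ.writeVec k x).set a 1)) :
    E.Ex (.linQuery a.idx b.idx c.idx) σ 1 Q := by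
  intro s hs
  have hib : |(i : ℤ)| ≤ 2 ^ E.lam := hi ▸ hs.reg_le b
  have hkb : |(k : ℤ)| ≤ 2 ^ E.lam := hk ▸ hs.reg_le c
  refine ⟨_, (σ.writeVec k x).set a 1, 1, _, Run.linQuery_some s a.idx b.idx c.idx i k w x
    (by rw [hs.reg, hi]; simp) (by rw [hs.reg, hk]; simp) ?_ hx, ?_, hQ, le_rfl, ?_⟩
  · funext j
    simp only [State.readVec]
    rw [hs.mem, hw]
  · have : Rep E.lam (σ.writeVec k x) (s.writeVec k fun j => (x j : ℚ)) := by
      refine ⟨hs.reg, fun j => ?_, hs.reg_le, fun j => ?_⟩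
      · simp only [State.writeVec, Cfg.writeVec]
        split_ifs
        · rfl
        · exact hs.mem j
      · simp only [Cfg.writeVec]
        split_ifs
        · exact hxb _
        · exact hs.mem_le j
    have h := this.setReg a 1 (by simpa using one_le_pow₀ (by norm_num : (1 : ℤ) ≤ 2))
    exact_mod_cast h
  · have h1 := E.intLen_reg_le_mu (E.idx_le a)
    have h2 := E.intLen_reg_le_mu (E.idx_le b)
    have h3 := E.intLen_reg_le_mu (E.idx_le c)
    have h4 := E.intLen_le_mu (hib.trans (pow_le_pow_right₀ (by norm_num) (Nat.le_succ _)))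
    have h5 := E.intLen_le_mu (hkb.trans (pow_le_pow_right₀ (by norm_num) (Nat.le_succ _)))
    have hlen : ∀ z : ℤ, |z| ≤ 2 ^ E.lam → intLen z ≤ E.mu := fun z hz =>
      E.intLen_le_mu (hz.trans (pow_le_pow_right₀ (by norm_num) (Nat.le_succ _)))
    have h6 := sum_len_le (E := E) i E.dim_le hib (fun j : Fin n => intLen (w j))
      (fun j => hlen _ (hw j ▸ hs.mem_le _))
    have h7 := sum_len_le (E := E) k E.dim_le hkb (fun j : Fin n => intLen (x j))
      (fun j => hlen _ (hxb j))
    -- Query and answer have `n` cells each, and every cell costs an address and an entry: this is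
    -- the term `4 * n` in `K`.
    have h8 : E.K = 1 + 6 * E.mu + 2 * (2 * n * E.mu) + 4 * d * E.mu := by unfold K; ring
    omega

theorem Ex.linQuery_none {a b c : Var d} {σ : Cfg d} {Q : Cfg d → Prop} (i k : ℕ)
    (w : Fin n → ℤ) (hi : σ.reg b = i) (hk : σ.reg c = k)
    (hw : ∀ j : Fin n, σ.mem (i + j) = w j) (hx : E.O.lin w = none)
    (hQ : Q (σ.set a 0)) :
    E.Ex (.linQuery a.idx b.idx c.idx) σ 1 Q := by
  intro s hs
  have hib : |(i : ℤ)| ≤ 2 ^ E.lam := hi ▸ hs.reg_le b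
  have hkb : |(k : ℤ)| ≤ 2 ^ E.lam := hk ▸ hs.reg_le c
  refine ⟨_, σ.set a 0, 1, _, Run.linQuery_none s a.idx b.idx c.idx i k w
    (by rw [hs.reg, hi]; simp) (by rw [hs.reg, hk]; simp) ?_ hx, ?_, hQ, le_rfl, ?_⟩
  · funext j
    simp only [State.readVec]
    rw [hs.mem, hw]
  · have h := hs.setReg a 0 (by simp)
    exact_mod_cast h
  · have h1 := E.intLen_reg_le_mu (E.idx_le a)
    have h2 := E.intLen_reg_le_mu (E.idx_le b)
    have h3 := E.intLen_reg_le_mu (E.idx_le c)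
    have h4 := E.intLen_le_mu (hib.trans (pow_le_pow_right₀ (by norm_num) (Nat.le_succ _)))
    have h5 := E.intLen_le_mu (hkb.trans (pow_le_pow_right₀ (by norm_num) (Nat.le_succ _)))
    have h6 := sum_len_le (E := E) i E.dim_le hib (fun j : Fin n => intLen (w j))
      (fun j => E.intLen_le_mu ((hw j ▸ hs.mem_le _ : |w j| ≤ 2 ^ E.lam).trans
        (pow_le_pow_right₀ (by norm_num) (Nat.le_succ _))))
    have h8 : E.K = 1 + 6 * E.mu + 2 * (2 * n * E.mu) + 4 * d * E.mu := by unfold K; ring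
    omega

theorem Ex.cmpQuery {a b c : Var d} {σ : Cfg d} {Q : Cfg d → Prop} (i k : ℕ)
    (y z : Fin d → ℤ) (hi : σ.reg b = i) (hk : σ.reg c = k)
    (hy : ∀ j : Fin d, σ.mem (i + j) = y j) (hz : ∀ j : Fin d, σ.mem (k + j) = z j)
    (hQ : Q (σ.set a (if E.O.cmp (fun j => (y j : ℚ)) (fun j => (z j : ℚ)) then 1 else 0))) :
    E.Ex (.cmpQuery a.idx b.idx c.idx) σ 1 Q := by
  intro s hs
  have hib : |(i : ℤ)| ≤ 2 ^ E.lam := hi ▸ hs.reg_le b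
  have hkb : |(k : ℤ)| ≤ 2 ^ E.lam := hk ▸ hs.reg_le c
  have ey : s.readVec d i = fun j => (y j : ℚ) := by
    funext j; simp only [State.readVec]; rw [hs.mem, hy]
  have ez : s.readVec d k = fun j => (z j : ℚ) := by
    funext j; simp only [State.readVec]; rw [hs.mem, hz]
  refine ⟨_, _, 1, _, Run.cmpQuery s a.idx b.idx c.idx i k
    (by rw [hs.reg, hi]; simp) (by rw [hs.reg, hk]; simp), ?_, hQ, le_rfl, ?_⟩
  · rw [ey, ez]
    have h := hs.setReg a
      (if E.O.cmp (fun j => (y j : ℚ)) (fun j => (z j : ℚ)) then 1 else 0) (by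
        split_ifs
        · simpa using one_le_pow₀ (by norm_num : (1 : ℤ) ≤ 2)
        · simp)
    exact_mod_cast h
  · rw [ey, ez]
    beta_reduce
    have h1 := E.intLen_reg_le_mu (E.idx_le a)
    have h2 := E.intLen_reg_le_mu (E.idx_le b)
    have h3 := E.intLen_reg_le_mu (E.idx_le c)
    have h4 := E.intLen_le_mu (hib.trans (pow_le_pow_right₀ (by norm_num) (Nat.le_succ _)))
    have h5 := E.intLen_le_mu (hkb.trans (pow_le_pow_right₀ (by norm_num) (Nat.le_succ _)))
    have h6 := sum_len_le (E := E) i E.len_le hib (fun j : Fin d => ratLen (y j))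
      (fun j => E.ratLen_le_mu' (hy j ▸ hs.mem_le _))
    have h7 := sum_len_le (E := E) k E.len_le hkb (fun j : Fin d => ratLen (z j))
      (fun j => E.ratLen_le_mu' (hz j ▸ hs.mem_le _))
    have h8 : E.K = 1 + 6 * E.mu + 2 * (2 * d * E.mu) + 4 * n * E.mu := by unfold K; ring
    omega

theorem test_le {σ : Cfg d} {s : State} (hs : Rep E.lam σ s) (a b : Var d) :
    1 + intLen a.idx + intLen b.idx + ratLen (s.reg a.idx) + ratLen (s.reg b.idx) ≤ E.K := by
  rw [hs.reg, hs.reg]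
  have h1 := E.intLen_reg_le_mu (E.idx_le a)
  have h2 := E.intLen_reg_le_mu (E.idx_le b)
  have h3 := E.ratLen_le_mu' (hs.reg_le a)
  have h4 := E.ratLen_le_mu' (hs.reg_le b)
  have h5 := E.six_mu_le
  omega

theorem Ex.ite {a b : Var d} {P P' : Prog} {σ : Cfg d} {t : ℕ} {Q : Cfg d → Prop}
    (h₁ : σ.reg a ≤ σ.reg b → E.Ex P σ t Q) (h₂ : ¬ σ.reg a ≤ σ.reg b → E.Ex P' σ t Q) :
    E.Ex (.ite a.idx b.idx P P') σ (1 + t) Q := by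
  intro s hs
  have htest := test_le hs a b
  by_cases h : σ.reg a ≤ σ.reg b
  · obtain ⟨s', σ', t', l, r, hr, q, ht, hl⟩ := h₁ h s hs
    exact ⟨s', σ', 1 + t', _, Run.ite_true _ _ _ _ _ _ _ _
      (by rw [hs.reg, hs.reg]; exact_mod_cast h) r, hr, q, by omega, by rw [Nat.add_mul]; omega⟩
  · obtain ⟨s', σ', t', l, r, hr, q, ht, hl⟩ := h₂ h s hs
    exact ⟨s', σ', 1 + t', _, Run.ite_false _ _ _ _ _ _ _ _
      (by rw [hs.reg, hs.reg]; exact_mod_cast h) r, hr, q, by omega, by rw [Nat.add_mul]; omega⟩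

/-- Downward induction on `k`: `I k` holds before test number `k`, and each of the remaining `N - k`
rounds costs its body and one test. -/
theorem Ex.loop {a b : Var d} {P : Prog} {t : ℕ} {Q : Cfg d → Prop} (N : ℕ)
    (I : ℕ → Cfg d → Prop)
    (hlt : ∀ k < N, ∀ σ, I k σ → σ.reg a ≤ σ.reg b ∧ E.Ex P σ t (I (k + 1)))
    (hend : ∀ σ, I N σ → ¬ σ.reg a ≤ σ.reg b ∧ Q σ) :
    ∀ k ≤ N, ∀ σ, I k σ → E.Ex (.loop a.idx b.idx P) σ ((N - k) * (t + 1) + 1) Q := by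
  intro k hk
  induction hk using Nat.decreasingInduction with
  | self =>
    intro σ hσ s hs
    obtain ⟨h1, h2⟩ := hend σ hσ
    have htest := test_le hs a b
    exact ⟨s, σ, 1, _, Run.loop_done _ _ _ _ (by rw [hs.reg, hs.reg]; exact_mod_cast h1), hs, h2,
      by omega, by omega⟩
  | of_succ k hkN ih =>
    intro σ hσ s hs
    obtain ⟨h1, h2⟩ := hlt k hkN σ hσ
    have htest := test_le hs a b
    obtain ⟨s₁, σ₁, u₁, l₁, r₁, hr₁, q₁, ht₁, hl₁⟩ := h2 s hs
    obtain ⟨s₂, σ₂, u₂, l₂, r₂, hr₂, q₂, ht₂, hl₂⟩ := ih σ₁ q₁ s₁ hr₁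
    refine ⟨s₂, σ₂, 1 + u₁ + u₂, _, Run.loop_step _ _ _ _ _ _ _ _ _ _
      (by rw [hs.reg, hs.reg]; exact_mod_cast h1) r₁ r₂, hr₂, q₂, ?_, ?_⟩
    · have : (N - k) * (t + 1) = (N - (k + 1)) * (t + 1) + (t + 1) := by
        rw [← Nat.succ_mul]; congr 1; omega
      omega
    · rw [Nat.add_mul, Nat.add_mul]; omega

/-- The rule for counted loops. -/
theorem Ex.forLoop {v u : Var d} {P : Prog} {σ : Cfg d} {t : ℕ} {Q : Cfg d → Prop} (N : ℕ)
    (hN : (N : ℤ) ≤ 2 ^ E.lam) (I : ℕ → Cfg d → Prop)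
    (hstart : I 0 (σ.set v 0))
    (hI : ∀ k σ, I k σ → σ.reg v = k ∧ σ.reg u = N - 1)
    (hstep : ∀ k < N, ∀ σ, I k σ →
      E.Ex P σ t fun σ' => σ'.reg v = k ∧ I (k + 1) (σ'.set v (k + 1)))
    (hend : ∀ σ, I N σ → Q σ) :
    E.Ex (forLoop v u P) σ (N * (t + E.U + 1) + 1 + E.U) Q := by
  have hgam := E.three_le_gam
  have h := Ex.seq (E := E) (P := ConvexOpt.assign v (.const 0)) (σ := σ) (R := I 0) (Q := Q)
    (P' := .loop v.idx u.idx (.seq P (ConvexOpt.assign v (.add (.var v) (.const 1)))))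
    (t₁ := E.U) (t₂ := N * (t + E.U + 1) + 1)
    -- The bound `u` holds `N - 1`, so the only available test `v ≤ u` first fails at `v = N`. For
    -- `N = 0` it holds `-1` and the body is skipped.
    (Ex.assign (by simp [Exp.weight]; omega) (by simp [Exp.eval]) hstart) (fun σ' hσ' => by
      refine Ex.loop (t := t + E.U) N I ?_ ?_ 0 (Nat.zero_le _) σ' hσ'
      · intro k hk σ hσ
        obtain ⟨h1, h2⟩ := hI k σ hσ
        refine ⟨by rw [h1, h2]; omega, ?_⟩
        refine (hstep k hk σ hσ).seq fun σ' hσ' => ?_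
        have he : (Exp.add (.var v) (.const 1)).eval σ'.reg = k + 1 := by
          simp only [Exp.eval, hσ'.1]
        refine Ex.assign (by simpa [Exp.weight] using E.three_le_gam) ?_ (by rw [he]; exact hσ'.2)
        rw [he, abs_of_nonneg (by positivity)]
        exact (by exact_mod_cast hk : (k : ℤ) + 1 ≤ N).trans hN
      · intro σ hσ
        obtain ⟨h1, h2⟩ := hI N σ hσ
        exact ⟨by rw [h1, h2]; omega, hend σ hσ⟩)
  exact h.mono (by omega) fun _ h => h

end Env

/-- The invariant is indexed by the set of items already treated, so no order of the list has to be
remembered. -/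
theorem Env.Ex.seqs {n d : ℕ} {E : Env n d} {α : Type*} {P : α → Prog} {t : ℕ}
    {I : Set α → Cfg d → Prop} (l : List α)
    (h : ∀ a ∈ l, ∀ A σ, I A σ → E.Ex (P a) σ t (I (insert a A))) (A : Set α) (σ : Cfg d)
    (hσ : I A σ) : E.Ex (seqs (l.map P)) σ (l.length * t) (I (A ∪ {a | a ∈ l})) := by
  induction l generalizing A σ with
  | nil => exact Env.Ex.skip (by simpa using hσ)
  | cons a l ih =>
    refine ((h a (by simp) A σ hσ).seq (fun σ' hσ' =>
      ih (fun b hb => h b (by simp [hb])) _ σ' hσ')).mono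
      (by rw [List.length_cons, Nat.succ_mul]; omega) fun σ' hσ' => ?_
    convert hσ' using 1
    ext b
    simp [or_assoc, or_comm, or_left_comm]

/-! ### Expressions for candidate directions -/

namespace Exp

variable {d : ℕ}

/-- The sum of a list of expressions. -/
def sum (l : List (Exp d)) : Exp d := l.foldr add (const 0)

/-- The product of a list of expressions. -/
def prod (l : List (Exp d)) : Exp d := l.foldr mul (const 1)

theorem eval_sum (ρ : Var d → ℤ) (l : List (Exp d)) :
    (sum l).eval ρ = (l.map (eval ρ)).sum := by
  induction l with
  | nil => rfl
  | cons e l ih => rw [List.map_cons, List.sum_cons, ← ih]; rfl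

theorem eval_prod (ρ : Var d → ℤ) (l : List (Exp d)) :
    (prod l).eval ρ = (l.map (eval ρ)).prod := by
  induction l with
  | nil => rfl
  | cons e l ih => rw [List.map_cons, List.prod_cons, ← ih]; rfl

/-- The determinant of a matrix of expressions. -/
noncomputable def det (M : Fin d → Fin d → Exp d) : Exp d :=
  sum ((Finset.univ : Finset (Equiv.Perm (Fin d))).toList.map fun σ =>
    mul (const (Equiv.Perm.sign σ)) (prod ((List.finRange d).map fun i => M (σ i) i)))

/-- The Leibniz expansion has `d!` terms, a constant for fixed `d`, and avoids division, so all
values remain integers. -/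
theorem eval_det (ρ : Var d → ℤ) (M : Fin d → Fin d → Exp d) :
    (det M).eval ρ = (Matrix.of fun i j => (M i j).eval ρ).det := by
  rw [det, eval_sum, List.map_map, Finset.sum_map_toList, Matrix.det_apply']
  refine Finset.sum_congr rfl fun σ _ => ?_
  simp only [Function.comp, eval, eval_prod, List.map_map, Matrix.of_apply]
  congr 1

/-- The coordinate `i` of the candidate direction with the rows in the matrix of variables and
the right hand side `b`. -/
noncomputable def cand (b : Fin d → ℤ) (i : Fin d) : Exp d :=
  mul (det fun l j => var (.r l j))
    (det fun l j => if j = i then const (b l) else var (.r l j))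

theorem eval_cand (ρ : Var d → ℤ) (b : Fin d → ℤ) (i : Fin d) :
    (cand b i).eval ρ = candidate (fun l j => ρ (.r l j)) b i := by
  simp only [cand, eval, eval_det, candidate, Pi.smul_apply, smul_eq_mul, Matrix.cramer_apply]
  congr 2
  ext l j
  by_cases h : j = i
  · subst h; simp [eval]
  · simp [h, eval]

end Exp

/-- The right hand sides with entries `±1`. -/
noncomputable def signs (d : ℕ) : List (Fin d → ℤ) :=
  (Fintype.piFinset fun _ : Fin d => ({1, -1} : Finset ℤ)).toList

theorem mem_signs {d : ℕ} {b : Fin d → ℤ} : b ∈ signs d ↔ ∀ l, b l = 1 ∨ b l = -1 := by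
  simp [signs]

/-! ### The program -/

namespace Var

variable {d : ℕ}

/-- The dimension `n`. -/
abbrev dim : Var d := .s 0
/-- The number `m` of listed vectors. -/
abbrev num : Var d := .s 1
/-- The number `n - 1`. -/
abbrev dimPred : Var d := .s 2
/-- The number `m - 1`. -/
abbrev numPred : Var d := .s 3
/-- The address of the query vector. -/
abbrev addrB : Var d := .s 4
/-- The address of the answer of the linear optimization oracle. -/
abbrev addrX : Var d := .s 5
/-- The address of the first argument of the comparison oracle. -/
abbrev addrY : Var d := .s 6
/-- The address of the second argument of the comparison oracle. -/
abbrev addrZ : Var d := .s 7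
/-- A variable which is never assigned. -/
abbrev zero : Var d := .s 8
/-- The counter of innermost loops. -/
abbrev ctr : Var d := .s 9
abbrev tmp₁ : Var d := .s 10
abbrev tmp₂ : Var d := .s 11
abbrev acc : Var d := .s 12
abbrev flag : Var d := .s 13
/-- The current direction. -/
abbrev dir (i : Fin d) : Var d := .f 0 i
/-- The current value of the linear functionals. -/
abbrev val (i : Fin d) : Var d := .f 1 i
/-- The best value of the linear functionals. -/
abbrev bestVal (i : Fin d) : Var d := .f 2 i
/-- The best direction. -/
abbrev bestDir (i : Fin d) : Var d := .f 3 i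
/-- The loop counters. -/
abbrev idxOf (l : Fin d) : Var d := .f 4 l

/-- Scratch variables. -/
def IsScratch : Var d → Prop
  | s i => 9 ≤ i
  | _ => False

end Var

open Var Exp

/-- Address of the functional `w i`. -/
def rowAddr {d : ℕ} (i : Fin d) : Exp d := .mul (.const (i : ℕ)) (.var dim)

/-- `v := ∑ j < n, mem (a₁ + j) * mem (a₂ + j)`. -/
def dotProg {d : ℕ} (v : Var d) (a₁ a₂ : Exp d) : Prog :=
  .seq (assign (d := d) acc (.const 0)) (.seq
    (forLoop (d := d) ctr dimPred (.seq (loadAt tmp₁ (.add a₁ (.var ctr)))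
      (.seq (loadAt tmp₂ (.add a₂ (.var ctr)))
        (assign (d := d) acc (.add (.var acc) (.mul (.var tmp₁) (.var tmp₂)))))))
    (assign v (.var acc)))

/-- Evaluate the functionals `w` on the vector at address `a`. -/
def dotVec {d : ℕ} (u : Fin d → Var d) (a : Exp d) : Prog :=
  seqs ((List.finRange d).map fun i => dotProg (u i) (rowAddr i) a)

/-- Assign values to a vector of variables. -/
def assignVec {d : ℕ} (u : Fin d → Var d) (e : Fin d → Exp d) : Prog :=
  seqs ((List.finRange d).map fun i => assign (u i) (e i))

/-- Store a vector of variables in memory. -/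
def storeVec {d : ℕ} (a : Var d) (u : Fin d → Var d) : Prog :=
  seqs ((List.finRange d).map fun i : Fin d => storeAt (.add (.var a) (.const (i : ℕ))) (.var (u i)))

/-- Write the query vector for the current direction. -/
def buildQuery (d : ℕ) : Prog :=
  forLoop (d := d) ctr dimPred (.seq (assign (d := d) acc (.const 0)) (.seq
    (seqs ((List.finRange d).map fun i => .seq (loadAt tmp₁ (.add (rowAddr i) (.var ctr)))
      (assign acc (.add (.var acc) (.mul (.var (dir i)) (.var tmp₁))))))
    (storeAt (d := d) (.add (.var addrB) (.var ctr)) (.var acc))))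

/-- Query the linear optimization oracle on the current direction and evaluate the answer. -/
def probe (d : ℕ) : Prog :=
  .seq (buildQuery d) (.seq (.linQuery (flag (d := d)).idx (addrB (d := d)).idx (addrX (d := d)).idx)
    (dotVec (val (d := d)) (.var addrX)))

/-- Try the candidate direction with the right hand side `b`. -/
noncomputable def tryCand {d : ℕ} (b : Fin d → ℤ) : Prog :=
  .seq (assignVec dir (cand b)) (.seq (probe d) (.seq (storeVec addrY (val (d := d)))
    (.seq (storeVec addrZ (bestVal (d := d)))
      (.seq (.cmpQuery (flag (d := d)).idx (addrY (d := d)).idx (addrZ (d := d)).idx)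
        (.ite (flag (d := d)).idx (zero (d := d)).idx
          (.seq (assignVec (d := d) bestVal fun i => .var (val i))
            (assignVec (d := d) bestDir fun i => .var (dir i))) .skip)))))

/-- Try all candidate directions, where the rows in the list run through the generators. -/
noncomputable def nest {d : ℕ} : List (Fin d) → Prog
  | [] => seqs ((signs d).map tryCand)
  | l :: ls => .seq
      (forLoop (idxOf l) numPred
        (.seq (dotVec (.r l) (.mul (.add (.const (d : ℕ)) (.var (idxOf l))) (.var dim))) (nest ls)))
      (seqs ((List.finRange d).map fun j => .seq
        (assignVec (.r l) fun i => .const ((Pi.single j 1 : Fin d → ℤ) i)) (nest ls)))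

/-- The algorithm. -/
noncomputable def mainProg (d : ℕ) : Prog :=
  .seq (assign (d := d) dimPred (.sub (.var dim) (.const 1))) <|
  .seq (assign (d := d) numPred (.sub (.var num) (.const 1))) <|
  .seq (assign (d := d) addrB (.mul (.add (.const (d : ℕ)) (.var num)) (.var dim))) <|
  .seq (assign (d := d) addrX (.add (.var addrB) (.var dim))) <|
  .seq (assign (d := d) addrY (.add (.var addrX) (.var dim))) <|
  .seq (assign (d := d) addrZ (.add (.var addrY) (.const (d : ℕ)))) <|
  .seq (buildQuery d) <|
  .seq (.linQuery (flag (d := d)).idx (addrB (d := d)).idx (addrX (d := d)).idx) <|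
  .ite (flag (d := d)).idx (zero (d := d)).idx (assign (d := d) dim (.const 0)) <|
  .seq (dotVec (bestVal (d := d)) (.var addrX)) <|
  .seq (nest (List.finRange d)) <|
  .seq (assignVec (d := d) dir fun i => .var (bestDir i)) <|
  .seq (buildQuery d) <|
  .linQuery (dim (d := d)).idx (addrB (d := d)).idx (zero (d := d)).idx

/-! ### Correctness of the subprograms -/

theorem abs_sum_range_le {k n : ℕ} (hk : k ≤ n) (f : ℕ → ℤ) (C : ℤ)
    (h : ∀ i < n, |f i| ≤ C) : |∑ i ∈ Finset.range k, f i| ≤ n * C := by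
  rcases Nat.eq_zero_or_pos n with rfl | hn
  · obtain rfl : k = 0 := by omega
    simp
  have hC : 0 ≤ C := (abs_nonneg _).trans (h 0 hn)
  calc |∑ i ∈ Finset.range k, f i| ≤ ∑ i ∈ Finset.range k, |f i| := Finset.abs_sum_le_sum_abs _ _
    _ ≤ ∑ _i ∈ Finset.range k, C :=
      Finset.sum_le_sum fun i hi => h i ((Finset.mem_range.1 hi).trans_le hk)
    _ = k * C := by simp
    _ ≤ n * C := by gcongr

namespace Env

variable {n d : ℕ} {E : Env n d}

/-- When entry `i` is evaluated, other entries of `u` may already be overwritten. Hence `e i` must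
have the value `y i` in every valuation that agrees with `σ` away from `u`. -/
theorem Ex.assignVec {u : Fin d → Var d} (hu : Function.Injective u) {e : Fin d → Exp d}
    {σ : Cfg d} (y : Fin d → ℤ)
    (hw : ∀ i, (e i).weight ≤ E.gam)
    (he : ∀ i ρ, (∀ v, (∀ j, v ≠ u j) → ρ v = σ.reg v) → (e i).eval ρ = y i)
    (hb : ∀ i, |y i| ≤ 2 ^ E.lam) :
    E.Ex (assignVec u e) σ (d * E.U) fun σ' => σ'.mem = σ.mem ∧ (∀ i, σ'.reg (u i) = y i) ∧
      ∀ v, (∀ j, v ≠ u j) → σ'.reg v = σ.reg v := by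
  have h := Ex.seqs (E := E) (P := fun i => ConvexOpt.assign (u i) (e i)) (t := E.U)
    (I := fun A σ' => σ'.mem = σ.mem ∧ (∀ i ∈ A, σ'.reg (u i) = y i) ∧
      ∀ v, (∀ j, v ≠ u j) → σ'.reg v = σ.reg v) (List.finRange d) (by
      rintro i - A σ' ⟨h1, h2, h3⟩
      have hev : (e i).eval σ'.reg = y i := he i _ h3
      refine Ex.assign (hw i) (by rw [hev]; exact hb i) ?_
      rw [hev]
      refine ⟨h1, ?_, fun v hv => ?_⟩
      · intro j hj
        by_cases hji : j = i
        · subst hji; simp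
        · rw [Cfg.set_reg_of_ne _ (hu.ne hji)]
          exact h2 j (hj.resolve_left hji)
      · rw [Cfg.set_reg_of_ne _ (hv i), h3 v hv]) ∅ σ ⟨rfl, by simp, fun _ _ => rfl⟩
  refine h.mono (by simp) ?_
  rintro σ' ⟨h1, h2, h3⟩
  exact ⟨h1, fun i => h2 i (by simp), h3⟩

theorem Ex.storeVec {a : Var d} {u : Fin d → Var d} {σ : Cfg d} (p : ℕ)
    (ha : σ.reg a = p) (hp : (p : ℤ) + d ≤ 2 ^ E.lam) (hd : d + 1 ≤ E.gam) :
    E.Ex (storeVec a u) σ (d * E.U) fun σ' => σ'.reg = σ.reg ∧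
      (∀ i : Fin d, σ'.mem (p + i) = σ.reg (u i)) ∧
      ∀ q, (∀ i : Fin d, q ≠ p + i) → σ'.mem q = σ.mem q := by
  refine Ex.of_bounded fun hreg _ => ?_
  have h := Ex.seqs (E := E)
    (P := fun i : Fin d => ConvexOpt.storeAt (.add (.var a) (.const (i : ℕ))) (.var (u i))) (t := E.U)
    (I := fun A σ' => σ'.reg = σ.reg ∧ (∀ i ∈ A, σ'.mem (p + (i : Fin d)) = σ.reg (u i)) ∧
      ∀ q, (∀ i : Fin d, q ≠ p + i) → σ'.mem q = σ.mem q) (List.finRange d) (by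
      rintro i - A σ' ⟨h1, h2, h3⟩
      have hi := i.2
      refine Ex.storeAt (p + i) (by simp only [weight, Int.natAbs_natCast]; omega)
        (by simp only [weight]; omega) (by simp only [eval, h1, ha]; push_cast; rfl)
        ?_ (by simp only [eval, h1]; exact hreg _) ?_
      · rw [Nat.abs_cast]; push_cast; omega
      · simp only [eval, h1]
        refine ⟨h1, fun j hj => ?_, fun q hq => ?_⟩
        · by_cases hji : j = i
          · subst hji; simp [Cfg.setMem]
          · have : p + (j : ℕ) ≠ p + i := fun h => hji (Fin.ext (by omega))
            simp only [Cfg.setMem, Function.update_of_ne this]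
            exact h2 j (hj.resolve_left hji)
        · simp only [Cfg.setMem, Function.update_of_ne (hq i)]
          exact h3 q hq) ∅ σ ⟨rfl, by simp, fun _ _ => rfl⟩
  refine h.mono (by simp) ?_
  rintro σ' ⟨h1, h2, h3⟩
  exact ⟨h1, fun i => h2 i (by simp), h3⟩

/-- A bound for the number of operations of `dotProg`. -/
def tDot (E : Env n d) : ℕ := E.U + ((n * ((E.U + (E.U + E.U)) + E.U + 1) + 1 + E.U) + E.U)

/-- The address expressions are evaluated again in every round while scratch variables change, so
their values must not depend on these. The bound `C` for single products keeps every partial sum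
storable. -/
theorem Ex.dotProg {v : Var d} {a₁ a₂ : Exp d} {σ : Cfg d} (p₁ p₂ : ℕ) (C : ℤ)
    (hn : σ.reg dimPred = n - 1)
    (hw₁ : a₁.weight + 1 ≤ E.gam) (hw₂ : a₂.weight + 1 ≤ E.gam)
    (h₁ : ∀ ρ, (∀ v, ¬ v.IsScratch → ρ v = σ.reg v) → a₁.eval ρ = p₁)
    (h₂ : ∀ ρ, (∀ v, ¬ v.IsScratch → ρ v = σ.reg v) → a₂.eval ρ = p₂)
    (hp₁ : (p₁ : ℤ) + n ≤ 2 ^ E.lam) (hp₂ : (p₂ : ℤ) + n ≤ 2 ^ E.lam)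
    (hC : ∀ i < n, |σ.mem (p₁ + i) * σ.mem (p₂ + i)| ≤ C) (hnC : n * C ≤ 2 ^ E.lam) :
    E.Ex (dotProg v a₁ a₂) σ E.tDot fun σ' => σ'.mem = σ.mem ∧
      σ'.reg v = ∑ i ∈ Finset.range n, σ.mem (p₁ + i) * σ.mem (p₂ + i) ∧
      ∀ u, ¬ u.IsScratch → u ≠ v → σ'.reg u = σ.reg u := by
  have hgam := E.three_le_gam
  have hsum : ∀ k ≤ n, |∑ i ∈ Finset.range k, σ.mem (p₁ + i) * σ.mem (p₂ + i)| ≤ 2 ^ E.lam :=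
    fun k hk => (abs_sum_range_le hk _ C hC).trans hnC
  refine Ex.seq (R := fun σ' => σ'.mem = σ.mem ∧ σ'.reg acc = 0 ∧
      ∀ u, ¬ u.IsScratch → σ'.reg u = σ.reg u)
    (Ex.assign (by simp only [weight]; omega) (by simp [eval]) ⟨rfl, by simp [eval], ?_⟩) ?_
  · intro u hu
    rw [Cfg.set_reg_of_ne _ (by rintro rfl; simp [IsScratch] at hu)]
  rintro σ₁ ⟨m₁, z₁, f₁⟩
  refine Ex.seq (R := fun σ' => σ'.mem = σ.mem ∧
      σ'.reg acc = ∑ i ∈ Finset.range n, σ.mem (p₁ + i) * σ.mem (p₂ + i) ∧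
      ∀ u, ¬ u.IsScratch → σ'.reg u = σ.reg u) ?_ ?_
  · refine Ex.forLoop n (by exact_mod_cast E.dim_le) (fun k σ' => σ'.reg ctr = k ∧
      σ'.mem = σ.mem ∧
      σ'.reg acc = ∑ i ∈ Finset.range k, σ.mem (p₁ + i) * σ.mem (p₂ + i) ∧
      ∀ u, ¬ u.IsScratch → σ'.reg u = σ.reg u) ?_ ?_ ?_ ?_
    · refine ⟨by simp, m₁, by simp [z₁], fun u hu => ?_⟩
      rw [Cfg.set_reg_of_ne _ (by rintro rfl; simp [IsScratch] at hu), f₁ u hu]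
    · rintro k σ' ⟨hk, -, -, hf⟩
      exact ⟨hk, by rw [hf _ (by simp [IsScratch]), hn]⟩
    · rintro k hkn σ' ⟨hk, hm, hacc, hf⟩
      have hbd : ∀ p : ℕ, (p : ℤ) + n ≤ 2 ^ E.lam → |((p + k : ℕ) : ℤ)| ≤ 2 ^ E.lam := by
        intro p hp; rw [Nat.abs_cast]; push_cast; omega
      refine Ex.seq (R := fun σ'' => σ'' = σ'.set tmp₁ (σ.mem (p₁ + k)))
        (Ex.loadAt (p₁ + k) (by simp only [weight]; omega) ?_ (hbd _ hp₁) (by rw [hm])) ?_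
      · simp only [eval, hk, h₁ _ hf]; push_cast; rfl
      rintro _ rfl
      have hf' : ∀ u : Var d, ¬ u.IsScratch →
          (σ'.set tmp₁ (σ.mem (p₁ + k))).reg u = σ.reg u := fun u hu => by
        rw [Cfg.set_reg_of_ne _ (by rintro rfl; simp [IsScratch] at hu), hf u hu]
      refine Ex.seq (R := fun σ'' => σ'' = (σ'.set tmp₁ (σ.mem (p₁ + k))).set tmp₂ (σ.mem (p₂ + k)))
        (Ex.loadAt (p₂ + k) (by simp only [weight]; omega) ?_ (hbd _ hp₂) (by simp [hm])) ?_
      · simp only [eval, h₂ _ hf']; simp [hk]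
      rintro _ rfl
      have hev : (Exp.add (.var acc) (.mul (.var tmp₁) (.var tmp₂))).eval
          ((σ'.set tmp₁ (σ.mem (p₁ + k))).set tmp₂ (σ.mem (p₂ + k))).reg
          = ∑ i ∈ Finset.range (k + 1), σ.mem (p₁ + i) * σ.mem (p₂ + i) := by
        simp [eval, hacc, Finset.sum_range_succ]
      refine Ex.assign (by simp only [weight]; omega) (by rw [hev]; exact hsum _ hkn) ?_
      rw [hev]
      refine ⟨by simp [hk], by simp, by simp [hm], by simp, fun u hu => ?_⟩
      rw [Cfg.set_reg_of_ne _ (by rintro rfl; simp [IsScratch] at hu),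
        Cfg.set_reg_of_ne _ (by rintro rfl; simp [IsScratch] at hu),
        Cfg.set_reg_of_ne _ (by rintro rfl; simp [IsScratch] at hu), hf' u hu]
    · rintro σ' ⟨-, h1, h2, h3⟩
      exact ⟨h1, h2, h3⟩
  · rintro σ₂ ⟨m₂, a₂, f₂⟩
    refine Ex.assign (by simp only [weight]; omega) (by simp only [eval, a₂]; exact hsum n le_rfl) ?_
    refine ⟨m₂, by simp [eval, a₂], fun u hu huv => ?_⟩
    rw [Cfg.set_reg_of_ne _ huv, f₂ u hu]

end Env

/-! ### Size parameters, memory layout and evaluation of directions -/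

/-- Input data together with the parameters of the cost estimates: the entries of the input and
of the answers are at most `2 ^ bet`, and the entries of the generators at most `2 ^ kap`. -/
structure Setting (n d m : ℕ) extends Env n d where
  w : Fin d → Fin n → ℤ
  e : Fin m → Fin n → ℤ
  bet : ℕ
  kap : ℕ
  abs_w_le : ∀ i j, |w i j| ≤ 2 ^ bet
  abs_e_le : ∀ i j, |e i j| ≤ 2 ^ bet
  addr_le : (d + m) * n + 2 * n + 2 * d ≤ 2 ^ lam
  num_le : m ≤ 2 ^ lam
  dim_le_gam : d + 4 ≤ gam
  cand_le : ∀ b ∈ signs d, ∀ i, (cand b i).weight ≤ gam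
  one_le_kap : 1 ≤ kap
  dot_le : n * (2 ^ bet * 2 ^ bet) ≤ 2 ^ kap
  pull_le : d * (2 ^ (kap * gam) * 2 ^ bet) ≤ 2 ^ lam
  kap_gam_le : kap * gam ≤ lam

namespace Setting

variable {n d m : ℕ} (P : Setting n d m)

/-- The address of the query vector. -/
abbrev base (_ : Setting n d m) : ℕ := (d + m) * n

/-- The scalar variables have the intended values, and the memory holds the input. -/
structure Ctx (σ : Cfg d) : Prop where
  dim : σ.reg dim = n
  dimPred : σ.reg dimPred = n - 1
  numPred : σ.reg numPred = m - 1
  addrB : σ.reg addrB = (P.base : ℕ)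
  addrX : σ.reg addrX = (P.base + n : ℕ)
  addrY : σ.reg addrY = (P.base + 2 * n : ℕ)
  addrZ : σ.reg addrZ = (P.base + 2 * n + d : ℕ)
  zero : σ.reg zero = 0
  mem_w : ∀ (i : Fin d) (j : Fin n), σ.mem (i * n + j) = P.w i j
  mem_e : ∀ (k : Fin m) (j : Fin n), σ.mem ((d + k) * n + j) = P.e k j

variable {P}

theorem w_lt (P : Setting n d m) (i : Fin d) (j : Fin n) : (i * n + j : ℕ) < P.base := by
  have h1 := j.2
  have h2 : (i + 1) * n ≤ (d + m) * n := Nat.mul_le_mul_right _ (by omega)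
  rw [Nat.add_mul, Nat.one_mul] at h2
  unfold base; omega

theorem e_lt (P : Setting n d m) (k : Fin m) (j : Fin n) :
    ((d + k) * n + j : ℕ) < P.base := by
  have h1 := j.2
  have h2 : (d + k + 1) * n ≤ (d + m) * n := Nat.mul_le_mul_right _ (by omega)
  rw [Nat.add_mul (d + k), Nat.one_mul] at h2
  unfold base; omega

/-- The context involves only scalars with number below nine and cells below `base`. The buffers for
oracle queries and answers lie from `base` on, so writing them does no harm. -/
theorem Ctx.congr {σ σ' : Cfg d} (h : P.Ctx σ)
    (hr : ∀ k : Fin 16, k < 9 → σ'.reg (.s k) = σ.reg (.s k))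
    (hm : ∀ q < P.base, σ'.mem q = σ.mem q) : P.Ctx σ' where
  dim := (hr 0 (by decide)).trans h.dim
  dimPred := (hr 2 (by decide)).trans h.dimPred
  numPred := (hr 3 (by decide)).trans h.numPred
  addrB := (hr 4 (by decide)).trans h.addrB
  addrX := (hr 5 (by decide)).trans h.addrX
  addrY := (hr 6 (by decide)).trans h.addrY
  addrZ := (hr 7 (by decide)).trans h.addrZ
  zero := (hr 8 (by decide)).trans h.zero
  mem_w i j := by rw [hm _ (P.w_lt i j), h.mem_w]
  mem_e k j := by rw [hm _ (P.e_lt k j), h.mem_e]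

theorem not_isScratch {k : Fin 16} (hk : k < 9) : ¬ (Var.s k : Var d).IsScratch := by
  simp only [IsScratch]; omega

theorem two_pow_kap_le (P : Setting n d m) : (2 : ℤ) ^ P.kap ≤ 2 ^ P.lam := by
  have h1 := P.three_le_gam
  refine pow_le_pow_right₀ (by norm_num) (le_trans ?_ P.kap_gam_le)
  exact Nat.le_mul_of_pos_right _ (by omega)

theorem n_mul_le (P : Setting n d m) : (n : ℤ) * (2 ^ P.bet * 2 ^ P.bet) ≤ 2 ^ P.kap := by
  exact_mod_cast P.dot_le

theorem abs_dot_le (P : Setting n d m) {u z : Fin n → ℤ} (hu : ∀ j, |u j| ≤ 2 ^ P.bet)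
    (hz : ∀ j, |z j| ≤ 2 ^ P.bet) : |dot u z| ≤ 2 ^ P.kap := by
  calc |dot u z| ≤ ∑ j, |u j * z j| := Finset.abs_sum_le_sum_abs _ _
    _ ≤ ∑ _j : Fin n, (2 ^ P.bet * 2 ^ P.bet : ℤ) := Finset.sum_le_sum fun j _ => by
        rw [abs_mul]; exact mul_le_mul (hu j) (hz j) (abs_nonneg _) (by positivity)
    _ = n * (2 ^ P.bet * 2 ^ P.bet) := by simp
    _ ≤ _ := P.n_mul_le

theorem ex_dotVec {σ : Cfg d} (hσ : P.Ctx σ) {u : Fin d → Var d} (hu : Function.Injective u)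
    (hus : ∀ i k, u i ≠ .s k) {a : Exp d} (p : ℕ) (z : Fin n → ℤ) (ha : a.weight + 1 ≤ P.gam)
    (hev : ∀ ρ, (∀ v, ¬ v.IsScratch → (∀ i, v ≠ u i) → ρ v = σ.reg v) → a.eval ρ = p)
    (hp : (p : ℤ) + n ≤ 2 ^ P.lam) (hz : ∀ j : Fin n, σ.mem (p + j) = z j)
    (hzb : ∀ j, |z j| ≤ 2 ^ P.bet) :
    P.Ex (dotVec u a) σ (d * P.tDot) fun σ' => σ'.mem = σ.mem ∧
      (∀ i, σ'.reg (u i) = dot (P.w i) z) ∧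
      ∀ v, ¬ v.IsScratch → (∀ i, v ≠ u i) → σ'.reg v = σ.reg v := by
  have hgam := P.dim_le_gam
  have haddr := P.addr_le
  have hscr : ∀ i, ¬ (u i).IsScratch := by
    intro i hi
    cases h : u i with
    | s k => exact hus i k h
    | f k j => rw [h] at hi; exact hi
    | r k j => rw [h] at hi; exact hi
  have hval : ∀ i : Fin d,
      ∑ j ∈ Finset.range n, σ.mem (i * n + j) * σ.mem (p + j) = dot (P.w i) z := by
    intro i
    rw [Finset.sum_range]
    exact Finset.sum_congr rfl fun j _ => by rw [hσ.mem_w, hz]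
  have h := Env.Ex.seqs (E := P.toEnv) (P := fun i => dotProg (u i) (rowAddr i) a) (t := P.tDot)
    (I := fun A σ' => σ'.mem = σ.mem ∧ (∀ i ∈ A, σ'.reg (u i) = dot (P.w i) z) ∧
      ∀ v, ¬ v.IsScratch → (∀ i, v ≠ u i) → σ'.reg v = σ.reg v) (List.finRange d) (by
      rintro i - A σ' ⟨h1, h2, h3⟩
      have hs : ∀ k : Fin 16, k < 9 → σ'.reg (.s k) = σ.reg (.s k) := fun k hk =>
        h3 _ (not_isScratch hk) fun i => (hus i k).symm
      have hi := i.2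
      have hp1 : (i * n + n : ℕ) ≤ P.base := by
        have h2 : (i + 1) * n ≤ (d + m) * n := Nat.mul_le_mul_right _ (by omega)
        rw [Nat.add_mul, Nat.one_mul] at h2
        exact h2
      refine (Env.Ex.dotProg (E := P.toEnv) (i * n) p (2 ^ P.bet * 2 ^ P.bet)
        ((hs 2 (by decide)).trans hσ.dimPred) ?_ ha ?_ ?_ ?_ hp ?_
        (P.n_mul_le.trans P.two_pow_kap_le)).mono le_rfl ?_
      · simp only [rowAddr, weight, Int.natAbs_natCast]; omega
      · intro ρ hρ
        have : ρ dim = n := by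
          rw [hρ _ (not_isScratch (by decide)), hs 0 (by decide)]; exact hσ.dim
        simp only [rowAddr, eval, this]; push_cast; rfl
      · intro ρ hρ
        exact hev ρ fun v hv hvu => (hρ v hv).trans (h3 v hv hvu)
      · have : (i * n + n : ℕ) ≤ 2 ^ P.lam := by unfold base at hp1; omega
        exact_mod_cast this
      · intro j hj
        have e1 := hσ.mem_w i ⟨j, hj⟩
        have e2 := hz ⟨j, hj⟩
        simp only at e1 e2
        rw [h1, e1, e2, abs_mul]
        exact mul_le_mul (P.abs_w_le _ _) (hzb _) (abs_nonneg _) (by positivity)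
      · rintro σ'' ⟨g1, g2, g3⟩
        rw [h1, hval] at g2
        refine ⟨g1.trans h1, fun i' hi' => ?_, fun v hv hvu => ?_⟩
        · by_cases hii : i' = i
          · rw [hii, g2]
          · rw [g3 _ (hscr i') (hu.ne hii)]
            exact h2 i' (hi'.resolve_left hii)
        · rw [g3 v hv (hvu i), h3 v hv hvu]) ∅ σ ⟨rfl, by simp, fun _ _ _ => rfl⟩
  refine h.mono (by simp) ?_
  rintro σ' ⟨h1, h2, h3⟩
  exact ⟨h1, fun i => h2 i (by simp), h3⟩

/-- A bound for the number of operations of `buildQuery`. -/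
def _root_.ConvexOpt.Env.tBuild (E : Env n d) : ℕ :=
  n * ((E.U + (d * (E.U + E.U) + E.U)) + E.U + 1) + 1 + E.U

theorem ex_buildQuery {σ : Cfg d} (hσ : P.Ctx σ) (h : Fin d → ℤ) (hh : ∀ i, σ.reg (dir i) = h i)
    (hb : ∀ i, |h i| ≤ 2 ^ (P.kap * P.gam)) :
    P.Ex (buildQuery d) σ P.tBuild fun σ' => (∀ v, ¬ v.IsScratch → σ'.reg v = σ.reg v) ∧
      (∀ j : Fin n, σ'.mem (P.base + j) = pull P.w h j) ∧
      ∀ q, (q < P.base ∨ P.base + n ≤ q) → σ'.mem q = σ.mem q := by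
  have hgam := P.dim_le_gam
  have haddr := P.addr_le
  set C : ℤ := 2 ^ (P.kap * P.gam) * 2 ^ P.bet with hC
  have hdC : (d : ℤ) * C ≤ 2 ^ P.lam := by rw [hC]; exact_mod_cast P.pull_le
  have hterm : ∀ i j, |h i * P.w i j| ≤ C := fun i j => by
    rw [abs_mul]; exact mul_le_mul (hb i) (P.abs_w_le _ _) (abs_nonneg _) (by positivity)
  -- The term `l.length * C` reserves room for the summands still to come, so that each partial sum
  -- stays below `2 ^ lam`.
  have inner : ∀ (k : Fin n) (l : List (Fin d)) (c : ℤ) (σ' : Cfg d),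
      (∀ v, ¬ v.IsScratch → σ'.reg v = σ.reg v) → (∀ q < P.base, σ'.mem q = σ.mem q) →
      σ'.reg ctr = (k : ℕ) → σ'.reg acc = c → |c| + l.length * C ≤ 2 ^ P.lam →
      P.Ex (seqs (l.map fun i => .seq (loadAt tmp₁ (.add (rowAddr i) (.var ctr)))
        (assign acc (.add (.var acc) (.mul (.var (dir i)) (.var tmp₁))))))
        σ' (l.length * (P.U + P.U)) fun σ'' => (∀ v, ¬ v.IsScratch → σ''.reg v = σ.reg v) ∧
          σ''.mem = σ'.mem ∧ σ''.reg ctr = (k : ℕ) ∧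
          σ''.reg acc = c + (l.map fun i => h i * P.w i k).sum := by
    intro k l
    induction l with
    | nil =>
      intro c σ' h1 h2 h3 h4 h5
      exact Env.Ex.skip ⟨h1, rfl, h3, by simp [h4]⟩
    | cons i l ih =>
      intro c σ' h1 h2 h3 h4 h5
      have hi := i.2
      have hwl := P.w_lt i k
      have hmem : σ'.mem (i * n + k) = P.w i k := by rw [h2 _ hwl, hσ.mem_w]
      rw [List.length_cons] at h5 ⊢
      rw [Nat.succ_mul]
      push_cast at h5
      have hC0 : 0 ≤ C := by positivity
      have hlC : 0 ≤ (l.length : ℤ) * C := by positivity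
      have habs : |c + h i * P.w i k| ≤ |c| + C :=
        (abs_add_le _ _).trans (add_le_add_right (hterm i k) _)
      refine (Env.Ex.seq (t₁ := P.U + P.U) (t₂ := l.length * (P.U + P.U)) (R := fun σ'' =>
        (∀ v, ¬ v.IsScratch → σ''.reg v = σ.reg v) ∧ σ''.mem = σ'.mem ∧ σ''.reg ctr = (k : ℕ) ∧
          σ''.reg acc = c + h i * P.w i k) ?_ ?_).mono (by omega) fun _ h => h
      · refine Env.Ex.seq (R := fun σ'' => σ'' = σ'.set tmp₁ (P.w i k))
          (Env.Ex.loadAt (i * n + k) ?_ ?_ ?_ (by rw [hmem])) ?_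
        · simp only [rowAddr, weight, Int.natAbs_natCast]; omega
        · simp only [rowAddr, eval, h3, h1 _ (not_isScratch (show (0 : Fin 16) < 9 by decide)),
            hσ.dim]
          push_cast; rfl
        · rw [Nat.abs_cast]
          have : (i * n + k : ℕ) ≤ 2 ^ P.lam := by unfold base at hwl; omega
          exact_mod_cast this
        · rintro _ rfl
          have hd : σ'.reg (dir i) = h i := by rw [h1 _ (by simp [IsScratch]), hh]
          have hev : (Exp.add (.var acc) (.mul (.var (dir i)) (.var tmp₁))).eval
              (σ'.set tmp₁ (P.w i k)).reg = c + h i * P.w i k := by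
            simp [eval, h4, hd]
          refine Env.Ex.assign (by simp only [weight]; omega) (by rw [hev]; linarith) ?_
          rw [hev]
          refine ⟨fun v hv => ?_, rfl, by simp [h3], by simp⟩
          rw [Cfg.set_reg_of_ne _ (by rintro rfl; simp [IsScratch] at hv),
            Cfg.set_reg_of_ne _ (by rintro rfl; simp [IsScratch] at hv), h1 v hv]
      · rintro σ'' ⟨g1, g2, g3, g4⟩
        refine (ih _ σ'' g1 (fun q hq => by rw [g2, h2 q hq]) g3 g4 (by linarith)).mono le_rfl ?_
        rintro τ ⟨f1, f2, f3, f4⟩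
        exact ⟨f1, f2.trans g2, f3, by rw [f4, List.map_cons, List.sum_cons]; ring⟩
  refine Env.Ex.forLoop n (by exact_mod_cast P.dim_le) (fun k σ' => σ'.reg ctr = k ∧
      (∀ v, ¬ v.IsScratch → σ'.reg v = σ.reg v) ∧
      (∀ j : Fin n, (j : ℕ) < k → σ'.mem (P.base + j) = pull P.w h j) ∧
      ∀ q, (q < P.base ∨ P.base + n ≤ q) → σ'.mem q = σ.mem q) ?_ ?_ ?_ ?_
  · refine ⟨by simp, fun v hv => ?_, by simp, fun _ _ => rfl⟩
    rw [Cfg.set_reg_of_ne _ (by rintro rfl; simp [IsScratch] at hv)]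
  · rintro k σ' ⟨h1, h2, -, -⟩
    exact ⟨h1, by rw [h2 _ (not_isScratch (by decide))]; exact hσ.dimPred⟩
  · rintro k hk σ' ⟨h1, h2, h3, h4⟩
    refine Env.Ex.seq (R := fun σ'' => σ'' = σ'.set acc 0)
      (Env.Ex.assign (by simp only [weight, Int.natAbs_zero]; omega) (by simp [eval]) rfl) ?_
    rintro _ rfl
    have hin := inner ⟨k, hk⟩ (List.finRange d) 0 (σ'.set acc 0)
      (fun v hv => by
        rw [Cfg.set_reg_of_ne _ (by rintro rfl; simp [IsScratch] at hv), h2 v hv])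
      (fun q hq => h4 q (Or.inl hq)) (by simp [h1]) (by simp) (by simpa using hdC)
    refine Env.Ex.seq (hin.mono (by simp) fun _ h => h) ?_
    rintro τ ⟨g1, g2, g3, g4⟩
    have hacc : τ.reg acc = pull P.w h ⟨k, hk⟩ := by
      rw [g4, zero_add, ← List.ofFn_eq_map, List.sum_ofFn]; rfl
    refine Env.Ex.storeAt (P.base + k) (by simp only [weight]; omega)
      (by simp only [weight]; omega) ?_ ?_ ?_ ?_
    · simp only [eval, g3, g1 _ (not_isScratch (show (4 : Fin 16) < 9 by decide)), hσ.addrB]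
      push_cast; rfl
    · rw [Nat.abs_cast]
      have : (P.base + k : ℕ) ≤ 2 ^ P.lam := by unfold base; omega
      exact_mod_cast this
    · simp only [eval, hacc]
      calc |pull P.w h ⟨k, hk⟩| ≤ ∑ i, |h i * P.w i ⟨k, hk⟩| := Finset.abs_sum_le_sum_abs _ _
        _ ≤ ∑ _i : Fin d, C := Finset.sum_le_sum fun i _ => hterm i _
        _ = d * C := by simp
        _ ≤ _ := hdC
    · simp only [eval, hacc]
      refine ⟨g3, by simp, fun v hv => ?_, fun j hj => ?_, fun q hq => ?_⟩
      · rw [Cfg.set_reg_of_ne _ (by rintro rfl; simp [IsScratch] at hv)]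
        exact g1 v hv
      · simp only [Cfg.set_mem, Cfg.setMem]
        by_cases hjk : (j : ℕ) = k
        · obtain rfl : j = ⟨k, hk⟩ := Fin.ext hjk
          simp
        · rw [Function.update_of_ne (by omega), g2]
          exact h3 j (by omega)
      · simp only [Cfg.set_mem, Cfg.setMem]
        rw [Function.update_of_ne (by omega), g2]
        exact h4 q hq
  · rintro σ' ⟨-, h2, h3, h4⟩
    exact ⟨h2, fun j => h3 j j.2, h4⟩


/-! ### The search over all candidate directions -/

/-- The values of the functionals at the answer to the query with direction `h`. -/
def value (P : Setting n d m) (x : (Fin n → ℤ) → Fin n → ℤ) (h : Fin d → ℤ) : Fin d → ℤ :=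
  fun i => dot (P.w i) (x (pull P.w h))

/-- The best direction found so far. -/
def _root_.ConvexOpt.Cfg.bestDir (σ : Cfg d) : Fin d → ℤ := fun i => σ.reg (.bestDir i)

/-- The best values of the functionals found so far. -/
def _root_.ConvexOpt.Cfg.bestVal (σ : Cfg d) : Fin d → ℤ := fun i => σ.reg (.bestVal i)

/-- The matrix of generators under consideration. -/
def _root_.ConvexOpt.Cfg.row (σ : Cfg d) : Fin d → Fin d → ℤ := fun l i => σ.reg (.r l i)

/-- A bound for the number of operations of `probe`. -/
def _root_.ConvexOpt.Env.tProbe (E : Env n d) : ℕ := E.tBuild + (1 + d * E.tDot)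

/-- A bound for the number of operations of `tryCand`. -/
def _root_.ConvexOpt.Env.tTry (E : Env n d) : ℕ :=
  d * E.U + (E.tProbe + (d * E.U + (d * E.U + (1 + (1 + (d * E.U + d * E.U))))))

/-- A bound for the number of operations of `nest`, by the number of levels. -/
noncomputable def _root_.ConvexOpt.Env.tNest (E : Env n d) (m : ℕ) : ℕ → ℕ
  | 0 => (signs d).length * E.tTry
  | k + 1 => (m * ((d * E.tDot + E.tNest m k) + E.U + 1) + 1 + E.U) +
      d * (d * E.U + E.tNest m k)

/-- Here the oracle is a total function `x`, which is justified as soon as `S` is nonempty. -/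
theorem ex_probe {x : (Fin n → ℤ) → Fin n → ℤ} (hx : ∀ u, P.O.lin u = some (x u))
    (hxb : ∀ u j, |x u j| ≤ 2 ^ P.bet) {σ : Cfg d} (hσ : P.Ctx σ) (h : Fin d → ℤ)
    (hh : ∀ i, σ.reg (dir i) = h i) (hb : ∀ i, |h i| ≤ 2 ^ (P.kap * P.gam)) :
    P.Ex (probe d) σ P.tProbe fun σ' => P.Ctx σ' ∧ (∀ i, σ'.reg (val i) = P.value x h i) ∧
      ∀ v, ¬ v.IsScratch → (∀ i, v ≠ val i) → σ'.reg v = σ.reg v := by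
  have hgam := P.dim_le_gam
  have haddr := P.addr_le
  have hxl : ∀ u j, |x u j| ≤ 2 ^ P.lam := by
    intro u j
    -- The step from `bet` to `lam` goes through `n * (2 ^ bet * 2 ^ bet) ≤ 2 ^ kap` and needs `0 <
    -- n`; otherwise there are no entries.
    rcases Nat.eq_zero_or_pos n with rfl | hn
    · exact j.elim0
    refine (hxb u j).trans (le_trans ?_ (P.n_mul_le.trans P.two_pow_kap_le))
    have h1 : (1 : ℤ) ≤ 2 ^ P.bet := one_le_pow₀ (by norm_num)
    have h2 : (1 : ℤ) ≤ n := by exact_mod_cast hn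
    nlinarith
  refine (ex_buildQuery hσ h hh hb).seq ?_
  rintro σ₁ ⟨r₁, q₁, m₁⟩
  have c₁ : P.Ctx σ₁ := hσ.congr (fun k hk => r₁ _ (not_isScratch hk)) fun q hq => m₁ q (Or.inl hq)
  refine Env.Ex.seq (R := fun σ' => σ' = (σ₁.writeVec (P.base + n) (x (pull P.w h))).set flag 1)
    (Env.Ex.linQuery_some P.base (P.base + n) (pull P.w h) (x (pull P.w h)) c₁.addrB c₁.addrX q₁
      (hx _) (hxl _) rfl) ?_
  rintro _ rfl
  set σ₂ := (σ₁.writeVec (P.base + n) (x (pull P.w h))).set flag 1 with hσ₂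
  have r₂ : ∀ v : Var d, ¬ v.IsScratch → σ₂.reg v = σ.reg v := fun v hv => by
    rw [hσ₂, Cfg.set_reg_of_ne _ (by rintro rfl; simp [IsScratch] at hv)]
    exact r₁ v hv
  have m₂ : ∀ q < P.base, σ₂.mem q = σ.mem q := fun q hq => by
    simp only [hσ₂, Cfg.set_mem, Cfg.writeVec]
    rw [dif_neg (by omega), m₁ q (Or.inl hq)]
  have c₂ : P.Ctx σ₂ := hσ.congr (fun k hk => r₂ _ (not_isScratch hk)) m₂
  refine (ex_dotVec c₂ (u := val) (fun i j h => by simpa using h) (by simp) (P.base + n)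
    (x (pull P.w h)) (by simp only [weight]; omega) ?_ ?_ ?_ (hxb _)).mono le_rfl ?_
  · intro ρ hρ
    simp only [eval]
    rw [hρ _ (not_isScratch (by decide)) (by simp), c₂.addrX]
  · have : P.base + n + n ≤ 2 ^ P.lam := by unfold base; omega
    exact_mod_cast this
  · intro j
    simp only [hσ₂, Cfg.set_mem, Cfg.writeVec]
    rw [dif_pos ⟨by omega, by omega⟩]
    congr 1
    ext
    simp
  · rintro σ₃ ⟨g1, g2, g3⟩
    refine ⟨c₂.congr (fun k hk => g3 _ (not_isScratch hk) (by simp)) fun q _ => by rw [g1], g2,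
      fun v hv hvu => by rw [g3 v hv hvu, r₂ v hv]⟩

/-- The context is intact, and the best values belong to the best direction, which is bounded. -/
def Inv (P : Setting n d m) (x : (Fin n → ℤ) → Fin n → ℤ) (σ : Cfg d) : Prop :=
  P.Ctx σ ∧ σ.bestVal = P.value x σ.bestDir ∧ ∀ i, |σ.bestDir i| ≤ 2 ^ (P.kap * P.gam)

/-- A part of the search has been performed, which uses the levels in `ls` only. -/
structure Progress (P : Setting n d m) (x : (Fin n → ℤ) → Fin n → ℤ) (F : (Fin d → ℤ) → ℝ)
    (ls : List (Fin d)) (σ σ' : Cfg d) : Prop where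
  inv : P.Inv x σ'
  idx : ∀ l ∉ ls, σ'.reg (idxOf l) = σ.reg (idxOf l)
  row : ∀ l ∉ ls, σ'.row l = σ.row l
  le : F σ.bestVal ≤ F σ'.bestVal

theorem Progress.refl {x : (Fin n → ℤ) → Fin n → ℤ} {F : (Fin d → ℤ) → ℝ} {ls : List (Fin d)}
    {σ : Cfg d} (h : P.Inv x σ) : P.Progress x F ls σ σ :=
  ⟨h, fun _ _ => rfl, fun _ _ => rfl, le_rfl⟩

theorem Progress.trans {x : (Fin n → ℤ) → Fin n → ℤ} {F : (Fin d → ℤ) → ℝ} {ls : List (Fin d)}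
    {σ σ' σ'' : Cfg d} (h : P.Progress x F ls σ σ') (h' : P.Progress x F ls σ' σ'') :
    P.Progress x F ls σ σ'' :=
  ⟨h'.inv, fun l hl => (h'.idx l hl).trans (h.idx l hl),
    fun l hl => (h'.row l hl).trans (h.row l hl), h.le.trans h'.le⟩

theorem Progress.mono {x : (Fin n → ℤ) → Fin n → ℤ} {F : (Fin d → ℤ) → ℝ} {ls ls' : List (Fin d)}
    {σ σ' : Cfg d} (h : P.Progress x F ls σ σ') (hl : ls ⊆ ls') : P.Progress x F ls' σ σ' :=
  ⟨h.inv, fun l hn => h.idx l fun hm => hn (hl hm), fun l hn => h.row l fun hm => hn (hl hm), h.le⟩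

theorem Inv.congr {x : (Fin n → ℤ) → Fin n → ℤ} {σ σ' : Cfg d} (h : P.Inv x σ)
    (hr : ∀ k : Fin 16, k < 9 → σ'.reg (.s k) = σ.reg (.s k))
    (hm : ∀ q < P.base, σ'.mem q = σ.mem q)
    (hv : ∀ i, σ'.reg (.bestVal i) = σ.reg (.bestVal i))
    (hd : ∀ i, σ'.reg (.bestDir i) = σ.reg (.bestDir i)) : P.Inv x σ' := by
  refine ⟨h.1.congr hr hm, ?_⟩
  have e1 : σ'.bestVal = σ.bestVal := funext hv
  have e2 : σ'.bestDir = σ.bestDir := funext hd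
  rw [e1, e2]
  exact h.2

/-- A candidate is the value of the expression `cand` in the valuation that sends the row variables
to the entries of `A`, so the weight bound for expressions replaces a determinant estimate. -/
theorem abs_cand_le (P : Setting n d m) {A : Fin d → Fin d → ℤ} (hA : ∀ l i, |A l i| ≤ 2 ^ P.kap)
    {b : Fin d → ℤ} (hb : b ∈ signs d) (i : Fin d) :
    |candidate A b i| ≤ 2 ^ (P.kap * P.gam) := by
  let ρ : Var d → ℤ := fun v => match v with
    | .r l i => A l i
    | _ => 0
  have hρ : ∀ v, |ρ v| ≤ 2 ^ P.kap := fun v => by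
    cases v with
    | r l i => exact hA l i
    | s k => simp [ρ]
    | f k j => simp [ρ]
  have h1 := (cand b i).abs_eval_le P.one_le_kap hρ
  rw [eval_cand] at h1
  exact h1.trans (pow_le_pow_right₀ (by norm_num) (Nat.mul_le_mul_left _ (P.cand_le b hb i)))

/-- `F` is the objective on integer values, accessible only through comparisons. In both outcomes
the retained value is at least the old one and the new one, and it still belongs to the retained
direction. -/
theorem ex_tryCand {x : (Fin n → ℤ) → Fin n → ℤ} (hx : ∀ u, P.O.lin u = some (x u))
    (hxb : ∀ u j, |x u j| ≤ 2 ^ P.bet) {F : (Fin d → ℤ) → ℝ}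
    (hF : ∀ y z : Fin d → ℤ,
      P.O.cmp (fun i => (y i : ℚ)) (fun i => (z i : ℚ)) = true ↔ F y ≤ F z)
    {b : Fin d → ℤ} (hb : b ∈ signs d) {σ : Cfg d} (hσ : P.Inv x σ)
    (hA : ∀ l i, |σ.row l i| ≤ 2 ^ P.kap) :
    P.Ex (tryCand b) σ P.tTry fun σ' => P.Progress x F [] σ σ' ∧
      F (P.value x (candidate σ.row b)) ≤ F σ'.bestVal := by
  have hgam := P.dim_le_gam
  have haddr := P.addr_le
  have hcb := P.abs_cand_le hA hb
  refine (Env.Ex.assignVec (u := dir) (fun i j h => by simpa using h) (candidate σ.row b)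
    (fun i => P.cand_le b hb i) (fun i ρ hρ => ?_) (fun i => (hcb i).trans
      (pow_le_pow_right₀ (by norm_num) P.kap_gam_le))).seq ?_
  · rw [eval_cand]
    congr 1
    funext l j
    exact hρ _ (by simp)
  rintro σ₁ ⟨m₁, d₁, f₁⟩
  have i₁ : P.Inv x σ₁ := hσ.congr (fun k _ => f₁ _ (by simp)) (fun q _ => by rw [m₁])
    (fun i => f₁ _ (by simp)) (fun i => f₁ _ (by simp))
  refine (ex_probe hx hxb i₁.1 _ d₁ hcb).seq ?_
  rintro σ₂ ⟨c₂, v₂, f₂⟩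
  have i₂ : P.Inv x σ₂ := by
    refine ⟨c₂, ?_⟩
    have e1 : σ₂.bestVal = σ₁.bestVal := funext fun i => f₂ _ (by simp [IsScratch]) (by simp)
    have e2 : σ₂.bestDir = σ₁.bestDir := funext fun i => f₂ _ (by simp [IsScratch]) (by simp)
    rw [e1, e2]
    exact i₁.2
  refine (Env.Ex.storeVec (P.base + 2 * n) c₂.addrY (by
    have : P.base + 2 * n + d ≤ 2 ^ P.lam := by unfold base; omega
    exact_mod_cast this) (by omega)).seq ?_
  rintro σ₃ ⟨r₃, s₃, m₃⟩
  have c₃ : P.Ctx σ₃ := c₂.congr (fun k _ => by rw [r₃]) fun q hq => m₃ q fun i => by omega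
  refine (Env.Ex.storeVec (P.base + 2 * n + d) c₃.addrZ (by
    have : P.base + 2 * n + d + d ≤ 2 ^ P.lam := by unfold base; omega
    exact_mod_cast this) (by omega)).seq ?_
  rintro σ₄ ⟨r₄, s₄, m₄⟩
  have r₄' : σ₄.reg = σ₂.reg := by rw [r₄, r₃]
  have c₄ : P.Ctx σ₄ := c₃.congr (fun k _ => by rw [r₄]) fun q hq => m₄ q fun i => by omega
  have b₄ : σ₄.bestVal = σ.bestVal := by
    funext i
    simp only [Cfg.bestVal, r₄']
    rw [f₂ _ (by simp [IsScratch]) (by simp), f₁ _ (by simp)]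
  refine Env.Ex.seq (R := fun σ' => σ' = σ₄.set flag
      (if P.O.cmp (fun i => (P.value x (candidate σ.row b) i : ℚ))
        (fun i => (σ.bestVal i : ℚ)) then 1 else 0))
    (Env.Ex.cmpQuery (P.base + 2 * n) (P.base + 2 * n + d) (P.value x (candidate σ.row b))
      σ.bestVal c₄.addrY c₄.addrZ (fun j => ?_) (fun j => ?_) rfl) ?_
  · rw [m₄ _ (fun i => by have := j.2; omega), s₃, v₂]
  · rw [s₄, r₃, f₂ _ (by simp [IsScratch]) (by simp), f₁ _ (by simp)]; rfl
  rintro _ rfl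
  set fl : ℤ := if P.O.cmp (fun i => (P.value x (candidate σ.row b) i : ℚ))
        (fun i => (σ.bestVal i : ℚ)) then 1 else 0 with hfl
  have f₅ : ∀ v : Var d, v ≠ flag → (σ₄.set flag fl).reg v = σ₂.reg v := fun v hv => by
    rw [Cfg.set_reg_of_ne _ hv, r₄']
  have c₅ : P.Ctx (σ₄.set flag fl) := c₄.congr (fun k hk => by
    rw [Cfg.set_reg_of_ne _ (by rintro h; injection h with h; subst h; simp at hk)])
    fun _ _ => rfl
  have z₅ : (σ₄.set flag fl).reg zero = 0 := c₅.zero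
  have fl₅ : (σ₄.set flag fl).reg flag = fl := by simp
  -- The comparison asks whether the new value is at most the best one; the flag is `0`, and the
  -- best is replaced, exactly if it is strictly better.
  refine Env.Ex.ite ?_ ?_
  · intro hle
    have hlt : F σ.bestVal ≤ F (P.value x (candidate σ.row b)) := by
      by_contra hc
      have := (hF _ _).2 (not_le.1 hc).le
      rw [z₅, fl₅, hfl, this] at hle
      norm_num at hle
    refine Env.Ex.of_bounded fun hreg _ => ?_
    refine (Env.Ex.assignVec (u := Var.bestVal) (fun i j h => by simpa using h)
      (P.value x (candidate σ.row b)) (fun i => by simp only [weight]; omega)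
      (fun i ρ hρ => ?_) (fun i => ?_)).seq ?_
    · simp only [eval]
      rw [hρ _ (by simp), f₅ _ (by simp), v₂]
    · rw [← v₂, ← f₅ _ (by simp)]; exact hreg _
    rintro σ₆ ⟨m₆, v₆, f₆⟩
    refine (Env.Ex.assignVec (u := Var.bestDir) (fun i j h => by simpa using h)
      (candidate σ.row b) (fun i => by simp only [weight]; omega)
      (fun i ρ hρ => ?_) (fun i => (hcb i).trans
        (pow_le_pow_right₀ (by norm_num) P.kap_gam_le))).mono le_rfl ?_
    · simp only [eval]
      rw [hρ _ (by simp), f₆ _ (by simp), f₅ _ (by simp), f₂ _ (by simp [IsScratch]) (by simp), d₁]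
    rintro σ₇ ⟨m₇, v₇, f₇⟩
    have e1 : σ₇.bestVal = P.value x (candidate σ.row b) := funext fun i => by
      simp only [Cfg.bestVal]; rw [f₇ _ (by simp), v₆]
    have e2 : σ₇.bestDir = candidate σ.row b := funext fun i => v₇ i
    refine ⟨⟨⟨c₅.congr (fun k _ => by rw [f₇ _ (by simp), f₆ _ (by simp)])
      (fun q _ => by rw [m₇, m₆]), by rw [e1, e2],
      by rw [e2]; exact hcb⟩, fun l _ => ?_, fun l _ => ?_, by rw [e1]; exact hlt⟩,
      by rw [e1]⟩
    · rw [f₇ _ (by simp), f₆ _ (by simp), f₅ _ (by simp), f₂ _ (by simp [IsScratch]) (by simp),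
        f₁ _ (by simp)]
    · funext i
      simp only [Cfg.row]
      rw [f₇ _ (by simp), f₆ _ (by simp), f₅ _ (by simp), f₂ _ (by simp [IsScratch]) (by simp),
        f₁ _ (by simp)]
  · intro hle
    have hge : F (P.value x (candidate σ.row b)) ≤ F σ.bestVal := by
      rw [← hF]
      by_contra hc
      rw [Bool.not_eq_true] at hc
      rw [z₅, fl₅, hfl, hc] at hle
      norm_num at hle
    refine Env.Ex.skip ?_
    have b₅ : (σ₄.set flag fl).bestVal = σ.bestVal := b₄
    refine ⟨⟨⟨c₅, ?_⟩, fun l _ => ?_, fun l _ => ?_, by rw [b₅]⟩, by rw [b₅]; exact hge⟩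
    · have e2 : (σ₄.set flag fl).bestDir = σ₂.bestDir := funext fun i => f₅ _ (by simp)
      have e1 : (σ₄.set flag fl).bestVal = σ₂.bestVal := funext fun i => f₅ _ (by simp)
      rw [e1, e2]
      exact i₂.2
    · rw [f₅ _ (by simp), f₂ _ (by simp [IsScratch]) (by simp), f₁ _ (by simp)]
    · funext i
      simp only [Cfg.row]
      rw [f₅ _ (by simp), f₂ _ (by simp [IsScratch]) (by simp), f₁ _ (by simp)]

theorem abs_generator_le (P : Setting n d m) {g : Fin d → ℤ} (hg : g ∈ generators P.w P.e)
    (i : Fin d) : |g i| ≤ 2 ^ P.kap := by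
  rcases hg with ⟨k, rfl⟩ | ⟨j, rfl⟩
  · exact P.abs_dot_le (fun j => P.abs_w_le i j) fun j => P.abs_e_le k j
  · by_cases h : i = j
    · subst h; simpa using one_le_pow₀ (by norm_num : (1 : ℤ) ≤ 2)
    · simp [h]

/-- All candidates whose rows agree with `σ` outside `ls` have been taken into account. -/
def Covered (P : Setting n d m) (x : (Fin n → ℤ) → Fin n → ℤ) (F : (Fin d → ℤ) → ℝ)
    (ls : List (Fin d)) (σ σ' : Cfg d) : Prop :=
  ∀ A : Fin d → Fin d → ℤ, (∀ l, A l ∈ generators P.w P.e) → (∀ l ∉ ls, A l = σ.row l) →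
    ∀ b ∈ signs d, F (P.value x (candidate A b)) ≤ F σ'.bestVal

/-- Induction on the rows still free. A row is either the image of a listed vector, reached by the
counted loop, or a unit vector, reached by the unrolled list. Once it is fixed, the induction
hypothesis covers the other rows. Earlier coverage persists because the best value never decreases.
-/
theorem ex_nest {x : (Fin n → ℤ) → Fin n → ℤ} (hx : ∀ u, P.O.lin u = some (x u))
    (hxb : ∀ u j, |x u j| ≤ 2 ^ P.bet) {F : (Fin d → ℤ) → ℝ}
    (hF : ∀ y z : Fin d → ℤ,
      P.O.cmp (fun i => (y i : ℚ)) (fun i => (z i : ℚ)) = true ↔ F y ≤ F z)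
    (ls : List (Fin d)) : ls.Nodup → ∀ σ : Cfg d, P.Inv x σ →
      (∀ l ∉ ls, σ.row l ∈ generators P.w P.e) →
      P.Ex (nest ls) σ (P.tNest m ls.length) fun σ' =>
        P.Progress x F ls σ σ' ∧ P.Covered x F ls σ σ' := by
  have hgam := P.dim_le_gam
  have haddr := P.addr_le
  induction ls with
  | nil =>
    intro _ σ hσ hrow
    refine (Env.Ex.seqs (E := P.toEnv) (P := tryCand) (t := P.tTry) (I := fun A σ' =>
      P.Progress x F [] σ σ' ∧ ∀ b ∈ A, b ∈ signs d →
        F (P.value x (candidate σ.row b)) ≤ F σ'.bestVal) (signs d) ?_ ∅ σ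
      ⟨Progress.refl hσ, by simp⟩).mono le_rfl ?_
    · rintro b hb B σ' ⟨h1, h2⟩
      have hr : σ'.row = σ.row := funext fun l => h1.row l (by simp)
      refine (ex_tryCand hx hxb hF hb h1.inv (fun l i => ?_)).mono le_rfl ?_
      · rw [hr]; exact P.abs_generator_le (hrow l (by simp)) i
      · rintro σ'' ⟨g1, g2⟩
        rw [hr] at g2
        refine ⟨h1.trans g1, fun b' hb' hs => ?_⟩
        rcases hb' with rfl | hb'
        · exact g2
        · exact (h2 b' hb' hs).trans g1.le
    · rintro σ' ⟨h1, h2⟩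
      refine ⟨h1, fun A _ hA b hb => ?_⟩
      obtain rfl : A = σ.row := funext fun l => hA l (by simp)
      exact h2 b (by simpa using hb) hb
  | cons l ls ih =>
    intro hnd σ hσ hrow
    obtain ⟨hl, hnd'⟩ := List.nodup_cons.1 hnd
    -- the inner search, after row `l` has been set to a generator
    have inner : ∀ (g : Fin d → ℤ) (σ' σ'' : Cfg d), g ∈ generators P.w P.e →
        P.Progress x F (l :: ls) σ σ' → σ''.row l = g →
        (∀ q < P.base, σ''.mem q = σ'.mem q) →
        (∀ v, ¬ v.IsScratch → (∀ i, v ≠ .r l i) → σ''.reg v = σ'.reg v) →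
        P.Ex (nest ls) σ'' (P.tNest m ls.length) fun τ => P.Progress x F (l :: ls) σ τ ∧
          F σ'.bestVal ≤ F τ.bestVal ∧ τ.reg (idxOf l) = σ'.reg (idxOf l) ∧
          ∀ A : Fin d → Fin d → ℤ, (∀ l, A l ∈ generators P.w P.e) →
            (∀ k ∉ l :: ls, A k = σ.row k) → A l = g →
            ∀ b ∈ signs d, F (P.value x (candidate A b)) ≤ F τ.bestVal := by
      intro g σ' σ'' hg hp hgl hm hv
      have hbv : σ''.bestVal = σ'.bestVal := funext fun i => hv _ (by simp [IsScratch]) (by simp)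
      have hrow' : ∀ k, k ≠ l → σ''.row k = σ'.row k := fun k hk => funext fun i =>
        hv _ (by simp [IsScratch]) (fun j h => hk (by injection h))
      have hp' : P.Progress x F (l :: ls) σ' σ'' := by
        refine ⟨hp.inv.congr (fun k hk => hv _ (not_isScratch hk) (by simp)) hm
          (fun i => hv _ (by simp [IsScratch]) (by simp))
          (fun i => hv _ (by simp [IsScratch]) (by simp)), fun k _ =>
          hv _ (by simp [IsScratch]) (by simp), fun k hk => hrow' k ?_, by rw [hbv]⟩
        rintro rfl; simp at hk
      have hrl : ∀ k ∉ ls, k ≠ l → σ''.row k = σ.row k := fun k hk hkl => by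
        rw [hrow' k hkl, hp.row k (by simp [hk, hkl])]
      refine (ih hnd' σ'' hp'.inv (fun k hk => ?_)).mono le_rfl ?_
      · by_cases hkl : k = l
        · rw [hkl, hgl]; exact hg
        · rw [hrl k hk hkl]; exact hrow k (by simp [hk, hkl])
      · rintro τ ⟨h1, h2⟩
        refine ⟨(hp.trans hp').trans (h1.mono (by simp)), by rw [← hbv]; exact h1.le, ?_,
          fun A hA hAk hAl => h2 A hA fun k hk => ?_⟩
        · rw [h1.idx l hl]; exact hv _ (by simp [IsScratch]) (by simp)
        · by_cases hkl : k = l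
          · rw [hkl, hAl, hgl]
          · rw [hrl k hk hkl]; exact hAk k (by simp [hk, hkl])
    refine Env.Ex.seq (R := fun σ' => P.Progress x F (l :: ls) σ σ' ∧
      ∀ A : Fin d → Fin d → ℤ, (∀ l, A l ∈ generators P.w P.e) →
        (∀ k ∉ l :: ls, A k = σ.row k) → (∃ k, A l = fun i => dot (P.w i) (P.e k)) →
        ∀ b ∈ signs d, F (P.value x (candidate A b)) ≤ F σ'.bestVal) ?_ ?_
    -- Before round `k`, all matrices whose row `l` is the image of a vector with index below `k`
    -- are covered.
    · refine Env.Ex.forLoop m (by exact_mod_cast P.num_le) (fun k σ' => σ'.reg (idxOf l) = k ∧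
        P.Progress x F (l :: ls) σ σ' ∧
        ∀ A : Fin d → Fin d → ℤ, (∀ l, A l ∈ generators P.w P.e) →
          (∀ k ∉ l :: ls, A k = σ.row k) →
          (∃ k' : Fin m, (k' : ℕ) < k ∧ A l = fun i => dot (P.w i) (P.e k')) →
          ∀ b ∈ signs d, F (P.value x (candidate A b)) ≤ F σ'.bestVal) ?_ ?_ ?_ ?_
      · refine ⟨by simp, ⟨hσ.congr ?_ ?_ ?_ ?_, ?_, ?_, ?_⟩, ?_⟩
        · intro k _; rw [Cfg.set_reg_of_ne _ (by simp)]
        · intro q _; rfl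
        · intro i; rw [Cfg.set_reg_of_ne _ (by simp)]
        · intro i; rw [Cfg.set_reg_of_ne _ (by simp)]
        · intro k hk
          rw [Cfg.set_reg_of_ne]
          rintro h; injection h with _ h; subst h; simp at hk
        · intro k hk; rfl
        · exact le_of_eq rfl
        · rintro A - - ⟨k', hk', -⟩; omega
      · rintro k σ' ⟨h1, h2, -⟩
        exact ⟨h1, h2.inv.1.numPred⟩
      · rintro k hk σ' ⟨h1, h2, h3⟩
        have hdim := h2.inv.1.dim
        refine (ex_dotVec h2.inv.1 (u := .r l) (fun i j h => by injection h) (by simp)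
          ((d + k) * n) (P.e ⟨k, hk⟩) (by simp only [weight, Int.natAbs_natCast]; omega)
          (fun ρ hρ => ?_) ?_ (fun j => h2.inv.1.mem_e ⟨k, hk⟩ j) (P.abs_e_le _)).seq ?_
        · simp only [eval]
          rw [hρ _ (by simp [IsScratch]) (by simp), hρ _ (not_isScratch (by decide)) (by simp), h1,
            hdim]
          push_cast; rfl
        · have h4 : (d + k + 1) * n ≤ (d + m) * n := Nat.mul_le_mul_right _ (by omega)
          rw [Nat.add_mul (d + k), Nat.one_mul] at h4
          have : (d + k) * n + n ≤ 2 ^ P.lam := by omega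
          exact_mod_cast this
        · rintro σ'' ⟨g1, g2, g3⟩
          refine (inner (fun i => dot (P.w i) (P.e ⟨k, hk⟩)) σ' σ'' (Or.inl ⟨_, rfl⟩) h2
            (funext g2) (fun q _ => by rw [g1]) g3).mono le_rfl ?_
          rintro τ ⟨t1, t2, t3, t4⟩
          have hbv : (τ.set (idxOf l) (k + 1)).bestVal = τ.bestVal := rfl
          refine ⟨by rw [t3, h1], by simp, t1.trans ⟨t1.inv.congr ?_ ?_ ?_ ?_, ?_, ?_, ?_⟩, ?_⟩
          · intro k _; rw [Cfg.set_reg_of_ne _ (by simp)]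
          · intro q _; rfl
          · intro i; rw [Cfg.set_reg_of_ne _ (by simp)]
          · intro i; rw [Cfg.set_reg_of_ne _ (by simp)]
          · intro k hk
            rw [Cfg.set_reg_of_ne]
            rintro h; injection h with _ h; subst h; simp at hk
          · intro k hk; rfl
          · exact le_of_eq rfl
          · rintro A hA hAk ⟨k', hk', hAl⟩ b hb
            rw [hbv]
            by_cases hkk : (k' : ℕ) = k
            · obtain rfl : k' = ⟨k, hk⟩ := Fin.ext hkk
              exact t4 A hA hAk hAl b hb
            · exact (h3 A hA hAk ⟨k', by omega, hAl⟩ b hb).trans t2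
      · rintro σ' ⟨-, h2, h3⟩
        exact ⟨h2, fun A hA hAk ⟨k, hk⟩ => h3 A hA hAk ⟨k, k.2, hk⟩⟩
    · rintro σ₁ ⟨p₁, q₁⟩
      refine (Env.Ex.seqs (E := P.toEnv) (t := d * P.U + P.tNest m ls.length)
        (P := fun j => .seq (assignVec (.r l) fun i => .const ((Pi.single j 1 : Fin d → ℤ) i))
          (nest ls))
        (I := fun J σ' => P.Progress x F (l :: ls) σ σ' ∧ F σ₁.bestVal ≤ F σ'.bestVal ∧
          ∀ A : Fin d → Fin d → ℤ, (∀ l, A l ∈ generators P.w P.e) →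
            (∀ k ∉ l :: ls, A k = σ.row k) → (∃ j ∈ J, A l = Pi.single j 1) →
            ∀ b ∈ signs d, F (P.value x (candidate A b)) ≤ F σ'.bestVal) (List.finRange d)
        ?_ ∅ σ₁ ⟨p₁, le_rfl, by simp⟩).mono (by simp) ?_
      · rintro j - J σ' ⟨h1, h2, h3⟩
        refine (Env.Ex.assignVec (u := .r l) (fun i j h => by injection h) (Pi.single j 1)
          (fun i => ?_) (fun i ρ _ => rfl) (fun i => ?_)).seq ?_
        · by_cases hij : i = j
          · subst hij; simp only [weight, Pi.single_eq_same, Int.natAbs_one]; omega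
          · simp only [weight, Pi.single_eq_of_ne hij, Int.natAbs_zero]; omega
        · exact (P.abs_generator_le (Or.inr ⟨j, rfl⟩) i).trans P.two_pow_kap_le
        · rintro σ'' ⟨g1, g2, g3⟩
          refine (inner (Pi.single j 1) σ' σ'' (Or.inr ⟨j, rfl⟩) h1 (funext g2)
            (fun q _ => by rw [g1]) (fun v _ hv => g3 v hv)).mono le_rfl ?_
          rintro τ ⟨t1, t2, -, t4⟩
          refine ⟨t1, h2.trans t2, ?_⟩
          rintro A hA hAk ⟨j', hj', hAl⟩ b hb
          rcases hj' with rfl | hj'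
          · exact t4 A hA hAk hAl b hb
          · exact (h3 A hA hAk ⟨j', hj', hAl⟩ b hb).trans t2
      · rintro σ₂ ⟨h1, h2, h3⟩
        refine ⟨h1, fun A hA hAk b hb => ?_⟩
        rcases hA l with ⟨k, hk⟩ | ⟨j, hj⟩
        · exact (q₁ A hA hAk ⟨k, hk⟩ b hb).trans h2
        · exact h3 A hA hAk ⟨j, by simp, hj⟩ b hb


/-! ### The whole algorithm -/

/-- A bound for the number of operations of the algorithm. -/
noncomputable def _root_.ConvexOpt.Env.tMain (E : Env n d) (m : ℕ) : ℕ :=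
  E.U + (E.U + (E.U + (E.U + (E.U + (E.U + (E.tBuild + (1 + (1 + (E.U + (d * E.tDot +
    (E.tNest m d + (d * E.U + (E.tBuild + 1)))))))))))))

theorem ex_main {S : Finset (Fin n → ℤ)} {c : (Fin d → ℝ) → ℝ} (hlin : IsLinearOracle S P.O.lin)
    (hE : CoversEdgeDirections (Set.range P.e) (polytope S)) (hc : ConvexOn ℝ Set.univ c)
    (hcmp : IsComparisonOracle c P.O.cmp) (hSb : ∀ x ∈ S, ∀ j, |x j| ≤ 2 ^ P.bet)
    {σ : Cfg d} (hdim : σ.reg dim = n) (hnum : σ.reg num = m) (hz : σ.reg zero = 0)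
    (hf : ∀ k i, σ.reg (.f k i) = 0)
    (hw : ∀ (i : Fin d) (j : Fin n), σ.mem (i * n + j) = P.w i j)
    (he : ∀ (k : Fin m) (j : Fin n), σ.mem ((d + k) * n + j) = P.e k j) :
    P.Ex (mainProg d) σ (P.tMain m) fun σ' =>
      (σ'.reg dim = 1 ∧ ∃ x ∈ S, (∀ j : Fin n, σ'.mem j = x j) ∧
        ∀ y ∈ S, objective c P.w y ≤ objective c P.w x) ∨
      (σ'.reg dim = 0 ∧ ¬ ∃ x ∈ S, ∀ y ∈ S, objective c P.w y ≤ objective c P.w x) := by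
  have hgam := P.dim_le_gam
  have haddr := P.addr_le
  have hnl : (n : ℤ) ≤ 2 ^ P.lam := by exact_mod_cast P.dim_le
  have hml : (m : ℤ) ≤ 2 ^ P.lam := by exact_mod_cast P.num_le
  have hone : (1 : ℤ) ≤ 2 ^ P.lam := one_le_pow₀ (by norm_num)
  have hbig : ((d : ℤ) + m) * n + 2 * n + 2 * d ≤ 2 ^ P.lam := by exact_mod_cast haddr
  have hb0 : (0 : ℤ) ≤ (d + m) * n := by positivity
  refine Env.Ex.seq (R := fun σ' => σ' = σ.set dimPred (n - 1))
    (Env.Ex.assign (by simp only [weight, Int.natAbs_one]; omega)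
      (by simp only [eval, hdim]; rw [abs_le]; constructor <;> linarith)
      (by simp only [eval, hdim])) ?_
  rintro _ rfl
  set σ₁ := σ.set dimPred (n - 1) with hσ₁
  have ev₁ : (Exp.sub (.var num) (.const 1)).eval σ₁.reg = m - 1 := by simp [eval, hσ₁, hnum]
  refine Env.Ex.seq (R := fun σ' => σ' = σ₁.set numPred (m - 1))
    (Env.Ex.assign (by simp only [weight, Int.natAbs_one]; omega)
      (by rw [ev₁, abs_le]; constructor <;> linarith) (by rw [ev₁])) ?_
  rintro _ rfl
  set σ₂ := σ₁.set numPred (m - 1) with hσ₂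
  have ev₂ : (Exp.mul (.add (.const (d : ℕ)) (.var num)) (.var dim)).eval σ₂.reg
      = (d + m) * n := by simp [eval, hσ₁, hσ₂, hnum, hdim]
  refine Env.Ex.seq (R := fun σ' => σ' = σ₂.set addrB ((d + m) * n))
    (Env.Ex.assign (by simp only [weight, Int.natAbs_natCast]; omega)
      (by rw [ev₂, abs_of_nonneg hb0]; linarith) (by rw [ev₂])) ?_
  rintro _ rfl
  set σ₃ := σ₂.set addrB ((d + m) * n) with hσ₃
  have ev₃ : (Exp.add (.var addrB) (.var dim)).eval σ₃.reg
      = (d + m) * n + n := by simp [eval, hσ₁, hσ₂, hσ₃, hdim]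
  refine Env.Ex.seq (R := fun σ' => σ' = σ₃.set addrX ((d + m) * n + n))
    (Env.Ex.assign (by simp only [weight]; omega)
      (by rw [ev₃, abs_of_nonneg (by positivity)]; linarith) (by rw [ev₃])) ?_
  rintro _ rfl
  set σ₄ := σ₃.set addrX ((d + m) * n + n) with hσ₄
  have ev₄ : (Exp.add (.var addrX) (.var dim)).eval σ₄.reg
      = (d + m) * n + n + n := by simp [eval, hσ₁, hσ₂, hσ₃, hσ₄, hdim]
  refine Env.Ex.seq (R := fun σ' => σ' = σ₄.set addrY ((d + m) * n + n + n))
    (Env.Ex.assign (by simp only [weight]; omega)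
      (by rw [ev₄, abs_of_nonneg (by positivity)]; linarith) (by rw [ev₄])) ?_
  rintro _ rfl
  set σ₅ := σ₄.set addrY ((d + m) * n + n + n) with hσ₅
  have ev₅ : (Exp.add (.var addrY) (.const (d : ℕ))).eval σ₅.reg
      = (d + m) * n + n + n + d := by simp [eval, hσ₅]
  refine Env.Ex.seq (R := fun σ' => σ' = σ₅.set addrZ ((d + m) * n + n + n + d))
    (Env.Ex.assign (by simp only [weight, Int.natAbs_natCast]; omega)
      (by rw [ev₅, abs_of_nonneg (by positivity)]; linarith) (by rw [ev₅])) ?_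
  rintro _ rfl
  set σ₆ := σ₅.set addrZ ((d + m) * n + n + n + d) with hσ₆
  have c₆ : P.Ctx σ₆ := by
    constructor
    · simp [hσ₁, hσ₂, hσ₃, hσ₄, hσ₅, hσ₆, hdim]
    · simp [hσ₁, hσ₂, hσ₃, hσ₄, hσ₅, hσ₆]
    · simp [hσ₂, hσ₃, hσ₄, hσ₅, hσ₆]
    · simp [hσ₃, hσ₄, hσ₅, hσ₆, base]
    · simp [hσ₄, hσ₅, hσ₆, base]
    · simp [hσ₅, hσ₆, base]; ring
    · simp [hσ₆, base]; ring
    · simp [hσ₁, hσ₂, hσ₃, hσ₄, hσ₅, hσ₆, hz]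
    · exact hw
    · exact he
  have f₆ : ∀ k i, σ₆.reg (.f k i) = 0 := fun k i => by
    simp [hσ₁, hσ₂, hσ₃, hσ₄, hσ₅, hσ₆, hf]
  -- The direction registers are initially zero, so the first query is the zero functional: it
  -- yields some point of `S`, or no answer exactly if `S` is empty.
  refine (ex_buildQuery c₆ 0 (fun i => f₆ _ i) (by simp)).seq ?_
  rintro σ₇ ⟨r₇, q₇, m₇⟩
  have c₇ : P.Ctx σ₇ := c₆.congr (fun k hk => r₇ _ (not_isScratch hk))
    fun q hq => m₇ q (Or.inl hq)
  rcases S.eq_empty_or_nonempty with rfl | hS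
  · have hnone : P.O.lin (pull P.w 0) = none := by
      by_contra hne
      obtain ⟨x, hx⟩ := Option.ne_none_iff_exists'.1 hne
      simpa using ((hlin (pull P.w 0)).1 x hx).1
    refine Env.Ex.seq (R := fun σ' => σ' = σ₇.set flag 0)
      (Env.Ex.linQuery_none P.base (P.base + n) (pull P.w 0) c₇.addrB c₇.addrX q₇ hnone rfl) ?_
    rintro _ rfl
    have hz' : (σ₇.set flag 0).reg zero = 0 := by
      rw [Cfg.set_reg_of_ne _ (by simp)]; exact c₇.zero
    -- `dim` is register `0`, the output register; clearing it asserts that there is no optimal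
    -- solution.
    refine Env.Ex.ite (fun _ => ?_) (fun h => absurd (by rw [hz']; simp) h)
    refine Env.Ex.mono (t := P.U) (Env.Ex.assign (Q := fun σ' => σ'.reg dim = 0)
      (by simp only [weight, Int.natAbs_zero]; omega)
      (by simp [eval]) (by simp [eval])) (by omega) fun σ' h => Or.inr ⟨h, by simp⟩
  · have hsome : ∀ u, ∃ x, P.O.lin u = some x := fun u => by
      by_contra hne
      push Not at hne
      have hnone : P.O.lin u = none := Option.eq_none_iff_forall_ne_some.2 hne
      obtain ⟨x, hx, hm⟩ := S.exists_max_image (fun x => dot u x) hS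
      exact (hlin u).2 hnone ⟨x, hx, hm⟩
    choose x hx using hsome
    have hxS : ∀ u, x u ∈ S ∧ ∀ y ∈ S, dot u y ≤ dot u (x u) := fun u => (hlin u).1 _ (hx u)
    have hxb : ∀ u j, |x u j| ≤ 2 ^ P.bet := fun u j => hSb _ (hxS u).1 j
    have hxl : ∀ u j, |x u j| ≤ 2 ^ P.lam := by
      intro u j
      have hn : 0 < n := j.pos
      refine (hxb u j).trans (le_trans ?_ (P.n_mul_le.trans P.two_pow_kap_le))
      have h1 : (1 : ℤ) ≤ 2 ^ P.bet := one_le_pow₀ (by norm_num)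
      have h2 : (1 : ℤ) ≤ n := by exact_mod_cast hn
      nlinarith
    set F : (Fin d → ℤ) → ℝ := fun y => c fun i => (y i : ℝ) with hFdef
    have hF : ∀ y z : Fin d → ℤ,
        P.O.cmp (fun i => (y i : ℚ)) (fun i => (z i : ℚ)) = true ↔ F y ≤ F z := fun y z => by
      rw [hcmp]; simp [hFdef]
    refine Env.Ex.seq (R := fun σ' => σ' = (σ₇.writeVec (P.base + n) (x (pull P.w 0))).set flag 1)
      (Env.Ex.linQuery_some P.base (P.base + n) (pull P.w 0) (x (pull P.w 0)) c₇.addrB c₇.addrX q₇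
        (hx _) (hxl _) rfl) ?_
    rintro _ rfl
    set σ₈ := (σ₇.writeVec (P.base + n) (x (pull P.w 0))).set flag 1 with hσ₈
    have r₈ : ∀ v : Var d, ¬ v.IsScratch → σ₈.reg v = σ₆.reg v := fun v hv => by
      rw [hσ₈, Cfg.set_reg_of_ne _ (by rintro rfl; simp [IsScratch] at hv)]
      exact r₇ v hv
    have c₈ : P.Ctx σ₈ := c₆.congr (fun k hk => r₈ _ (not_isScratch hk)) fun q hq => by
      simp only [hσ₈, Cfg.set_mem, Cfg.writeVec]
      rw [dif_neg (by omega), m₇ q (Or.inl hq)]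
    refine Env.Ex.ite (fun h => ?_) (fun _ => ?_)
    · rw [c₈.zero, hσ₈, Cfg.set_reg_self] at h
      norm_num at h
    refine Env.Ex.mono (t := d * P.tDot + (P.tNest m d + (d * P.U + (P.tBuild + 1)))) ?_
      (by omega) fun _ h => Or.inl h
    refine (ex_dotVec c₈ (u := Var.bestVal) (fun i j h => by simpa using h) (by simp)
      (P.base + n) (x (pull P.w 0)) (by simp only [weight]; omega) ?_ ?_ ?_ (hxb _)).seq ?_
    · intro ρ hρ
      simp only [eval]
      rw [hρ _ (not_isScratch (by decide)) (by simp), c₈.addrX]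
    · have : P.base + n + n ≤ 2 ^ P.lam := by unfold base; omega
      exact_mod_cast this
    · intro j
      simp only [hσ₈, Cfg.set_mem, Cfg.writeVec]
      rw [dif_pos ⟨by omega, by omega⟩]
      congr 1
      ext
      simp
    rintro σ₉ ⟨m₉, v₉, r₉⟩
    -- The registers for the best direction are still zero, which matches the best values just
    -- computed from the first query, so the search invariant holds at the start.
    have hd₉ : σ₉.bestDir = 0 := funext fun i => by
      simp only [Cfg.bestDir]
      rw [r₉ _ (by simp [IsScratch]) (by simp), r₈ _ (by simp [IsScratch]), f₆]; rfl
    have i₉ : P.Inv x σ₉ := by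
      refine ⟨c₈.congr (fun k hk => r₉ _ (not_isScratch hk) (by simp)) fun q _ => by rw [m₉], ?_, ?_⟩
      · rw [hd₉]; exact funext v₉
      · rw [hd₉]; simp
    refine ((ex_nest hx hxb hF (List.finRange d) (List.nodup_finRange d) σ₉ i₉ (by simp)).mono
      (by rw [List.length_finRange]) fun _ h => h).seq ?_
    rintro τ ⟨hp, hcov⟩
    obtain ⟨cτ, bτ, dτ⟩ := hp.inv
    refine (Env.Ex.assignVec (u := dir) (fun i j h => by simpa using h) τ.bestDir
      (fun i => by simp only [weight]; omega) (fun i ρ hρ => by simp only [eval]; exact hρ _ (by simp))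
      (fun i => (dτ i).trans (pow_le_pow_right₀ (by norm_num) P.kap_gam_le))).seq ?_
    rintro τ₁ ⟨n₁, d₁, g₁⟩
    have cτ₁ : P.Ctx τ₁ := cτ.congr (fun k _ => g₁ _ (by simp)) fun q _ => by rw [n₁]
    refine (ex_buildQuery cτ₁ τ.bestDir d₁ dτ).seq ?_
    rintro τ₂ ⟨g₂, q₂, n₂⟩
    have cτ₂ : P.Ctx τ₂ := cτ₁.congr (fun k hk => g₂ _ (not_isScratch hk))
      fun q hq => n₂ q (Or.inl hq)
    -- The oracle is a function, so the repeated query returns the point whose value was recorded.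
    -- The variable `zero` sends the answer to cell `0`, and the success flag goes to register `0`.
    refine Env.Ex.linQuery_some P.base 0 (pull P.w τ.bestDir) (x (pull P.w τ.bestDir)) cτ₂.addrB
      cτ₂.zero q₂ (hx _) (hxl _) ⟨by simp, x (pull P.w τ.bestDir), (hxS _).1, fun j => ?_, ?_⟩
    · simp [Cfg.writeVec]
    · intro y hy
      obtain ⟨A, hA, b, hb, hle⟩ := exists_candidate_ge S P.w P.e c hc hE x hxS y hy
      -- All rows were free in the search, so every matrix of generators is covered.
      have h1 := hcov A hA (fun l hl => absurd (List.mem_finRange l) hl) b (mem_signs.2 hb)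
      rw [bτ] at h1
      exact hle.trans h1

end Setting

/-! ### Polynomial bounds -/

/-- The function `f` is bounded by a polynomial in `size`. -/
def PolyBounded {ι : Type*} (size f : ι → ℕ) : Prop :=
  ∃ p : Polynomial ℕ, ∀ i, f i ≤ p.eval (size i)

namespace PolyBounded

variable {ι : Type*} {size f g : ι → ℕ}

theorem const (k : ℕ) : PolyBounded size fun _ => k := ⟨Polynomial.C k, fun i => by simp⟩

theorem of_le (h : ∀ i, f i ≤ size i) : PolyBounded size f :=
  ⟨Polynomial.X, fun i => by simpa using h i⟩

theorem mono (hg : PolyBounded size g) (h : ∀ i, f i ≤ g i) : PolyBounded size f := by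
  obtain ⟨p, hp⟩ := hg
  exact ⟨p, fun i => (h i).trans (hp i)⟩

theorem add (hf : PolyBounded size f) (hg : PolyBounded size g) :
    PolyBounded size fun i => f i + g i := by
  obtain ⟨p, hp⟩ := hf
  obtain ⟨q, hq⟩ := hg
  exact ⟨p + q, fun i => by rw [Polynomial.eval_add]; exact Nat.add_le_add (hp i) (hq i)⟩

theorem mul (hf : PolyBounded size f) (hg : PolyBounded size g) :
    PolyBounded size fun i => f i * g i := by
  obtain ⟨p, hp⟩ := hf
  obtain ⟨q, hq⟩ := hg
  exact ⟨p * q, fun i => by rw [Polynomial.eval_mul]; exact Nat.mul_le_mul (hp i) (hq i)⟩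

end PolyBounded

/-- A bound for the weights of the expressions in the program. -/
noncomputable def maxWeight (d : ℕ) : ℕ :=
  d + 4 + ((signs d).map fun b => ∑ i, (cand b i).weight).sum

theorem weight_cand_le {d : ℕ} {b : Fin d → ℤ} (hb : b ∈ signs d) (i : Fin d) :
    (cand b i).weight ≤ maxWeight d := by
  have h1 : (cand b i).weight ≤ ∑ i, (cand b i).weight :=
    Finset.single_le_sum (f := fun i => (cand b i).weight) (fun _ _ => Nat.zero_le _)
      (Finset.mem_univ i)
  have h2 : ∑ i, (cand b i).weight ≤ ((signs d).map fun b => ∑ i, (cand b i).weight).sum :=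
    List.le_sum_of_mem (List.mem_map_of_mem (f := fun b => ∑ i, (cand b i).weight) hb)
  unfold maxWeight
  omega

/-- The setting for input data of total size at most `N`. -/
noncomputable def Setting.ofSize {n d m : ℕ} (N : ℕ) (w : Fin d → Fin n → ℤ) (e : Fin m → Fin n → ℤ)
    (O : Oracles n d) (hN : n + m ≤ N) (hw : ∀ i j, |w i j| ≤ 2 ^ N) (he : ∀ i j, |e i j| ≤ 2 ^ N) :
    Setting n d m where
  O := O
  -- The exponent accommodates query entries, at most `d * 2 ^ (kap * gam) * 2 ^ N`, and addresses,
  -- at most `2 ^ (n + m + d + 4)`.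
  lam := (3 * N + 1) * maxWeight d + N + d + 4
  gam := maxWeight d
  one_le_lam := by omega
  three_le_gam := by unfold maxWeight; omega
  dim_le := Nat.lt_two_pow_self.le.trans (Nat.pow_le_pow_right (by norm_num) (by omega))
  len_le := Nat.lt_two_pow_self.le.trans (Nat.pow_le_pow_right (by norm_num) (by omega))
  w := w
  e := e
  bet := N
  -- Products `dot u z` are at most `n * 2 ^ N * 2 ^ N ≤ 2 ^ (3 * N)`; the extra `1` keeps the
  -- exponent positive when `N = 0`.
  kap := 3 * N + 1
  abs_w_le := hw
  abs_e_le := he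
  addr_le := by
    have h1 : d + m + 2 ≤ 2 ^ (d + m + 2) := Nat.lt_two_pow_self.le
    have h2 : n + 2 ≤ 2 ^ (n + 2) := Nat.lt_two_pow_self.le
    calc (d + m) * n + 2 * n + 2 * d ≤ (d + m + 2) * (n + 2) := by nlinarith
      _ ≤ 2 ^ (d + m + 2) * 2 ^ (n + 2) := Nat.mul_le_mul h1 h2
      _ = 2 ^ (d + m + 2 + (n + 2)) := (pow_add _ _ _).symm
      _ ≤ _ := Nat.pow_le_pow_right (by norm_num) (by omega)
  num_le := Nat.lt_two_pow_self.le.trans (Nat.pow_le_pow_right (by norm_num) (by omega))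
  dim_le_gam := by unfold maxWeight; omega
  cand_le b hb i := weight_cand_le hb i
  one_le_kap := by omega
  dot_le := by
    have h1 : n ≤ 2 ^ N := (by omega : n ≤ N).trans Nat.lt_two_pow_self.le
    calc n * (2 ^ N * 2 ^ N) ≤ 2 ^ N * (2 ^ N * 2 ^ N) := Nat.mul_le_mul_right _ h1
      _ = 2 ^ (N + (N + N)) := by rw [pow_add, pow_add]
      _ ≤ _ := Nat.pow_le_pow_right (by norm_num) (by omega)
  pull_le := by
    have h1 : d ≤ 2 ^ d := Nat.lt_two_pow_self.le
    calc d * (2 ^ ((3 * N + 1) * maxWeight d) * 2 ^ N)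
        ≤ 2 ^ d * (2 ^ ((3 * N + 1) * maxWeight d) * 2 ^ N) := Nat.mul_le_mul_right _ h1
      _ = 2 ^ (d + ((3 * N + 1) * maxWeight d + N)) := by rw [pow_add, pow_add]
      _ ≤ _ := Nat.pow_le_pow_right (by norm_num) (by omega)
  kap_gam_le := by omega

section

variable {ι : Type*} {d : ℕ} {size nn mm : ι → ℕ} {P : (i : ι) → Env (nn i) d} {G : ℕ}

/-- The weight bound `gam` depends on `d` only, so a simple statement takes a constant number of
operations, whatever the lengths of the numbers. -/
theorem polyBounded_U (hG : ∀ i, (P i).gam = G) : PolyBounded size fun i => (P i).U :=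
  (PolyBounded.const (6 * G + 4)).mono fun i => by rw [Env.U, hG]

theorem polyBounded_tDot (hG : ∀ i, (P i).gam = G) (hn : ∀ i, nn i ≤ size i) :
    PolyBounded size fun i => (P i).tDot := by
  have u := polyBounded_U (size := size) hG
  have n := PolyBounded.of_le hn
  have o := PolyBounded.const (size := size) 1
  exact u.add (((n.mul (((u.add (u.add u)).add u).add o)).add o |>.add u).add u)

theorem polyBounded_tBuild (hG : ∀ i, (P i).gam = G) (hn : ∀ i, nn i ≤ size i) :
    PolyBounded size fun i => (P i).tBuild := by
  have u := polyBounded_U (size := size) hG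
  have n := PolyBounded.of_le hn
  have o := PolyBounded.const (size := size) 1
  have d := PolyBounded.const (size := size) d
  exact ((n.mul (((u.add ((d.mul (u.add u)).add u)).add u).add o)).add o).add u

theorem polyBounded_tTry (hG : ∀ i, (P i).gam = G) (hn : ∀ i, nn i ≤ size i) :
    PolyBounded size fun i => (P i).tTry := by
  have u := polyBounded_U (size := size) hG
  have o := PolyBounded.const (size := size) 1
  have d := PolyBounded.const (size := size) d
  have b := polyBounded_tBuild hG hn
  have t := polyBounded_tDot hG hn
  have pr : PolyBounded size fun i => (P i).tProbe := b.add (o.add (d.mul t))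
  exact (d.mul u).add (pr.add ((d.mul u).add ((d.mul u).add
    (o.add (o.add ((d.mul u).add (d.mul u)))))))

/-- Each level multiplies the bound by a polynomial, so the degree grows with the depth `k`; this is
where `d` has to be fixed. -/
theorem polyBounded_tNest (hG : ∀ i, (P i).gam = G) (hn : ∀ i, nn i ≤ size i)
    (hm : ∀ i, mm i ≤ size i) (k : ℕ) : PolyBounded size fun i => (P i).tNest (mm i) k := by
  have u := polyBounded_U (size := size) hG
  have o := PolyBounded.const (size := size) 1
  have dd := PolyBounded.const (size := size) d
  have t := polyBounded_tDot hG hn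
  have m := PolyBounded.of_le hm
  induction k with
  | zero => exact (PolyBounded.const (signs d).length).mul (polyBounded_tTry hG hn)
  | succ k ih =>
    exact (((m.mul ((((dd.mul t).add ih).add u).add o)).add o).add u).add
      (dd.mul ((dd.mul u).add ih))

theorem polyBounded_tMain (hG : ∀ i, (P i).gam = G) (hn : ∀ i, nn i ≤ size i)
    (hm : ∀ i, mm i ≤ size i) : PolyBounded size fun i => (P i).tMain (mm i) := by
  have u := polyBounded_U (size := size) hG
  have o := PolyBounded.const (size := size) 1
  have dd := PolyBounded.const (size := size) d
  have t := polyBounded_tDot hG hn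
  have b := polyBounded_tBuild hG hn
  have ne := polyBounded_tNest hG hn hm d
  exact u.add (u.add (u.add (u.add (u.add (u.add (b.add (o.add (o.add (u.add ((dd.mul t).add
    (ne.add ((dd.mul u).add (b.add o)))))))))))))

/-- The lengths of the numbers influence only the price of one operation, through `lam`. -/
theorem polyBounded_K (hG : ∀ i, (P i).gam = G) (hn : ∀ i, nn i ≤ size i)
    (hlam : PolyBounded size fun i => (P i).lam) : PolyBounded size fun i => (P i).K := by
  have c : ∀ k, PolyBounded size fun _ => k := PolyBounded.const
  have g : PolyBounded size fun i => (P i).gam := (c G).mono fun i => (hG i).le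
  have mu : PolyBounded size fun i => (P i).mu :=
    (((hlam.mul g).add (c (numVars d))).add g).add (c 10)
  exact (c 1).add ((((c 6).add ((c 4).mul (PolyBounded.of_le hn))).add ((c 4).mul (c d))).mul mu)

end

/-! ### The main theorem -/

/-- The configuration of the initial state. -/
def initialCfg {n d m : ℕ} (w : Fin d → Fin n → ℤ) (e : Fin m → Fin n → ℤ) : Cfg d where
  reg v := if v = .dim then n else if v = .num then m else 0
  mem a := if h : a < (d + m) * n then Fin.append w e (Fin.divNat ⟨a, h⟩) (Fin.modNat ⟨a, h⟩) else 0

theorem initialCfg_mem {n d m : ℕ} (w : Fin d → Fin n → ℤ) (e : Fin m → Fin n → ℤ)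
    (i : Fin (d + m)) (j : Fin n) : (initialCfg w e).mem (i * n + j) = Fin.append w e i j := by
  have h1 := j.2
  have hlt : (i * n + j : ℕ) < (d + m) * n := by
    have h2 : (i + 1) * n ≤ (d + m) * n := Nat.mul_le_mul_right _ i.2
    rw [Nat.add_mul, Nat.one_mul] at h2
    omega
  have hn : 0 < n := j.pos
  have e1 : Fin.divNat (⟨i * n + j, hlt⟩ : Fin ((d + m) * n)) = i := by
    ext
    simp only [Fin.coe_divNat]
    rw [Nat.add_comm, Nat.add_mul_div_right _ _ hn, Nat.div_eq_of_lt h1, zero_add]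
  have e2 : Fin.modNat (⟨i * n + j, hlt⟩ : Fin ((d + m) * n)) = j := by
    ext
    simp only [Fin.coe_modNat]
    rw [Nat.add_comm, Nat.add_mul_mod_self_right, Nat.mod_eq_of_lt h1]
  simp only [initialCfg, dif_pos hlt, e1, e2]

theorem rep_initialCfg {n d m k : ℕ} (w : Fin d → Fin n → ℤ) (e : Fin m → Fin n → ℤ)
    (hn : n ≤ 2 ^ k) (hm : m ≤ 2 ^ k) (hw : ∀ i j, |w i j| ≤ 2 ^ k) (he : ∀ i j, |e i j| ≤ 2 ^ k) :
    Rep k (initialCfg w e) (inputState w e) where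
  reg v := by
    have h0 : v.idx = 0 ↔ v = .dim := ⟨fun h => Var.idx_injective h, fun h => h ▸ rfl⟩
    have h1 : v.idx = 1 ↔ v = .num := ⟨fun h => Var.idx_injective h, fun h => h ▸ rfl⟩
    simp only [inputState, initialCfg, h0, h1]
    split_ifs <;> simp
  mem a := by
    simp only [inputState, initialCfg]
    split_ifs <;> simp
  reg_le v := by
    simp only [initialCfg]
    split_ifs
    · rw [Nat.abs_cast]; exact_mod_cast hn
    · rw [Nat.abs_cast]; exact_mod_cast hm
    · simp
  mem_le a := by
    simp only [initialCfg]
    split_ifs with h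
    · generalize Fin.divNat ⟨a, h⟩ = i
      generalize Fin.modNat ⟨a, h⟩ = j
      refine Fin.addCases (fun i => ?_) (fun i => ?_) i
      · rw [Fin.append_left]; exact hw i j
      · rw [Fin.append_right]; exact he i j
    · simp

theorem abs_le_two_pow_famLen {k n : ℕ} (v : Fin k → Fin n → ℤ) (i : Fin k) (j : Fin n) :
    |v i j| ≤ 2 ^ famLen v := by
  refine (abs_le_two_pow_intLen _).trans (pow_le_pow_right₀ (by norm_num) ?_)
  have h1 : intLen (v i j) ≤ ∑ j, intLen (v i j) :=
    Finset.single_le_sum (f := fun j => intLen (v i j)) (fun _ _ => Nat.zero_le _)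
      (Finset.mem_univ j)
  have h2 : ∑ j, intLen (v i j) ≤ famLen v :=
    Finset.single_le_sum (f := fun i => ∑ j, intLen (v i j)) (fun _ _ => Nat.zero_le _)
      (Finset.mem_univ i)
  exact h1.trans h2

theorem abs_le_radius {n : ℕ} {S : Finset (Fin n → ℤ)} {x : Fin n → ℤ} (hx : x ∈ S) (j : Fin n) :
    |x j| ≤ radius S := by
  have h1 : (x j).natAbs ≤ Finset.univ.sup fun j => (x j).natAbs :=
    Finset.le_sup (f := fun j => (x j).natAbs) (Finset.mem_univ j)
  have h2 : (Finset.univ.sup fun j => (x j).natAbs) ≤ radius S :=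
    Finset.le_sup (f := fun x : Fin n → ℤ => Finset.univ.sup fun j => (x j).natAbs) hx
  rw [← Int.natCast_natAbs]
  exact_mod_cast h1.trans h2

/-- Input data and a bound for their size. -/
structure Input (d : ℕ) where
  n : ℕ
  m : ℕ
  N : ℕ
  P : Setting n d m
  add_le : n + m ≤ N
  gam_eq : P.gam = maxWeight d
  lam_eq : P.lam = (3 * N + 1) * maxWeight d + N + d + 4

end ConvexOpt

open ConvexOpt in
theorem theorem2p4 (d : ℕ) :
    ∃ A : ConvexOpt.Prog, ConvexOpt.SolvesInStronglyPolynomialTime d A := by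
  -- Both polynomials must precede the choice of an instance, so the bounds are taken over the type
  -- of all inputs: in `n + m` for the operations, and in the total size `N` for the bit cost.
  obtain ⟨p, hp⟩ := polyBounded_tMain (P := fun i : Input d => i.P.toEnv) (G := maxWeight d)
    (size := fun i => i.n + i.m) (mm := fun i => i.m) (fun i => i.gam_eq)
    (fun i => Nat.le_add_right _ _) fun i => Nat.le_add_left _ _
  obtain ⟨q, hq⟩ := (polyBounded_tMain (P := fun i : Input d => i.P.toEnv) (G := maxWeight d)
    (size := fun i => i.N) (mm := fun i => i.m) (fun i => i.gam_eq)
    (fun i => (Nat.le_add_right _ _).trans i.add_le)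
    fun i => (Nat.le_add_left _ _).trans i.add_le).mul
    (polyBounded_K (P := fun i : Input d => i.P.toEnv) (G := maxWeight d)
      (size := fun i => i.N) (fun i => i.gam_eq) (fun i => (Nat.le_add_right _ _).trans i.add_le)
      (by
        have c : ∀ k, PolyBounded (fun i : Input d => i.N) fun _ => k := PolyBounded.const
        have hN : PolyBounded (fun i : Input d => i.N) fun i => i.N :=
          PolyBounded.of_le fun _ => le_rfl
        exact (((((((c 3).mul hN).add (c 1)).mul (c (maxWeight d))).add hN).add (c d)).add
          (c 4)).mono fun i => i.lam_eq.le))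
  refine ⟨mainProg d, p, q, ?_⟩
  intro n m S w e c O hlin hE hc hcmp
  set N := n + m + intLen (radius S) + famLen w + famLen e with hN
  have hpow : ∀ k ≤ N, (2 : ℤ) ^ k ≤ 2 ^ N := fun k hk => pow_le_pow_right₀ (by norm_num) hk
  have hw : ∀ i j, |w i j| ≤ 2 ^ N := fun i j =>
    (abs_le_two_pow_famLen w i j).trans (hpow _ (by omega))
  have he : ∀ i j, |e i j| ≤ 2 ^ N := fun i j =>
    (abs_le_two_pow_famLen e i j).trans (hpow _ (by omega))
  -- The radius appears in the analysis only: it bounds the answers of the oracle, while the program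
  -- never sees it.
  have hSb : ∀ x ∈ S, ∀ j, |x j| ≤ 2 ^ N := fun x hx j =>
    (abs_le_radius hx j).trans ((le_abs_self _).trans
      ((abs_le_two_pow_intLen _).trans (hpow _ (by omega))))
  let P : Setting n d m := Setting.ofSize N w e O (by omega) hw he
  have hNl : ∀ z : ℤ, |z| ≤ 2 ^ N → |z| ≤ 2 ^ P.lam := fun z hz =>
    hz.trans (pow_le_pow_right₀ (by norm_num)
      (show N ≤ (3 * N + 1) * maxWeight d + N + d + 4 by omega))
  obtain ⟨s', σ', t, b, hrun, hrep, hout, ht, hb⟩ := Setting.ex_main (P := P) (σ := initialCfg w e)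
    hlin hE hc hcmp hSb (by simp [initialCfg]) (by simp [initialCfg]) (by simp [initialCfg])
    (by simp [initialCfg])
    (fun i j => by
      have := initialCfg_mem w e (Fin.castAdd m i) j
      rwa [Fin.append_left] at this)
    (fun k j => by
      have := initialCfg_mem w e (Fin.natAdd d k) j
      rwa [Fin.append_right] at this)
    (inputState w e)
    (rep_initialCfg w e P.dim_le P.num_le (fun i j => hNl _ (hw i j)) fun i j => hNl _ (he i j))
  let i : Input d := ⟨n, m, N, P, by omega, rfl, rfl⟩
  refine ⟨s', t, b, hrun, ?_, ht.trans (hp i), hb.trans ((Nat.mul_le_mul_right _ ht).trans (hq i))⟩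
  have h0 : s'.reg 0 = (σ'.reg .dim : ℚ) := hrep.reg .dim
  rcases hout with ⟨h1, x, hx, hm, hopt⟩ | ⟨h1, hno⟩
  · refine Or.inl ⟨by rw [h0, h1]; simp, x, hx, ?_, hopt⟩
    funext j
    simp only [State.readVec]
    rw [hrep.mem, zero_add, hm]
  · exact Or.inr ⟨by rw [h0, h1]; simp, hno⟩
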